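/- **Theorem (output/data relation, generalized).** Consider the innovation-form system $$x(t+1)=Ax(t)+Bu(t)+Ke(t),\qquad y(t)=Cx(t)+Du(t)+e(t),\qquad t\in\mathbb Z,$$ with $x(t)\in\mathbb R^n$, $u(t)\in\mathbb R^m$, $y(t),e(t)\in\mathbb R^p$, where all eigenvalues of $A$ and of $A-KC$ lie strictly inside the unit circle. The training data come from this system in steady state ($x$ has bounded second moments) and in open loop, under the following conditions. * $e$ is an innovation process with positive definite variance $V=\mathrm{Var}\{e(t)\}>0$: conditionally on $\{u(s)\}_{s\in\mathbb Z}$ and $\{e(s)\}_{s<t}$, $e(t)$ has mean $0$ and variance $V$; its fourth moments are bounded. * $u$ is wide-sense stationary with a spectral density $\Phi$ that is bounded away from zero ($\Phi(\theta)\ge cI$ for almost every $\theta$, with $c>0$; so it has full rank). * $u$ has finite fourth moments and is second-order ergodic in mean square: for every $N\ge1$ the variance of $\frac1N\sum_{j=0}^{N-1}u_a(t+j)u_b(t+j+s)$ is at most $\delta_N$ for all $t,s,a,b$, with $\delta_N\to0$. For a signal $w$ let $W_{[t_0,t_1],N}$ be the block Hankel matrix with $N$ columns whose $(i,j)$ block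 is $w(t_0+i+j)/\sqrt N$, $0\le i\le t_1-t_0$, $0\le j<N$. Let $z=(u,y)$. For the past horizon $\rho$ and the fixed future horizon $T$ set $Z_P=Z_{[0,\rho-1],N}$, $U_F=U_{[\rho,\rho+T-1],N}$, $Y_F=Y_{[\rho,\rho+T-1],N}$, and let $\hat Y_F$ be the orthogonal projection of the rows of $Y_F$ onto the row span of $\begin{bmatrix}Z_P\\U_F\end{bmatrix}$. The past horizon is a deterministic sequence $\rho=\rho_N$ with $\rho_N^3=O(N)$ and $\rho_N^3\delta_N=O(1)$. Let $z_{init}=(z(t-\rho),\dots,z(t-1))$ be any window of past inputs and outputs of the system, let $\xi=x(t-\rho)$ be the state at its beginning and $x_{init}=x(t)$ the state that the system equations then determine at its end. Let $u_f=(u(t),\dots,u(t+T-1))$ be any future input, and let $y_f^d=(y^d(t),\dots,y^d(t+T-1))$ be the mean of the future output (the expectation over the future noise, given $x_{init}$ and $u_f$). Let $\alpha^\star$ be the minimum-norm solution of $$\begin{bmatrix}z_{init}\\u_f\end{bmatrix}=\begin{bmatrix}Z_P\\U_F\end{bmatrix}\alpha .$$ 1. If $\|(A-KC)^{\rho_N}\|=o(1/\sqrt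 N)$, then $y_f^d=\hat Y_F\,\alpha^\star+O_P(1/\sqrt N)$. 2. Without this condition, for instance for a fixed $\rho$, $y_f^d=\hat Y_F\,\alpha^\star+O_P\big(1/\sqrt N+\|(A-KC)^{\rho_N}\|\big)$. Here $O_P(r_N)$ means: for every $\varepsilon>0$ there are $M$ and $N_0$ such that for all $N\ge N_0$ and all $t,\xi,z_{init},u_f$, with probability at least $1-\varepsilon$ (with respect to the training data) $\alpha^\star$ exists and $\|y_f^d-\hat Y_F\alpha^\star\|\le M\,r_N\,(\|\xi\|+\|z_{init}\|+\|u_f\|)$, in Euclidean norms. -/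

import Mathlib

open MeasureTheory ProbabilityTheory Filter
open scoped Matrix Matrix.Norms.L2Operator ComplexOrder Topology

noncomputable section

/-- Euclidean norm of a finite real vector. -/
def l2 {ι : Type*} [Fintype ι] (v : ι → ℝ) : ℝ :=
  ‖(WithLp.toLp 2 v : EuclideanSpace ℝ ι)‖

/-- The matrices of a linear system in innovation form,
`x(t+1) = A x(t) + B u(t) + K e(t)`, `y(t) = C x(t) + D u(t) + e(t)`,
with `n` states, `m` inputs and `p` outputs. -/
structure InnovModel (n m p : ℕ) where
  A : Matrix (Fin n) (Fin n) ℝ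
  B : Matrix (Fin n) (Fin m) ℝ
  C : Matrix (Fin p) (Fin n) ℝ
  D : Matrix (Fin p) (Fin m) ℝ
  K : Matrix (Fin n) (Fin p) ℝ

namespace InnovModel

variable {n m p : ℕ}

/-- State update. -/
def next (S : InnovModel n m p) (x : Fin n → ℝ) (u : Fin m → ℝ) (e : Fin p → ℝ) : Fin n → ℝ :=
  S.A *ᵥ x + S.B *ᵥ u + S.K *ᵥ e

/-- Output map. -/
def out (S : InnovModel n m p) (x : Fin n → ℝ) (u : Fin m → ℝ) (e : Fin p → ℝ) : Fin p → ℝ :=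
  S.C *ᵥ x + S.D *ᵥ u + e

/-- State at time `t` of the trajectory which is in state `ξ` at time `t - ρ` and whose inputs and
outputs on `[t - ρ, t - 1]` are the window `z`; the innovations on this interval are the ones forced
by the output equation, `e(k) = y(k) - C x(k) - D u(k)`. -/
def stateAfter (S : InnovModel n m p) (ξ : Fin n → ℝ) :
    (ρ : ℕ) → (Fin ρ × (Fin m ⊕ Fin p) → ℝ) → Fin n → ℝ
  | 0, _ => ξ
  | ρ + 1, z =>
    let x := S.stateAfter ξ ρ (fun q => z (q.1.castSucc, q.2))
    let u : Fin m → ℝ := fun a => z (Fin.last ρ, Sum.inl a)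
    let y : Fin p → ℝ := fun b => z (Fin.last ρ, Sum.inr b)
    S.next x u (y - S.C *ᵥ x - S.D *ᵥ u)

/-- State `k` steps after `x₀`, under the inputs `u` and the noise `ε`. -/
def futureState (S : InnovModel n m p) (x₀ : Fin n → ℝ) (u : ℕ → Fin m → ℝ) (ε : ℕ → Fin p → ℝ) :
    ℕ → Fin n → ℝ
  | 0 => x₀
  | k + 1 => S.next (S.futureState x₀ u ε k) (u k) (ε k)

/-- Output `k` steps after the state was `x₀`, under the inputs `u` and the noise `ε`. -/
def futureOutput (S : InnovModel n m p) (x₀ : Fin n → ℝ) (u : ℕ → Fin m → ℝ) (ε : ℕ → Fin p → ℝ)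
    (k : ℕ) : Fin p → ℝ :=
  S.out (S.futureState x₀ u ε k) (u k) (ε k)

/-- The "deterministic" output `y_f^d = (y^d(t), …, y^d(t+T-1))`: the expectation, over the noise
`e(t), e(t+1), …`, of the output that starts from `x(t) = xinit` under the inputs `uf`. -/
def meanOutput (S : InnovModel n m p) {Ω : Type*} [MeasurableSpace Ω] (μ : Measure Ω)
    (e : ℤ → Ω → Fin p → ℝ) (t : ℤ) (T : ℕ) (xinit : Fin n → ℝ) (uf : Fin T × Fin m → ℝ) :
    Fin T × Fin p → ℝ :=
  fun q => ∫ ω, S.futureOutput xinit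
    (fun k a => if h : k < T then uf (⟨k, h⟩, a) else 0) (fun k => e (t + k) ω) q.1 q.2 ∂μ

end InnovModel

/-- All eigenvalues lie strictly inside the unit circle. -/
def SchurStable {n : ℕ} (A : Matrix (Fin n) (Fin n) ℝ) : Prop :=
  ∀ l ∈ spectrum ℂ (A.map (fun r : ℝ => (r : ℂ))), ‖l‖ < 1

/-- Block Hankel matrix with `L` block rows and `N` columns, scaled by `1 / √N`:
its `(i, j)` block is `w(t₀ + i + j) / √N`. -/
def hankel {ι : Type*} (w : ℤ → ι → ℝ) (t₀ : ℤ) (L N : ℕ) : Matrix (Fin L × ι) (Fin N) ℝ :=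
  Matrix.of fun q j => w (t₀ + (q.1 : ℕ) + (j : ℕ)) q.2 / √(N : ℝ)

/-- Orthogonal projection of every row of `B` onto the row span of `A`. -/
def rowProj {κ ι : Type*} {N : ℕ} (A : Matrix κ (Fin N) ℝ) (B : Matrix ι (Fin N) ℝ) :
    Matrix ι (Fin N) ℝ :=
  Matrix.of fun i => WithLp.ofLp
    ((Submodule.span ℝ (Set.range fun k => (WithLp.toLp 2 (A k) : EuclideanSpace ℝ (Fin N)))).starProjection
      (WithLp.toLp 2 (B i)))

/-- `α` is a solution of `W α = w` of minimal Euclidean norm. -/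
def IsMinNormSolution {κ : Type*} {N : ℕ} (W : Matrix κ (Fin N) ℝ) (w : κ → ℝ) (α : Fin N → ℝ) :
    Prop :=
  W *ᵥ α = w ∧ ∀ β : Fin N → ℝ, W *ᵥ β = w → l2 α ≤ l2 β

/-- The stacked matrix `[Z_P; U_F]` of past inputs and outputs and of future inputs. -/
def regressor {m p : ℕ} (u : ℤ → Fin m → ℝ) (y : ℤ → Fin p → ℝ) (ρ T N : ℕ) :
    Matrix ((Fin ρ × (Fin m ⊕ Fin p)) ⊕ (Fin T × Fin m)) (Fin N) ℝ :=
  Matrix.fromRows (hankel (fun t => Sum.elim (u t) (y t)) 0 ρ N) (hankel u ρ T N)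

/-- `Ŷ_F`, the projection of `Y_F` onto the row span of `[Z_P; U_F]`. -/
def projOutput {m p : ℕ} (u : ℤ → Fin m → ℝ) (y : ℤ → Fin p → ℝ) (ρ T N : ℕ) :
    Matrix (Fin T × Fin p) (Fin N) ℝ :=
  rowProj (regressor u y ρ T N) (hankel y ρ T N)

section Stochastic

variable {Ω : Type*} [MeasurableSpace Ω]

/-- The information generated by the whole input process and by the noise before time `t`. -/
@[reducible] def history {m p : ℕ} (u : ℤ → Ω → Fin m → ℝ) (e : ℤ → Ω → Fin p → ℝ) (t : ℤ) :
    MeasurableSpace Ω :=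
  (⨆ s : ℤ, MeasurableSpace.comap (u s) inferInstance) ⊔
    ⨆ s : {s : ℤ // s < t}, MeasurableSpace.comap (e s) inferInstance

/-- `e` is an innovation process with variance `V` in open loop with the input `u`: given the
past of `e` and the whole input, `e(t)` has mean `0` and variance `V`; its fourth moments are
bounded. -/
structure IsInnovation {m p : ℕ} (μ : Measure Ω) (u : ℤ → Ω → Fin m → ℝ) (e : ℤ → Ω → Fin p → ℝ)
    (V : Matrix (Fin p) (Fin p) ℝ) : Prop where
  measurable : ∀ t, Measurable (e t)
  memLp : ∀ t a, MemLp (fun ω => e t ω a) 4 μ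
  fourth_moment : ∃ κ : ℝ, ∀ t a, ∫ ω, e t ω a ^ 4 ∂μ ≤ κ
  condMean : ∀ t a, μ[fun ω => e t ω a | history u e t] =ᵐ[μ] fun _ => 0
  condVar : ∀ t a b, μ[fun ω => e t ω a * e t ω b | history u e t] =ᵐ[μ] fun _ => V a b

/-- `u` is wide-sense stationary with spectral density `Φ`. -/
structure HasSpectralDensity {m : ℕ} (μ : Measure Ω) (u : ℤ → Ω → Fin m → ℝ)
    (Φ : ℝ → Matrix (Fin m) (Fin m) ℂ) : Prop where
  memLp : ∀ t a, MemLp (fun ω => u t ω a) 2 μ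
  mean : ∀ t a, ∫ ω, u t ω a ∂μ = ∫ ω, u 0 ω a ∂μ
  integrable : ∀ a b, IntervalIntegrable (fun θ => Φ θ a b) volume (-Real.pi) Real.pi
  autocov : ∀ (t k : ℤ) (a b : Fin m),
    ((cov[fun ω => u (t + k) ω a, fun ω => u t ω b; μ] : ℝ) : ℂ) =
      (1 / (2 * Real.pi)) *
        ∫ θ in (-Real.pi)..Real.pi, Complex.exp (Complex.I * k * θ) * Φ θ a b

/-- The spectral density is bounded away from zero: `Φ(θ) ≥ c I` with `c > 0`. In particular it has
full rank. -/
def BoundedAwayFromZero {m : ℕ} (Φ : ℝ → Matrix (Fin m) (Fin m) ℂ) : Prop :=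
  ∃ c : ℝ, 0 < c ∧ ∀ᵐ θ ∂(volume.restrict (Set.Ioc (-Real.pi) Real.pi)),
    (Φ θ - (c : ℂ) • (1 : Matrix (Fin m) (Fin m) ℂ)).PosSemidef

/-- Second-order ergodicity of `u` in mean square: the sample autocovariances over `N` samples have
variance at most `δ N`, uniformly in the lag, and `δ N → 0`. -/
structure SecondOrderErgodic {m : ℕ} (μ : Measure Ω) (u : ℤ → Ω → Fin m → ℝ) (δ : ℕ → ℝ) :
    Prop where
  memLp : ∀ t a, MemLp (fun ω => u t ω a) 4 μ
  variance_le : ∀ (t s : ℤ) (N : ℕ) (a b : Fin m), 1 ≤ N →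
    Var[fun ω => (∑ j ∈ Finset.range N, u (t + j) ω a * u (t + j + s) ω b) / N; μ] ≤ δ N
  tendsto : Tendsto δ atTop (𝓝 0)

/-- `(u, y)` are the input and the output of the system `S`, running on all of `ℤ` with noise `e`,
in its steady state: the state `x` has bounded second moments. -/
structure IsSteadyState {n m p : ℕ} (S : InnovModel n m p) (μ : Measure Ω)
    (x : ℤ → Ω → Fin n → ℝ) (u : ℤ → Ω → Fin m → ℝ) (y e : ℤ → Ω → Fin p → ℝ) : Prop where
  memLp : ∀ t i, MemLp (fun ω => x t ω i) 2 μ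
  bounded : ∃ κ : ℝ, ∀ t i, ∫ ω, x t ω i ^ 2 ∂μ ≤ κ
  state : ∀ t, ∀ᵐ ω ∂μ, x (t + 1) ω = S.next (x t ω) (u t ω) (e t ω)
  output : ∀ t, ∀ᵐ ω ∂μ, y t ω = S.out (x t ω) (u t ω) (e t ω)

/-- `y_f^d = Ŷ_F α⋆ + O_P(r_N)` for windows of length `ρ_N`, with `α⋆` the minimum-norm solution of
`[z_init; u_f] = [Z_P; U_F] α`. The data of the online experiment are the state `ξ` at time `t - ρ`,
the window `zinit` on `[t - ρ, t - 1]` and the input `uf` on `[t, t + T - 1]`; the bound is uniform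
in them, up to their size. That `α⋆` exists, with probability tending to one, is part of it. -/
def PredictionErrorBigOP {n m p : ℕ} (S : InnovModel n m p) (μ : Measure Ω)
    (u : ℤ → Ω → Fin m → ℝ) (y e : ℤ → Ω → Fin p → ℝ) (T : ℕ) (ρ : ℕ → ℕ) (r : ℕ → ℝ) : Prop :=
  ∀ ε : ℝ, 0 < ε → ∃ M : ℝ, ∃ N₀ : ℕ, ∀ N : ℕ, N₀ ≤ N →
    ∀ (t : ℤ) (ξ : Fin n → ℝ) (zinit : Fin (ρ N) × (Fin m ⊕ Fin p) → ℝ) (uf : Fin T × Fin m → ℝ),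
      μ {ω | ¬ ∃ α : Fin N → ℝ,
        IsMinNormSolution (regressor (fun s => u s ω) (fun s => y s ω) (ρ N) T N)
          (Sum.elim zinit uf) α ∧
        l2 (S.meanOutput μ e t T (S.stateAfter ξ (ρ N) zinit) uf
            - projOutput (fun s => u s ω) (fun s => y s ω) (ρ N) T N *ᵥ α)
          ≤ M * r N * (l2 ξ + l2 zinit + l2 uf)} ≤ ENNReal.ofReal ε

end Stochastic

end

/-!
A solution `α` of `[z_init; u_f] = [Z_P; U_F] α` combines recorded trajectories of the system into one
with the window and the input of the online experiment. By linearity the mean future output and the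
combination `Y_F α` differ only by a fixed linear function of
`(A - K C) ^ ρ (ξ - X₀ α)` and of `E_F α`, where `X₀` holds the states at the beginning of the recorded
windows and `E_F` the future noise (`IsTrajectory.mean_sub_hankel_mulVec`). The minimum-norm solution
lies in the row span of `W = [Z_P; U_F]`, where `Ŷ_F` and `Y_F` act alike, so it remains to bound `α`
and `E_F α`.

Let `Σ` be the mean of the Gram matrix `W Wᵀ` and `w = (z_init, u_f)`. Then `α = Wᵀ g` with
`W Wᵀ g = w`, and with `Σ v = w`
`E_F α = E_F Wᵀ v + E_F Wᵀ (g - v)`, `‖g - v‖ = O(‖W Wᵀ - Σ‖ ‖v‖)`.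
The first term has a fixed vector `v`, so by the martingale property of the noise its second moment is
`O(vᵀ Σ v / N) = O(‖w‖² / N)`, whatever the number `d = O(ρ + 1)` of rows of `W`. In the second term
`‖E_F Wᵀ‖² = O_P(d / N)` and `‖W Wᵀ - Σ‖² = O_P(d² (δ_N + 1 / N))` in Frobenius norm, and the growth
conditions on `ρ` say that `d³ (δ_N + 1 / N)` is bounded, which gives `O_P(1 / √N)` again. The same
estimates give `‖W Wᵀ - Σ‖ → 0`, hence the existence of `α` and a bound for it.

Two facts about the recorded data carry these estimates. The matrix `Σ` is coercive uniformly in `ρ`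
(`IsOpenLoop.exists_dataCov_coercive`), and its sample version fluctuates by `O(δ_N + 1 / N)` in
variance, entry by entry (`IsOpenLoop.exists_variance_io_le`). Both rest on rewriting a weighted sum of
inputs and outputs as a weighted sum of inputs and noise, whose weights come from an adjoint state
(`InnovModel.sum_weight_eq`). Stability of `A` makes the remainder, a state in the remote past, vanish
as the expansion is prolonged. Stability of `A - K C` bounds the original weights by the new ones in
`ℓ²` (`InnovModel.exists_sum_weight_sq_le`), and the new ones are bounded by the second moment of the
sum because of the lower bound on the spectral density and because the noise is white and orthogonal to
the input. The outputs are not assumed to have fourth moments: fluctuations are computed for the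
truncated expansions and passed to the limit by Fatou's lemma.
-/

noncomputable section

/-! ### The Euclidean norm of coordinate vectors -/

section EuclideanNorm

variable {ι κ : Type*} [Fintype ι] [Fintype κ]

lemma l2_nonneg (v : ι → ℝ) : 0 ≤ l2 v := norm_nonneg _

lemma l2_sq (v : ι → ℝ) : l2 v ^ 2 = ∑ i, v i ^ 2 := by
  simp [l2, EuclideanSpace.norm_sq_eq]

lemma l2_sq_eq_dotProduct (v : ι → ℝ) : l2 v ^ 2 = v ⬝ᵥ v := by
  rw [l2_sq]
  exact Finset.sum_congr rfl fun i _ => sq (v i)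

lemma l2_add_le (v w : ι → ℝ) : l2 (v + w) ≤ l2 v + l2 w := by
  simp only [l2, WithLp.toLp_add]
  exact norm_add_le _ _

lemma l2_neg (v : ι → ℝ) : l2 (-v) = l2 v := by
  simp [l2, WithLp.toLp_neg]

lemma l2_sub_le (v w : ι → ℝ) : l2 (v - w) ≤ l2 v + l2 w := by
  rw [sub_eq_add_neg, ← l2_neg w]
  exact l2_add_le _ _

lemma l2_sumElim_le (v : ι → ℝ) (w : κ → ℝ) : l2 (Sum.elim v w) ≤ l2 v + l2 w := by
  refine abs_le_of_sq_le_sq' ?_ (add_nonneg (l2_nonneg _) (l2_nonneg _)) |>.2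
  have h : l2 (Sum.elim v w) ^ 2 = l2 v ^ 2 + l2 w ^ 2 := by
    simp [l2_sq, Fintype.sum_sum_type]
  nlinarith [l2_nonneg v, l2_nonneg w]

lemma dotProduct_le_l2 (v w : ι → ℝ) : v ⬝ᵥ w ≤ l2 v * l2 w := by
  refine abs_le_of_sq_le_sq' ?_ (mul_nonneg (l2_nonneg _) (l2_nonneg _)) |>.2
  rw [mul_pow, l2_sq, l2_sq]
  exact Finset.sum_mul_sq_le_sq_mul_sq _ _ _

lemma l2_mulVec_le [DecidableEq κ] (M : Matrix ι κ ℝ) (v : κ → ℝ) :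
    l2 (M *ᵥ v) ≤ ‖M‖ * l2 v :=
  Matrix.l2_opNorm_mulVec M (WithLp.toLp 2 v)

lemma l2_mulVec_sq_le (M : Matrix ι κ ℝ) (v : κ → ℝ) :
    l2 (M *ᵥ v) ^ 2 ≤ (∑ i, ∑ j, M i j ^ 2) * l2 v ^ 2 := by
  rw [l2_sq, l2_sq, Finset.sum_mul]
  exact Finset.sum_le_sum fun i _ => Finset.sum_mul_sq_le_sq_mul_sq _ _ _

lemma l2_mulVec_le_sqrt (M : Matrix ι κ ℝ) (v : κ → ℝ) :
    l2 (M *ᵥ v) ≤ √(∑ i, ∑ j, M i j ^ 2) * l2 v := by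
  refine abs_le_of_sq_le_sq' ?_ (mul_nonneg (Real.sqrt_nonneg _) (l2_nonneg _)) |>.2
  have h0 : 0 ≤ ∑ i, ∑ j, M i j ^ 2 :=
    Finset.sum_nonneg fun i _ => Finset.sum_nonneg fun j _ => sq_nonneg _
  rw [mul_pow, Real.sq_sqrt h0]
  exact l2_mulVec_sq_le M v

lemma abs_apply_le_l2 (v : ι → ℝ) (i : ι) : |v i| ≤ l2 v := by
  refine abs_le_of_sq_le_sq ?_ (l2_nonneg v)
  rw [l2_sq]
  exact Finset.single_le_sum (f := fun i => v i ^ 2) (fun i _ => sq_nonneg _) (Finset.mem_univ i)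

lemma l2_le_sum_abs (v : ι → ℝ) : l2 v ≤ ∑ i, |v i| := by
  refine abs_le_of_sq_le_sq' ?_ (Finset.sum_nonneg fun i _ => abs_nonneg _) |>.2
  rw [l2_sq]
  calc ∑ i, v i ^ 2 = ∑ i, |v i| ^ 2 := by simp
    _ ≤ (∑ i, |v i|) ^ 2 := Finset.sum_sq_le_sq_sum_of_nonneg fun i _ => abs_nonneg _

/-- A linear map between spaces of coordinate vectors is bounded. -/
lemma exists_l2_le_of_linear {E : Type*} [AddCommGroup E] [Module ℝ E]
    (i : (ι → ℝ) →ₗ[ℝ] E) (f : E →ₗ[ℝ] (κ → ℝ)) :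
    ∃ C : ℝ, 0 ≤ C ∧ ∀ v, l2 (f (i v)) ≤ C * l2 v := by
  classical
  refine ⟨‖LinearMap.toMatrix' (f ∘ₗ i)‖, norm_nonneg _, fun v => ?_⟩
  have := l2_mulVec_le (LinearMap.toMatrix' (f ∘ₗ i)) v
  rwa [LinearMap.toMatrix'_mulVec] at this

end EuclideanNorm

/-! ### Trajectories of the system as linear functions of their data -/

namespace InnovModel

variable {n m p : ℕ} (S : InnovModel n m p)

/-- The state at the end of a window, as a linear map of the initial state and the window. -/
def stateAfterLin (ρ : ℕ) :
    ((Fin n → ℝ) × (Fin ρ × (Fin m ⊕ Fin p) → ℝ)) →ₗ[ℝ] (Fin n → ℝ) where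
  toFun a := S.stateAfter a.1 ρ a.2
  map_add' a b := by
    induction ρ with
    | zero => rfl
    | succ ρ ih =>
      have h := ih (a.1, fun q => a.2 (q.1.castSucc, q.2)) (b.1, fun q => b.2 (q.1.castSucc, q.2))
      simp only [Prod.mk_add_mk] at h
      simp only [stateAfter, next, Prod.fst_add, Prod.snd_add, Pi.add_apply]
      have e1 : (fun q : Fin ρ × (Fin m ⊕ Fin p) => a.2 (q.1.castSucc, q.2) + b.2 (q.1.castSucc, q.2))
        = (fun q => a.2 (q.1.castSucc, q.2)) + fun q => b.2 (q.1.castSucc, q.2) := rfl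
      have e2 : (fun c => a.2 (Fin.last ρ, Sum.inl c) + b.2 (Fin.last ρ, Sum.inl c))
        = (fun c => a.2 (Fin.last ρ, Sum.inl c)) + fun c => b.2 (Fin.last ρ, Sum.inl c) := rfl
      have e3 : (fun c => a.2 (Fin.last ρ, Sum.inr c) + b.2 (Fin.last ρ, Sum.inr c))
        = (fun c => a.2 (Fin.last ρ, Sum.inr c)) + fun c => b.2 (Fin.last ρ, Sum.inr c) := rfl
      rw [e1, e2, e3, h]
      simp only [Matrix.mulVec_add, Matrix.mulVec_sub]
      abel
  map_smul' c a := by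
    induction ρ with
    | zero => rfl
    | succ ρ ih =>
      have h := ih (a.1, fun q => a.2 (q.1.castSucc, q.2))
      simp only [Prod.smul_mk, RingHom.id_apply] at h
      simp only [stateAfter, next, Prod.smul_fst, Prod.smul_snd, Pi.smul_apply, RingHom.id_apply]
      have e1 : (fun q : Fin ρ × (Fin m ⊕ Fin p) => c • a.2 (q.1.castSucc, q.2))
        = c • fun q => a.2 (q.1.castSucc, q.2) := rfl
      have e2 : (fun i => c • a.2 (Fin.last ρ, Sum.inl i))
        = c • fun i => a.2 (Fin.last ρ, Sum.inl i) := rfl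
      have e3 : (fun i => c • a.2 (Fin.last ρ, Sum.inr i))
        = c • fun i => a.2 (Fin.last ρ, Sum.inr i) := rfl
      rw [e1, e2, e3, h]
      simp only [Matrix.mulVec_smul, Matrix.mulVec_sub, smul_add, smul_sub]

@[simp] lemma stateAfterLin_apply (ρ : ℕ) (a) : S.stateAfterLin ρ a = S.stateAfter a.1 ρ a.2 := rfl

/-- Against a zero window the state evolves with the closed-loop matrix `A - K C` of the predictor. -/
lemma stateAfter_zero (ξ : Fin n → ℝ) (ρ : ℕ) :
    S.stateAfter ξ ρ 0 = (S.A - S.K * S.C) ^ ρ *ᵥ ξ := by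
  induction ρ with
  | zero => simp [stateAfter]
  | succ ρ ih =>
    have ih' : S.stateAfter ξ ρ (fun _ => 0) = (S.A - S.K * S.C) ^ ρ *ᵥ ξ := ih
    simp only [stateAfter, next, Pi.zero_apply, ih']
    rw [pow_succ', ← Matrix.mulVec_mulVec]
    have hz : ∀ k : ℕ, (fun _ : Fin k => (0 : ℝ)) = 0 := fun _ => rfl
    generalize (S.A - S.K * S.C) ^ ρ *ᵥ ξ = v
    simp only [hz, Matrix.mulVec_zero, add_zero, sub_zero, zero_sub, Matrix.mulVec_neg,
      Matrix.sub_mulVec, Matrix.mulVec_mulVec, ← sub_eq_add_neg]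

/-- Extension by zero of a finite sequence of vectors. -/
def extendZero {T k : ℕ} (w : Fin T × Fin k → ℝ) : ℕ → Fin k → ℝ :=
  fun i a => if h : i < T then w (⟨i, h⟩, a) else 0

/-- The outputs on a horizon of length `T`, as a linear map of the initial state, the inputs and the
noise. -/
def futureLin (T : ℕ) :
    ((Fin n → ℝ) × (Fin T × Fin m → ℝ) × (Fin T × Fin p → ℝ)) →ₗ[ℝ] (Fin T × Fin p → ℝ) where
  toFun a q := S.futureOutput a.1 (extendZero a.2.1) (extendZero a.2.2) q.1 q.2
  map_add' a b := by
    have hext : ∀ {k : ℕ} (v w : Fin T × Fin k → ℝ) (i : ℕ),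
        extendZero (v + w) i = extendZero v i + extendZero w i := by
      intro k v w i; ext c; simp only [extendZero, Pi.add_apply]; split_ifs <;> simp
    have hstate : ∀ k, S.futureState (a + b).1 (extendZero (a + b).2.1) (extendZero (a + b).2.2) k
        = S.futureState a.1 (extendZero a.2.1) (extendZero a.2.2) k
          + S.futureState b.1 (extendZero b.2.1) (extendZero b.2.2) k := by
      intro k
      induction k with
      | zero => rfl
      | succ k ih =>
        simp only [futureState, next, ih, Matrix.mulVec_add]
        simp only [Prod.fst_add, Prod.snd_add, hext, Matrix.mulVec_add]
        abel
    ext q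
    simp only [futureOutput, hstate, out]
    simp only [Prod.snd_add, Prod.fst_add, hext, Matrix.mulVec_add, Pi.add_apply]
    ring
  map_smul' c a := by
    have hext : ∀ {k : ℕ} (v : Fin T × Fin k → ℝ) (i : ℕ),
        extendZero (c • v) i = c • extendZero v i := by
      intro k v i; ext c; simp only [extendZero, Pi.smul_apply]; split_ifs <;> simp
    have hstate : ∀ k, S.futureState (c • a).1 (extendZero (c • a).2.1) (extendZero (c • a).2.2) k
        = c • S.futureState a.1 (extendZero a.2.1) (extendZero a.2.2) k := by
      intro k
      induction k with
      | zero => rfl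
      | succ k ih =>
        simp only [futureState, next, ih, Matrix.mulVec_smul, smul_add]
        simp only [Prod.smul_fst, Prod.smul_snd, hext, Matrix.mulVec_smul]
    ext q
    simp only [futureOutput, hstate, out]
    simp only [Prod.smul_snd, Prod.smul_fst, hext, Matrix.mulVec_smul, Pi.smul_apply, Pi.add_apply,
      RingHom.id_apply, smul_eq_mul]
    ring

lemma futureLin_apply (T : ℕ) (a) (q : Fin T × Fin p) :
    S.futureLin T a q = S.futureOutput a.1 (extendZero a.2.1) (extendZero a.2.2) q.1 q.2 := rfl

/-- The output at step `k` depends only on the inputs and the noise up to step `k`. -/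
lemma futureOutput_congr {x₀ : Fin n → ℝ} {u u' : ℕ → Fin m → ℝ} {ε ε' : ℕ → Fin p → ℝ} {k : ℕ}
    (hu : ∀ i ≤ k, u i = u' i) (hε : ∀ i ≤ k, ε i = ε' i) :
    S.futureOutput x₀ u ε k = S.futureOutput x₀ u' ε' k := by
  have h : ∀ i ≤ k, S.futureState x₀ u ε i = S.futureState x₀ u' ε' i := by
    intro i hi
    induction i with
    | zero => rfl
    | succ i ih =>
      simp only [futureState, ih (by omega), hu i (by omega), hε i (by omega)]
  simp only [futureOutput, h k le_rfl, hu k le_rfl, hε k le_rfl]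

/-- `(x, u, y, e)` satisfies the system equations at all times. -/
structure IsTrajectory (x : ℤ → Fin n → ℝ) (u : ℤ → Fin m → ℝ) (y e : ℤ → Fin p → ℝ) : Prop where
  state : ∀ t, x (t + 1) = S.next (x t) (u t) (e t)
  output : ∀ t, y t = S.out (x t) (u t) (e t)

variable {S} {x : ℤ → Fin n → ℝ} {u : ℤ → Fin m → ℝ} {y e : ℤ → Fin p → ℝ}

lemma IsTrajectory.stateAfter_eq (h : S.IsTrajectory x u y e) (t : ℤ) (ρ : ℕ) :
    S.stateAfter (x t) ρ (fun q => Sum.elim (u (t + (q.1 : ℕ))) (y (t + (q.1 : ℕ))) q.2)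
      = x (t + ρ) := by
  induction ρ with
  | zero => simp [stateAfter]
  | succ ρ ih =>
    simp only [stateAfter, Fin.val_castSucc, ih, Fin.val_last, Sum.elim_inl, Sum.elim_inr]
    have h1 : (fun b => y (t + ρ) b) - S.C *ᵥ x (t + ρ) - S.D *ᵥ (fun a => u (t + ρ) a)
        = e (t + ρ) := by
      have := h.output (t + ρ)
      simp only [out] at this
      change y (t + ρ) - S.C *ᵥ x (t + ρ) - S.D *ᵥ u (t + ρ) = _
      rw [this]; abel
    rw [h1]
    push_cast
    rw [← add_assoc, h.state]

lemma IsTrajectory.futureOutput_eq (h : S.IsTrajectory x u y e) (t : ℤ) (k : ℕ) :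
    S.futureOutput (x t) (fun i => u (t + i)) (fun i => e (t + i)) k = y (t + k) := by
  have hs : ∀ k : ℕ, S.futureState (x t) (fun i => u (t + i)) (fun i => e (t + i)) k
      = x (t + k) := by
    intro k
    induction k with
    | zero => simp [futureState]
    | succ k ih =>
      simp only [futureState, ih]
      push_cast
      rw [← add_assoc, h.state]
  simp only [futureOutput, hs, h.output]

/-- The states `x(0), …, x(N-1)`, scaled by `1 / √N`, as the columns of a matrix. -/
def initialStates (x : ℤ → Fin n → ℝ) (N : ℕ) : Matrix (Fin n) (Fin N) ℝ :=
  Matrix.of fun i j => x (j : ℕ) i / √(N : ℝ)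

/-- The columns of the future data matrix are produced by the system from those of the matrices of
initial states, past data, future inputs and future noise, hence so are their combinations. -/
lemma IsTrajectory.hankel_mulVec (h : S.IsTrajectory x u y e) (ρ T N : ℕ) (α : Fin N → ℝ) :
    hankel y ρ T N *ᵥ α =
      S.futureLin T (S.stateAfter (initialStates x N *ᵥ α) ρ
          (hankel (fun t => Sum.elim (u t) (y t)) 0 ρ N *ᵥ α),
        hankel u ρ T N *ᵥ α, hankel e ρ T N *ᵥ α) := by
  have hcol : ∀ {ι : Type} (w : ℤ → ι → ℝ) (t₀ : ℤ) (L : ℕ),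
      hankel w t₀ L N *ᵥ α
        = ∑ j : Fin N, (α j / √(N : ℝ)) • fun q : Fin L × ι => w (t₀ + (q.1 : ℕ) + (j : ℕ)) q.2 := by
    intro ι w t₀ L
    ext q
    simp only [hankel, Matrix.mulVec, dotProduct, Matrix.of_apply, Finset.sum_apply, Pi.smul_apply,
      smul_eq_mul]
    exact Finset.sum_congr rfl fun j _ => by ring
  have hini : initialStates x N *ᵥ α = ∑ j : Fin N, (α j / √(N : ℝ)) • x (j : ℕ) := by
    ext i
    simp only [initialStates, Matrix.mulVec, dotProduct, Matrix.of_apply, Finset.sum_apply,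
      Pi.smul_apply, smul_eq_mul]
    exact Finset.sum_congr rfl fun j _ => by ring
  have hstate : S.stateAfter (initialStates x N *ᵥ α) ρ
      (hankel (fun t => Sum.elim (u t) (y t)) 0 ρ N *ᵥ α)
      = ∑ j : Fin N, (α j / √(N : ℝ)) • x ((j : ℕ) + ρ) := by
    rw [hini, hcol]
    have hpair := map_sum (S.stateAfterLin ρ) (fun j : Fin N => (α j / √(N : ℝ)) •
      ((x (j : ℕ), fun q : Fin ρ × (Fin m ⊕ Fin p) =>
        Sum.elim (u (0 + (q.1 : ℕ) + (j : ℕ))) (y (0 + (q.1 : ℕ) + (j : ℕ))) q.2) :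
          (Fin n → ℝ) × (Fin ρ × (Fin m ⊕ Fin p) → ℝ))) Finset.univ
    rw [stateAfterLin_apply, Prod.fst_sum, Prod.snd_sum] at hpair
    simp only [Prod.smul_fst, Prod.smul_snd] at hpair
    rw [hpair]
    refine Finset.sum_congr rfl fun j _ => ?_
    rw [map_smul, stateAfterLin_apply, ← h.stateAfter_eq]
    have e1 : ∀ q : Fin ρ × (Fin m ⊕ Fin p), (0 : ℤ) + (q.1 : ℕ) + (j : ℕ) = (j : ℕ) + (q.1 : ℕ) :=
      fun q => by ring
    simp only [e1]
  rw [hstate, hcol, hcol, hcol]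
  have hpair := map_sum (S.futureLin T) (fun j : Fin N => (α j / √(N : ℝ)) •
      ((x ((j : ℕ) + ρ), (fun q : Fin T × Fin m => u (ρ + (q.1 : ℕ) + (j : ℕ)) q.2),
        fun q : Fin T × Fin p => e (ρ + (q.1 : ℕ) + (j : ℕ)) q.2) :
          (Fin n → ℝ) × (Fin T × Fin m → ℝ) × (Fin T × Fin p → ℝ))) Finset.univ
  have hsplit : ∑ j : Fin N, (α j / √(N : ℝ)) •
      ((x ((j : ℕ) + ρ), (fun q : Fin T × Fin m => u (ρ + (q.1 : ℕ) + (j : ℕ)) q.2),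
        fun q : Fin T × Fin p => e (ρ + (q.1 : ℕ) + (j : ℕ)) q.2) :
          (Fin n → ℝ) × (Fin T × Fin m → ℝ) × (Fin T × Fin p → ℝ))
      = (∑ j : Fin N, (α j / √(N : ℝ)) • x ((j : ℕ) + ρ),
        ∑ j : Fin N, (α j / √(N : ℝ)) • (fun q : Fin T × Fin m => u (ρ + (q.1 : ℕ) + (j : ℕ)) q.2),
        ∑ j : Fin N, (α j / √(N : ℝ)) •
          fun q : Fin T × Fin p => e (ρ + (q.1 : ℕ) + (j : ℕ)) q.2) := by
    refine Prod.ext ?_ (Prod.ext ?_ ?_) <;> simp [Prod.fst_sum, Prod.snd_sum]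
  rw [← hsplit, hpair]
  refine Finset.sum_congr rfl fun j _ => ?_
  rw [map_smul]
  congr 1
  ext q
  rw [futureLin_apply]
  have hq := h.futureOutput_eq ((j : ℕ) + ρ) q.1
  have e1 : ((ρ : ℤ) + (q.1 : ℕ) + (j : ℕ)) = (j : ℕ) + ρ + (q.1 : ℕ) := by ring
  rw [e1, ← hq]
  refine congrFun (S.futureOutput_congr (fun i hi => ?_) fun i hi => ?_) q.2
  · ext a
    simp only [extendZero, dif_pos (lt_of_le_of_lt hi q.1.2)]
    rw [show (ρ : ℤ) + i + (j : ℕ) = (j : ℕ) + ρ + i by ring]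
  · ext a
    simp only [extendZero, dif_pos (lt_of_le_of_lt hi q.1.2)]
    rw [show (ρ : ℤ) + i + (j : ℕ) = (j : ℕ) + ρ + i by ring]

/-- If `α` reproduces the window and the input of the online experiment, then the mean future output
and the same combination of the recorded future outputs differ only through the initial states,
damped by `(A - K C) ^ ρ`, and through the recorded future noise. -/
lemma IsTrajectory.mean_sub_hankel_mulVec (h : S.IsTrajectory x u y e) (ρ T N : ℕ)
    (α : Fin N → ℝ) (ξ : Fin n → ℝ) (zinit : Fin ρ × (Fin m ⊕ Fin p) → ℝ)
    (uf : Fin T × Fin m → ℝ) (hα : regressor u y ρ T N *ᵥ α = Sum.elim zinit uf) :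
    S.futureLin T (S.stateAfter ξ ρ zinit, uf, 0) - hankel y ρ T N *ᵥ α =
      S.futureLin T ((S.A - S.K * S.C) ^ ρ *ᵥ (ξ - initialStates x N *ᵥ α), 0,
        -(hankel e ρ T N *ᵥ α)) := by
  rw [regressor, Matrix.fromRows_mulVec] at hα
  obtain ⟨h1, h2⟩ := Sum.elim_eq_iff.mp hα
  rw [h.hankel_mulVec, ← map_sub, h1, h2]
  congr 1
  refine Prod.ext ?_ (Prod.ext ?_ ?_)
  · rw [← stateAfter_zero]
    have := map_sub (S.stateAfterLin ρ) (ξ, zinit) (initialStates x N *ᵥ α, zinit)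
    simp only [stateAfterLin_apply, Prod.mk_sub_mk, sub_self] at this
    exact this.symm
  · simp
  · simp

end InnovModel

/-! ### Minimum-norm solutions and perturbed Gram matrices -/

section GramMatrix

variable {ι κ : Type*} [Fintype κ]

lemma l2_le_of_coercive {M : Matrix κ κ ℝ} {c : ℝ} (hM : ∀ g, c * l2 g ^ 2 ≤ g ⬝ᵥ M *ᵥ g)
    (g : κ → ℝ) : c * l2 g ≤ l2 (M *ᵥ g) := by
  rcases (l2_nonneg g).eq_or_lt with h | h
  · rw [← h, mul_zero]; exact l2_nonneg _
  · have h1 := (hM g).trans (dotProduct_le_l2 _ _)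
    nlinarith

lemma exists_mulVec_eq_of_coercive {M : Matrix κ κ ℝ} {c : ℝ} (hc : 0 < c)
    (hM : ∀ g, c * l2 g ^ 2 ≤ g ⬝ᵥ M *ᵥ g) (w : κ → ℝ) : ∃ g, M *ᵥ g = w := by
  have hinj : Function.Injective M.mulVecLin := by
    rw [injective_iff_map_eq_zero]
    intro g hg
    have h1 := l2_le_of_coercive hM g
    rw [Matrix.mulVecLin_apply] at hg
    have h2 : l2 g = 0 := by
      have : l2 (0 : κ → ℝ) = 0 := by simp [l2]
      rw [hg, this] at h1
      nlinarith [l2_nonneg g]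
    ext i
    have := abs_apply_le_l2 g i
    rw [h2] at this
    simpa using this
  obtain ⟨g, hg⟩ := LinearMap.injective_iff_surjective.mp hinj w
  exact ⟨g, hg⟩

/-- If the Gram matrix of `W` is close to a coercive matrix `Σ`, then `W α = w` has a minimum-norm
solution `α = Wᵀ g`, its norm is controlled by that of `w`, and `g` is close to `Σ⁻¹ w`. -/
lemma exists_isMinNormSolution {N : ℕ} (W : Matrix κ (Fin N) ℝ) {Sg : Matrix κ κ ℝ} {c : ℝ}
    (hc : 0 < c) (hS : ∀ g, c * l2 g ^ 2 ≤ g ⬝ᵥ Sg *ᵥ g)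
    (hQ : √(∑ q, ∑ q', (Sg - W * Wᵀ) q q' ^ 2) ≤ c / 2) {w v : κ → ℝ} (hv : Sg *ᵥ v = w) :
    ∃ g : κ → ℝ, IsMinNormSolution W w (Wᵀ *ᵥ g) ∧
      l2 (Wᵀ *ᵥ g) ^ 2 ≤ 2 / c * l2 w ^ 2 ∧
      l2 (g - v) ≤ 2 / c * (√(∑ q, ∑ q', (Sg - W * Wᵀ) q q' ^ 2) * l2 v) := by
  set Q := √(∑ q, ∑ q', (Sg - W * Wᵀ) q q' ^ 2) with hQdef
  have hG : ∀ g, c / 2 * l2 g ^ 2 ≤ g ⬝ᵥ (W * Wᵀ) *ᵥ g := by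
    intro g
    have h1 := dotProduct_le_l2 g ((Sg - W * Wᵀ) *ᵥ g)
    have h2 := l2_mulVec_le_sqrt (Sg - W * Wᵀ) g
    rw [← hQdef] at h2
    rw [Matrix.sub_mulVec, dotProduct_sub] at h1
    rw [Matrix.sub_mulVec] at h2
    have h3 : l2 g * l2 (Sg *ᵥ g - (W * Wᵀ) *ᵥ g) ≤ l2 g * (c / 2 * l2 g) :=
      mul_le_mul_of_nonneg_left
        (h2.trans (mul_le_mul_of_nonneg_right hQ (l2_nonneg g))) (l2_nonneg g)
    nlinarith [hS g]
  obtain ⟨g, hg⟩ := exists_mulVec_eq_of_coercive (half_pos hc) hG w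
  have hsol : W *ᵥ (Wᵀ *ᵥ g) = w := by rw [Matrix.mulVec_mulVec, hg]
  have hdot : ∀ β : Fin N → ℝ, (Wᵀ *ᵥ g) ⬝ᵥ β = g ⬝ᵥ W *ᵥ β := by
    intro β
    rw [Matrix.mulVec_transpose, ← Matrix.dotProduct_mulVec]
  have hnorm : l2 (Wᵀ *ᵥ g) ^ 2 = g ⬝ᵥ w := by
    rw [l2_sq_eq_dotProduct, hdot, hsol]
  have hgw : l2 g ≤ 2 / c * l2 w := by
    have := l2_le_of_coercive hG g
    rw [hg] at this
    rw [div_mul_eq_mul_div, le_div_iff₀ hc]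
    linarith
  refine ⟨g, ⟨hsol, fun β hβ => ?_⟩, ?_, ?_⟩
  · -- `β - Wᵀ g` lies in the kernel of `W`, hence is orthogonal to `Wᵀ g`
    have h1 : l2 (Wᵀ *ᵥ g) ^ 2 = (Wᵀ *ᵥ g) ⬝ᵥ β := by rw [hdot, hβ, hnorm]
    have h2 := dotProduct_le_l2 (Wᵀ *ᵥ g) β
    rcases (l2_nonneg (Wᵀ *ᵥ g)).eq_or_lt with h | h
    · rw [← h]; exact l2_nonneg _
    · nlinarith
  · rw [hnorm]
    calc g ⬝ᵥ w ≤ l2 g * l2 w := dotProduct_le_l2 _ _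
      _ ≤ 2 / c * l2 w * l2 w := mul_le_mul_of_nonneg_right hgw (l2_nonneg _)
      _ = 2 / c * l2 w ^ 2 := by ring
  · have h1 := l2_le_of_coercive hG (g - v)
    have h2 : (W * Wᵀ) *ᵥ (g - v) = (Sg - W * Wᵀ) *ᵥ v := by
      rw [Matrix.mulVec_sub, Matrix.sub_mulVec, hg, hv]
    rw [h2] at h1
    have h3 := l2_mulVec_le_sqrt (Sg - W * Wᵀ) v
    rw [← hQdef] at h3
    rw [div_mul_eq_mul_div, le_div_iff₀ hc]
    linarith

/-- Projecting the rows of `B` onto the row span of `W` does not change the action of `B` on that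
span. -/
lemma rowProj_mulVec_transpose {N : ℕ} (W : Matrix κ (Fin N) ℝ) (B : Matrix ι (Fin N) ℝ)
    (g : κ → ℝ) : rowProj W B *ᵥ (Wᵀ *ᵥ g) = B *ᵥ (Wᵀ *ᵥ g) := by
  set U := Submodule.span ℝ
    (Set.range fun k => (WithLp.toLp 2 (W k) : EuclideanSpace ℝ (Fin N))) with hU
  have hmem : (WithLp.toLp 2 (Wᵀ *ᵥ g) : EuclideanSpace ℝ (Fin N)) ∈ U := by
    have : (WithLp.toLp 2 (Wᵀ *ᵥ g) : EuclideanSpace ℝ (Fin N))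
        = ∑ k, g k • (WithLp.toLp 2 (W k) : EuclideanSpace ℝ (Fin N)) := by
      ext j
      simp [Matrix.mulVec, dotProduct, mul_comm]
    rw [this]
    exact Submodule.sum_mem _ fun k _ =>
      Submodule.smul_mem _ _ (Submodule.subset_span (Set.mem_range_self k))
  have hdot : ∀ a b : EuclideanSpace ℝ (Fin N), WithLp.ofLp a ⬝ᵥ WithLp.ofLp b = inner ℝ b a := by
    intro a b
    simp [PiLp.inner_apply, dotProduct]
  ext i
  change WithLp.ofLp (U.starProjection (WithLp.toLp 2 (B i))) ⬝ᵥ (Wᵀ *ᵥ g) = B i ⬝ᵥ (Wᵀ *ᵥ g)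
  have h1 := hdot (U.starProjection (WithLp.toLp 2 (B i))) (WithLp.toLp 2 (Wᵀ *ᵥ g))
  have h2 := hdot (WithLp.toLp 2 (B i)) (WithLp.toLp 2 (Wᵀ *ᵥ g))
  rw [← Submodule.inner_starProjection_left_eq_right,
    Submodule.starProjection_eq_self_iff.mpr hmem] at h1
  exact h1.trans h2.symm

end GramMatrix

/-! ### Summability of the powers of a stable matrix -/

/-- The entries of the powers of a Schur stable matrix are absolutely summable, by Gelfand's formula
for the spectral radius. -/
lemma SchurStable.summable_abs_pow {n : ℕ} {A : Matrix (Fin n) (Fin n) ℝ} (hA : SchurStable A)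
    (i j : Fin n) : Summable fun k : ℕ => |(A ^ k) i j| := by
  have : Nonempty (Fin n) := ⟨i⟩
  set a : Matrix (Fin n) (Fin n) ℂ := A.map (fun r : ℝ => (r : ℂ)) with ha
  have hne : (spectrum ℂ a).Nonempty := spectrum.nonempty_of_isAlgClosed_of_finiteDimensional ℂ a
  have hrad : spectralRadius ℂ a < (1 : NNReal) :=
    spectrum.spectralRadius_lt_of_forall_lt_of_nonempty hne fun k hk => by
      have := hA k hk
      exact_mod_cast this
  obtain ⟨r, hr1, hr2⟩ := ENNReal.lt_iff_exists_nnreal_btwn.mp hrad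
  have hr : (r : ℝ) < 1 := by exact_mod_cast hr2
  have hev : ∀ᶠ k : ℕ in atTop, |(A ^ k) i j| ≤ (r : ℝ) ^ k := by
    filter_upwards [(spectrum.pow_nnnorm_pow_one_div_tendsto_nhds_spectralRadius a).eventually
      (gt_mem_nhds hr1), eventually_gt_atTop 0] with k hk hk0
    have h1 : ‖a ^ k‖ ≤ (r : ℝ) ^ k := by
      have h2 : ((‖a ^ k‖₊ : ENNReal) ^ (1 / (k : ℝ))) ^ (k : ℝ) ≤ (r : ENNReal) ^ (k : ℝ) :=
        ENNReal.rpow_le_rpow hk.le (Nat.cast_nonneg k)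
      rw [← ENNReal.rpow_mul, one_div_mul_cancel (by exact_mod_cast hk0.ne'), ENNReal.rpow_one,
        ENNReal.rpow_natCast] at h2
      have h3 : ‖a ^ k‖₊ ≤ r ^ k := by exact_mod_cast h2
      exact_mod_cast h3
    have h2 : (a ^ k) i j = (((A ^ k) i j : ℝ) : ℂ) := by
      have : a ^ k = (A ^ k).map (algebraMap ℝ ℂ) := by
        rw [Matrix.map_pow]; rfl
      rw [this]; rfl
    have h3 : ‖(a ^ k) i j‖ ≤ ‖a ^ k‖ := by
      have h4 := Matrix.l2_opNorm_mulVec (a ^ k) (EuclideanSpace.single j (1 : ℂ))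
      rw [PiLp.norm_single, norm_one, mul_one] at h4
      refine le_trans (le_of_eq ?_) ((PiLp.norm_apply_le _ i).trans h4)
      simp
    rw [h2, Complex.norm_real, Real.norm_eq_abs] at h3
    exact h3.trans h1
  refine Summable.of_norm_bounded_eventually_nat (summable_geometric_of_lt_one r.2 hr) ?_
  filter_upwards [hev] with k hk
  rwa [Real.norm_eq_abs, abs_abs]

/-! ### The adjoint recursion: from input-output weights to input-noise weights -/

/-- Young's inequality for causal convolutions: `ℓ¹ * ℓ² ⊆ ℓ²`, for finite sections. -/
lemma sum_sq_le_of_le_convolution {a b c : ℕ → ℝ} (ha : ∀ k, 0 ≤ a k)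
    (hc : ∀ k, 0 ≤ c k) {R : ℝ} (hR : ∀ L, ∑ k ∈ Finset.range L, a k ≤ R)
    (h : ∀ i, c i ≤ ∑ k ∈ Finset.range i, a (i - 1 - k) * b k) (L : ℕ) :
    ∑ i ∈ Finset.range L, c i ^ 2 ≤ R ^ 2 * ∑ k ∈ Finset.range L, b k ^ 2 := by
  have hR0 : 0 ≤ R := by simpa using hR 0
  have h1 : ∀ i, c i ^ 2 ≤ R * ∑ k ∈ Finset.range i, a (i - 1 - k) * b k ^ 2 := by
    intro i
    calc c i ^ 2 ≤ (∑ k ∈ Finset.range i, a (i - 1 - k) * b k) ^ 2 :=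
          pow_le_pow_left₀ (hc i) (h i) 2
      _ ≤ (∑ k ∈ Finset.range i, a (i - 1 - k)) *
            ∑ k ∈ Finset.range i, a (i - 1 - k) * b k ^ 2 :=
          Finset.sum_sq_le_sum_mul_sum_of_sq_le_mul _ (fun k _ => ha _)
            (fun k _ => mul_nonneg (ha _) (sq_nonneg _)) fun k _ => le_of_eq (by ring)
      _ ≤ _ := by
          refine mul_le_mul_of_nonneg_right ?_
            (Finset.sum_nonneg fun k _ => mul_nonneg (ha _) (sq_nonneg _))
          rw [Finset.sum_range_reflect]
          exact hR i
  calc ∑ i ∈ Finset.range L, c i ^ 2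
      ≤ ∑ i ∈ Finset.range L, R * ∑ k ∈ Finset.range i, a (i - 1 - k) * b k ^ 2 :=
        Finset.sum_le_sum fun i _ => h1 i
    _ = R * ∑ k ∈ Finset.range L, (∑ i ∈ Finset.Ico (k + 1) L, a (i - 1 - k)) * b k ^ 2 := by
        rw [← Finset.mul_sum]
        congr 1
        simp_rw [Finset.sum_mul]
        refine Finset.sum_comm' fun i k => ?_
        simp only [Finset.mem_range, Finset.mem_Ico]
        omega
    _ ≤ R * ∑ k ∈ Finset.range L, R * b k ^ 2 := by
        refine mul_le_mul_of_nonneg_left (Finset.sum_le_sum fun k _ => ?_) hR0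
        refine mul_le_mul_of_nonneg_right ?_ (sq_nonneg _)
        rw [Finset.sum_Ico_eq_sum_range]
        refine le_trans (le_of_eq (Finset.sum_congr rfl fun i _ => ?_)) (hR (L - (k + 1)))
        congr 1
        omega
    _ = _ := by rw [← Finset.mul_sum]; ring

/-- The sum of the absolute values of the entries, a convenient norm for summability. -/
def absSum {ι κ : Type*} [Fintype ι] [Fintype κ] (M : Matrix ι κ ℝ) : ℝ := ∑ i, ∑ j, |M i j|

lemma absSum_nonneg {ι κ : Type*} [Fintype ι] [Fintype κ] (M : Matrix ι κ ℝ) : 0 ≤ absSum M :=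
  Finset.sum_nonneg fun _ _ => Finset.sum_nonneg fun _ _ => abs_nonneg _

lemma absSum_transpose {ι κ : Type*} [Fintype ι] [Fintype κ] (M : Matrix ι κ ℝ) :
    absSum Mᵀ = absSum M := Finset.sum_comm

lemma sum_abs_mulVec_le {ι κ : Type*} [Fintype ι] [Fintype κ] (M : Matrix ι κ ℝ) (v : κ → ℝ) :
    ∑ i, |(M *ᵥ v) i| ≤ absSum M * ∑ j, |v j| := by
  rw [absSum, Finset.sum_mul]
  refine Finset.sum_le_sum fun i _ => ?_
  rw [Finset.sum_mul]
  refine (Finset.abs_sum_le_sum_abs _ _).trans (Finset.sum_le_sum fun j _ => ?_)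
  rw [abs_mul]
  exact mul_le_mul_of_nonneg_left
    (Finset.single_le_sum (f := fun j => |v j|) (fun _ _ => abs_nonneg _) (Finset.mem_univ j))
    (abs_nonneg _)

lemma l2_mulVec_le_absSum {ι κ : Type*} [Fintype ι] [Fintype κ] (M : Matrix ι κ ℝ) (v : κ → ℝ) :
    l2 (M *ᵥ v) ≤ absSum M * l2 v := by
  refine (l2_le_sum_abs _).trans ?_
  rw [absSum, Finset.sum_mul]
  refine Finset.sum_le_sum fun i _ => ?_
  rw [Finset.sum_mul]
  refine (Finset.abs_sum_le_sum_abs _ _).trans (Finset.sum_le_sum fun j _ => ?_)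
  rw [abs_mul]
  exact mul_le_mul_of_nonneg_left (abs_apply_le_l2 v j) (abs_nonneg _)

lemma SchurStable.summable_absSum_pow {n : ℕ} {A : Matrix (Fin n) (Fin n) ℝ} (hA : SchurStable A) :
    Summable fun k : ℕ => absSum (A ^ k) :=
  summable_sum fun i _ => summable_sum fun j _ => hA.summable_abs_pow i j

/-- The trajectory of a stable system with zero initial state is bounded in `ℓ²` by its input. -/
lemma SchurStable.exists_sum_sq_le {n : ℕ} {A : Matrix (Fin n) (Fin n) ℝ} (hA : SchurStable A) :
    ∃ R : ℝ, ∀ (l f : ℕ → Fin n → ℝ), l 0 = 0 → (∀ i, l (i + 1) = Aᵀ *ᵥ l i + f i) →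
      ∀ L, ∑ i ∈ Finset.range L, l2 (l i) ^ 2 ≤ R ^ 2 * ∑ i ∈ Finset.range L, l2 (f i) ^ 2 := by
  refine ⟨∑' k, absSum (A ^ k), fun l f h0 hs L => ?_⟩
  have hl : ∀ i, l i = ∑ k ∈ Finset.range i, (Aᵀ) ^ (i - 1 - k) *ᵥ f k := by
    intro i
    induction i with
    | zero => simp [h0]
    | succ i ih =>
      rw [hs, ih, Finset.sum_range_succ, Matrix.mulVec_sum]
      congr 1
      · refine Finset.sum_congr rfl fun k hk => ?_
        rw [Matrix.mulVec_mulVec, ← pow_succ']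
        congr 2
        have := Finset.mem_range.mp hk
        omega
      · simp
  refine sum_sq_le_of_le_convolution (a := fun k => absSum (A ^ k)) (fun k => absSum_nonneg _)
    (fun k => l2_nonneg _)
    (fun L => hA.summable_absSum_pow.sum_le_tsum _ fun k _ => absSum_nonneg _) (fun i => ?_) L
  have hsum : ∀ s : Finset ℕ, ∀ w : ℕ → Fin n → ℝ, l2 (∑ k ∈ s, w k) ≤ ∑ k ∈ s, l2 (w k) := by
    intro s w
    simp only [l2, WithLp.toLp_sum]
    exact norm_sum_le _ _
  rw [hl i]
  refine (hsum _ _).trans (Finset.sum_le_sum fun k _ => ?_)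
  rw [← absSum_transpose (A ^ _), Matrix.transpose_pow]
  exact l2_mulVec_le_absSum _ _

namespace InnovModel

variable {n m p : ℕ} (S : InnovModel n m p)

/-- The adjoint state of a weighted sum `∑ gᵢ · (u, y)(t - i)` of inputs and outputs, the index `i`
running backward in time from the end `t` of the window. -/
def costate (g : ℕ → Fin m ⊕ Fin p → ℝ) : ℕ → Fin n → ℝ
  | 0 => 0
  | i + 1 => S.Aᵀ *ᵥ costate g i + S.Cᵀ *ᵥ fun b => g i (Sum.inr b)

/-- The weight of `(u, e)(t - i)` when a weighted sum of inputs and outputs is expanded in inputs,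
noise and an initial state. -/
def noiseWeight (g : ℕ → Fin m ⊕ Fin p → ℝ) (i : ℕ) : Fin m ⊕ Fin p → ℝ :=
  Sum.elim ((fun a => g i (Sum.inl a)) + S.Dᵀ *ᵥ (fun b => g i (Sum.inr b)) + S.Bᵀ *ᵥ S.costate g i)
    ((fun b => g i (Sum.inr b)) + S.Kᵀ *ᵥ S.costate g i)

lemma dotProduct_sumElim (h : Fin m ⊕ Fin p → ℝ) (a : Fin m → ℝ) (b : Fin p → ℝ) :
    h ⬝ᵥ Sum.elim a b = (fun i => h (Sum.inl i)) ⬝ᵥ a + (fun i => h (Sum.inr i)) ⬝ᵥ b := by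
  simp [dotProduct, Fintype.sum_sum_type]

/-- Summation by parts: the weighted sum of inputs and outputs over a window, expanded in the state
at the beginning of the window and in the inputs and the noise on the window. -/
lemma sum_weight_eq {S : InnovModel n m p} {x : ℤ → Fin n → ℝ} {u : ℤ → Fin m → ℝ}
    {y e : ℤ → Fin p → ℝ} (h : S.IsTrajectory x u y e) (g : ℕ → Fin m ⊕ Fin p → ℝ) (t : ℤ)
    (L : ℕ) :
    ∑ i ∈ Finset.range L, g i ⬝ᵥ Sum.elim (u (t - i)) (y (t - i)) =
      S.costate g L ⬝ᵥ x (t - L + 1) +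
        ∑ i ∈ Finset.range L, S.noiseWeight g i ⬝ᵥ Sum.elim (u (t - i)) (e (t - i)) := by
  induction L with
  | zero => simp [costate]
  | succ L ih =>
    rw [Finset.sum_range_succ, Finset.sum_range_succ, ih, h.state, h.output]
    have ht : t - ((L + 1 : ℕ) : ℤ) + 1 = t - L := by push_cast; ring
    rw [ht]
    simp only [dotProduct_sumElim, costate, noiseWeight, Sum.elim_inl, Sum.elim_inr, next, out]
    simp only [dotProduct_add, add_dotProduct, Matrix.mulVec_transpose,
      Matrix.dotProduct_mulVec]
    ring

/-- The adjoint state, driven by the noise weights, follows the stable closed loop `A - K C`. -/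
lemma costate_succ (g : ℕ → Fin m ⊕ Fin p → ℝ) (i : ℕ) :
    S.costate g (i + 1) = (S.A - S.K * S.C)ᵀ *ᵥ S.costate g i +
      S.Cᵀ *ᵥ fun b => S.noiseWeight g i (Sum.inr b) := by
  have h : (fun b => S.noiseWeight g i (Sum.inr b))
      = (fun b => g i (Sum.inr b)) + S.Kᵀ *ᵥ S.costate g i := rfl
  rw [h, costate, Matrix.transpose_sub, Matrix.transpose_mul, Matrix.sub_mulVec, Matrix.mulVec_add,
    Matrix.mulVec_mulVec]
  abel

/-- The input-output weights are bounded in `ℓ²` by the input-noise weights, uniformly in the length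
of the window: this is where the stability of the inverse system is used. -/
lemma exists_sum_weight_sq_le (hAKC : SchurStable (S.A - S.K * S.C)) :
    ∃ C : ℝ, 0 < C ∧ ∀ (g : ℕ → Fin m ⊕ Fin p → ℝ) (L : ℕ),
      ∑ i ∈ Finset.range L, l2 (g i) ^ 2 ≤ C * ∑ i ∈ Finset.range L, l2 (S.noiseWeight g i) ^ 2 := by
  obtain ⟨R, hR⟩ := hAKC.exists_sum_sq_le
  set c := absSum S.Cᵀ
  set k := absSum S.Kᵀ
  set d := absSum S.Dᵀ
  set b := absSum S.Bᵀ
  refine ⟨3 + (1 + 3 * d ^ 2) * 2 + ((1 + 3 * d ^ 2) * (2 * k ^ 2) + 3 * b ^ 2) * (R ^ 2 * c ^ 2),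
    by positivity, fun g L => ?_⟩
  set lam := S.costate g with hlam
  set al : ℕ → Fin m → ℝ := fun i a => g i (Sum.inl a)
  set be : ℕ → Fin p → ℝ := fun i a => g i (Sum.inr a)
  set ga : ℕ → Fin m → ℝ := fun i a => S.noiseWeight g i (Sum.inl a)
  set et : ℕ → Fin p → ℝ := fun i a => S.noiseWeight g i (Sum.inr a)
  have hga : ∀ i, ga i = al i + S.Dᵀ *ᵥ be i + S.Bᵀ *ᵥ lam i := fun i => rfl
  have het : ∀ i, et i = be i + S.Kᵀ *ᵥ lam i := fun i => rfl
  have hl2 : ∀ h : Fin m ⊕ Fin p → ℝ,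
      l2 h ^ 2 = l2 (fun a => h (Sum.inl a)) ^ 2 + l2 (fun a => h (Sum.inr a)) ^ 2 := by
    intro h; simp [l2_sq, Fintype.sum_sum_type]
  have h1 : ∑ i ∈ Finset.range L, l2 (lam i) ^ 2
      ≤ R ^ 2 * c ^ 2 * ∑ i ∈ Finset.range L, l2 (et i) ^ 2 := by
    refine (hR lam (fun i => S.Cᵀ *ᵥ et i) rfl (S.costate_succ g) L).trans ?_
    rw [mul_assoc, Finset.mul_sum _ _ (c ^ 2)]
    refine mul_le_mul_of_nonneg_left (Finset.sum_le_sum fun i _ => ?_) (sq_nonneg _)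
    rw [← mul_pow]
    exact pow_le_pow_left₀ (l2_nonneg _) (l2_mulVec_le_absSum _ _) 2
  have hbe : ∀ i, l2 (be i) ^ 2 ≤ 2 * l2 (et i) ^ 2 + 2 * k ^ 2 * l2 (lam i) ^ 2 := by
    intro i
    have h2 : be i = et i - S.Kᵀ *ᵥ lam i := by rw [het]; abel
    have h3 : l2 (be i) ≤ l2 (et i) + k * l2 (lam i) := by
      rw [h2]; exact (l2_sub_le _ _).trans (add_le_add_right (l2_mulVec_le_absSum _ _) _)
    nlinarith [sq_nonneg (l2 (et i) - k * l2 (lam i)), l2_nonneg (be i),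
      pow_le_pow_left₀ (l2_nonneg (be i)) h3 2]
  have hal : ∀ i, l2 (al i) ^ 2
      ≤ 3 * l2 (ga i) ^ 2 + 3 * d ^ 2 * l2 (be i) ^ 2 + 3 * b ^ 2 * l2 (lam i) ^ 2 := by
    intro i
    have h2 : al i = ga i - S.Dᵀ *ᵥ be i - S.Bᵀ *ᵥ lam i := by rw [hga]; abel
    have h3 : l2 (al i) ≤ l2 (ga i) + d * l2 (be i) + b * l2 (lam i) := by
      rw [h2]
      refine (l2_sub_le _ _).trans (add_le_add ?_ (l2_mulVec_le_absSum _ _))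
      exact (l2_sub_le _ _).trans (add_le_add_right (l2_mulVec_le_absSum _ _) _)
    nlinarith [sq_nonneg (l2 (ga i) - d * l2 (be i)), sq_nonneg (l2 (ga i) - b * l2 (lam i)),
      sq_nonneg (d * l2 (be i) - b * l2 (lam i)), pow_le_pow_left₀ (l2_nonneg (al i)) h3 2]
  have hpt : ∀ i, l2 (g i) ^ 2 ≤ 3 * l2 (ga i) ^ 2 + (1 + 3 * d ^ 2) * 2 * l2 (et i) ^ 2
      + ((1 + 3 * d ^ 2) * (2 * k ^ 2) + 3 * b ^ 2) * l2 (lam i) ^ 2 := by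
    intro i
    have h4 := mul_le_mul_of_nonneg_left (hbe i) (by positivity : 0 ≤ 1 + 3 * d ^ 2)
    have h5 : l2 (g i) ^ 2 = l2 (al i) ^ 2 + l2 (be i) ^ 2 := hl2 (g i)
    nlinarith [hal i]
  have hsum := Finset.sum_le_sum fun i (_ : i ∈ Finset.range L) => hpt i
  simp only [Finset.sum_add_distrib, ← Finset.mul_sum] at hsum
  have hnw : ∑ i ∈ Finset.range L, l2 (S.noiseWeight g i) ^ 2
      = ∑ i ∈ Finset.range L, l2 (ga i) ^ 2 + ∑ i ∈ Finset.range L, l2 (et i) ^ 2 := by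
    rw [← Finset.sum_add_distrib]
    exact Finset.sum_congr rfl fun i _ => hl2 _
  have hG : 0 ≤ ∑ i ∈ Finset.range L, l2 (ga i) ^ 2 := Finset.sum_nonneg fun i _ => sq_nonneg _
  have hE : 0 ≤ ∑ i ∈ Finset.range L, l2 (et i) ^ 2 := Finset.sum_nonneg fun i _ => sq_nonneg _
  rw [hnw]
  have hq : 0 ≤ (1 + 3 * d ^ 2) * (2 * k ^ 2) + 3 * b ^ 2 := by positivity
  have h6 := mul_le_mul_of_nonneg_left h1 hq
  have h7 : 0 ≤ (1 + 3 * d ^ 2) * 2 := by positivity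
  have h8 : 0 ≤ ((1 + 3 * d ^ 2) * (2 * k ^ 2) + 3 * b ^ 2) * (R ^ 2 * c ^ 2) := by positivity
  nlinarith [mul_nonneg h7 hG, mul_nonneg h8 hG]

section Support

variable {g : ℕ → Fin m ⊕ Fin p → ℝ} {L₀ : ℕ}

lemma costate_add (hg : ∀ i, L₀ ≤ i → g i = 0) (k : ℕ) :
    S.costate g (L₀ + k) = (S.Aᵀ) ^ k *ᵥ S.costate g L₀ := by
  induction k with
  | zero => simp
  | succ k ih =>
    have hz : (fun _ : Fin p => (0 : ℝ)) = 0 := rfl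
    rw [← add_assoc, costate, ih, hg _ (Nat.le_add_right _ _), Matrix.mulVec_mulVec, ← pow_succ']
    simp [hz]

/-- The adjoint state of weights with bounded support decays summably before the window. -/
lemma summable_costate (hA : SchurStable S.A) (hg : ∀ i, L₀ ≤ i → g i = 0) :
    Summable fun i => ∑ a, |S.costate g i a| := by
  rw [← summable_nat_add_iff L₀]
  refine Summable.of_nonneg_of_le (fun k => Finset.sum_nonneg fun _ _ => abs_nonneg _)
    (fun k => ?_) (hA.summable_absSum_pow.mul_right (∑ a, |S.costate g L₀ a|))
  rw [add_comm k, S.costate_add hg, ← absSum_transpose, Matrix.transpose_pow]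
  exact sum_abs_mulVec_le _ _

lemma summable_noiseWeight (hA : SchurStable S.A) (hg : ∀ i, L₀ ≤ i → g i = 0) :
    Summable fun i => ∑ c, |S.noiseWeight g i c| := by
  rw [← summable_nat_add_iff L₀]
  have hs := (summable_nat_add_iff L₀).mpr (S.summable_costate hA hg)
  refine Summable.of_nonneg_of_le (fun k => Finset.sum_nonneg fun _ _ => abs_nonneg _)
    (fun k => ?_) (hs.mul_left (absSum S.Bᵀ + absSum S.Kᵀ))
  have hz : ∀ q : ℕ, (fun _ : Fin q => (0 : ℝ)) = 0 := fun _ => rfl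
  rw [noiseWeight, hg _ (Nat.le_add_left _ _), Fintype.sum_sum_type]
  simp only [Pi.zero_apply, hz, Matrix.mulVec_zero, zero_add, Sum.elim_inl, Sum.elim_inr, add_mul]
  exact add_le_add (sum_abs_mulVec_le _ _) (sum_abs_mulVec_le _ _)

lemma costate_eq_zero (hg : ∀ i b, g i (Sum.inr b) = 0) (i : ℕ) : S.costate g i = 0 := by
  have hz : (fun _ : Fin p => (0 : ℝ)) = 0 := rfl
  induction i with
  | zero => rfl
  | succ i ih => simp [costate, ih, hg, hz]

lemma noiseWeight_eq_self (hg : ∀ i b, g i (Sum.inr b) = 0) (i : ℕ) : S.noiseWeight g i = g i := by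
  have hz : (fun _ : Fin p => (0 : ℝ)) = 0 := rfl
  ext c
  rcases c with a | b <;> simp [noiseWeight, S.costate_eq_zero hg, hg, hz]

end Support

end InnovModel

/-! ### Spectral lower bound for filtered inputs -/

lemma integral_exp_int_mul (k : ℤ) :
    ∫ θ in (-Real.pi)..Real.pi, Complex.exp (Complex.I * k * θ) = if k = 0 then 2 * Real.pi else 0 := by
  split_ifs with h
  · subst h
    simp
    ring
  · have hc : Complex.I * (k : ℂ) ≠ 0 := mul_ne_zero Complex.I_ne_zero (by exact_mod_cast h)
    rw [integral_exp_mul_complex hc]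
    have h1 : Complex.I * k * (Real.pi : ℂ) = Complex.I * k * ((-Real.pi : ℝ) : ℂ) +
        (k : ℂ) * (2 * Real.pi * Complex.I) := by push_cast; ring
    rw [h1, Complex.exp_periodic.int_mul k]
    simp

/-- If the spectral density is bounded below by `c`, then so is the covariance operator of the
process: `c ∑ ‖γᵢ‖² ≤ Var (∑ γᵢ · u(t - i))`. -/
lemma HasSpectralDensity.exists_le_variance {Ω : Type*} [MeasurableSpace Ω] {μ : Measure Ω}
    [IsProbabilityMeasure μ] {m : ℕ} {u : ℤ → Ω → Fin m → ℝ} {Φ : ℝ → Matrix (Fin m) (Fin m) ℂ}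
    (hu : HasSpectralDensity μ u Φ) (hΦ : BoundedAwayFromZero Φ) :
    ∃ c : ℝ, 0 < c ∧ ∀ (γ : ℕ → Fin m → ℝ) (t : ℤ) (L : ℕ),
      c * ∑ i ∈ Finset.range L, l2 (γ i) ^ 2 ≤
        Var[fun ω => ∑ i ∈ Finset.range L, γ i ⬝ᵥ u (t - i) ω; μ] := by
  obtain ⟨c, hc, hpos⟩ := hΦ
  refine ⟨c, hc, fun γ t L => ?_⟩
  set w : Fin L × Fin m → ℝ := fun q => γ q.1 q.2 with hw
  -- the density of the quadratic form, with the lower bound `c I` subtracted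
  set F : Fin L × Fin m → Fin L × Fin m → ℝ → ℂ := fun q q' θ =>
    (w q * w q' : ℝ) * (Complex.exp (Complex.I * ((q'.1 : ℤ) - (q.1 : ℤ) : ℤ) * θ) *
      (Φ θ - (c : ℂ) • (1 : Matrix (Fin m) (Fin m) ℂ)) q.2 q'.2) with hF
  have hexp : ∀ k : ℤ, Continuous fun θ : ℝ => Complex.exp (Complex.I * k * θ) := fun k => by fun_prop
  have hint1 : ∀ (k : ℤ) a b, IntervalIntegrable
      (fun θ : ℝ => Complex.exp (Complex.I * k * θ) * Φ θ a b) volume (-Real.pi) Real.pi :=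
    fun k a b => (hu.integrable a b).continuousOn_mul (hexp k).continuousOn
  have hint2 : ∀ (k : ℤ) (z : ℂ), IntervalIntegrable
      (fun θ : ℝ => Complex.exp (Complex.I * k * θ) * z) volume (-Real.pi) Real.pi :=
    fun k z => ((hexp k).mul continuous_const).intervalIntegrable _ _
  have hsplit : ∀ q q', F q q' = fun θ : ℝ => ((w q * w q' : ℝ) : ℂ) *
      (Complex.exp (Complex.I * ((q'.1 : ℤ) - (q.1 : ℤ) : ℤ) * θ) * Φ θ q.2 q'.2 -
        Complex.exp (Complex.I * ((q'.1 : ℤ) - (q.1 : ℤ) : ℤ) * θ) *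
          (if q.2 = q'.2 then (c : ℂ) else 0)) := by
    intro q q'
    ext θ
    simp only [hF, Matrix.sub_apply, Matrix.smul_apply, Matrix.one_apply, smul_eq_mul, mul_ite,
      mul_one, mul_zero]
    split_ifs <;> ring
  have hFint : ∀ q q', IntervalIntegrable (F q q') volume (-Real.pi) Real.pi := by
    intro q q'
    rw [hsplit]
    exact ((hint1 _ _ _).sub (hint2 _ _)).const_mul _
  have hFval : ∀ q q', ∫ θ in (-Real.pi)..Real.pi, F q q' θ =
      ((2 * Real.pi * (w q * w q' * cov[fun ω => u (t - (q.1 : ℕ)) ω q.2,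
        fun ω => u (t - (q'.1 : ℕ)) ω q'.2; μ] - if q = q' then c * w q ^ 2 else 0) : ℝ) : ℂ) := by
    intro q q'
    rw [hsplit, intervalIntegral.integral_const_mul,
      intervalIntegral.integral_sub (hint1 _ _ _) (hint2 _ _), intervalIntegral.integral_mul_const,
      integral_exp_int_mul]
    have h1 := hu.autocov (t - (q'.1 : ℕ)) ((q'.1 : ℤ) - (q.1 : ℤ)) q.2 q'.2
    have h2 : t - ((q'.1 : ℕ) : ℤ) + ((q'.1 : ℤ) - (q.1 : ℤ)) = t - (q.1 : ℕ) := by ring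
    rw [h2] at h1
    have hpi : (Real.pi : ℂ) ≠ 0 := by exact_mod_cast Real.pi_ne_zero
    have h3 : ∫ θ in (-Real.pi)..Real.pi,
        Complex.exp (Complex.I * ((q'.1 : ℤ) - (q.1 : ℤ) : ℤ) * θ) * Φ θ q.2 q'.2 =
        2 * Real.pi * ((cov[fun ω => u (t - (q.1 : ℕ)) ω q.2,
          fun ω => u (t - (q'.1 : ℕ)) ω q'.2; μ] : ℝ) : ℂ) := by
      rw [h1]; field_simp
    rw [h3]
    have h4 : ((q'.1 : ℤ) - (q.1 : ℤ) = 0) ↔ q.1 = q'.1 := by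
      rw [sub_eq_zero, Int.natCast_inj, Fin.val_inj]; exact eq_comm
    by_cases h5 : q.1 = q'.1
    · by_cases h6 : q.2 = q'.2
      · have h7 : q = q' := Prod.ext h5 h6
        subst h7
        simp
        ring
      · have h7 : q ≠ q' := fun h => h6 (congrArg Prod.snd h)
        simp [h6, h7]
        ring
    · have h7 : q ≠ q' := fun h => h5 (congrArg Prod.fst h)
      simp [h4, h5, h7]
      ring
  -- the density is a Hermitian form in the trigonometric polynomial `g`
  have hnonneg : ∀ᵐ θ ∂(volume.restrict (Set.Ioc (-Real.pi) Real.pi)),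
      0 ≤ (∑ q, ∑ q', F q q' θ).re := by
    filter_upwards [hpos] with θ hθ
    set g : Fin m → ℂ := fun b => ∑ i : Fin L, (w (i, b) : ℂ) * Complex.exp (Complex.I * (i : ℕ) * θ)
    have h1 := hθ.dotProduct_mulVec_nonneg g
    have h2 : star g ⬝ᵥ (Φ θ - (c : ℂ) • (1 : Matrix (Fin m) (Fin m) ℂ)) *ᵥ g
        = ∑ q, ∑ q', F q q' θ := by
      simp only [dotProduct, Matrix.mulVec, Fintype.sum_prod_type_right, Pi.star_apply]
      refine Finset.sum_congr rfl fun a _ => ?_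
      rw [show star (g a) = ∑ i : Fin L,
        star ((w (i, a) : ℂ) * Complex.exp (Complex.I * (i : ℕ) * θ)) from star_sum _ _,
        Finset.sum_mul]
      refine Finset.sum_congr rfl fun i _ => ?_
      rw [Finset.mul_sum]
      refine Finset.sum_congr rfl fun b _ => ?_
      rw [show g b = ∑ j : Fin L,
        (w (j, b) : ℂ) * Complex.exp (Complex.I * (j : ℕ) * θ) from rfl, Finset.mul_sum,
        Finset.mul_sum]
      refine Finset.sum_congr rfl fun j _ => ?_
      have h3 : Complex.exp (Complex.I * (((j : ℕ) : ℤ) - ((i : ℕ) : ℤ) : ℤ) * θ)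
          = star (Complex.exp (Complex.I * (i : ℕ) * θ)) * Complex.exp (Complex.I * (j : ℕ) * θ) := by
        rw [Complex.star_def, ← Complex.exp_conj, ← Complex.exp_add]
        congr 1
        simp
        ring
      simp only [hF, h3, star_mul', Complex.star_def, Complex.conj_ofReal]
      push_cast
      ring
    rw [h2] at h1
    exact (Complex.le_def.mp h1).1
  have hle : -Real.pi ≤ Real.pi := by linarith [Real.pi_pos]
  have htot : 0 ≤ (∫ θ in (-Real.pi)..Real.pi, ∑ q, ∑ q', F q q' θ).re := by
    have hi : IntegrableOn (fun θ => ∑ q, ∑ q', F q q' θ) (Set.Ioc (-Real.pi) Real.pi) := by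
      refine integrable_finsetSum _ fun q _ => integrable_finsetSum _ fun q' _ => ?_
      exact (intervalIntegrable_iff_integrableOn_Ioc_of_le hle).mp (hFint q q')
    rw [intervalIntegral.integral_of_le hle, ← Complex.reCLM_apply,
      ← Complex.reCLM.integral_comp_comm hi]
    exact integral_nonneg_of_ae hnonneg
  have hsum : ∫ θ in (-Real.pi)..Real.pi, ∑ q, ∑ q', F q q' θ
      = ∑ q, ∑ q', ∫ θ in (-Real.pi)..Real.pi, F q q' θ := by
    rw [intervalIntegral.integral_finsetSum]
    · exact Finset.sum_congr rfl fun q _ => intervalIntegral.integral_finsetSum fun q' _ => hFint q q'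
    · intro q _
      have h := IntervalIntegrable.sum Finset.univ (f := F q) fun q' _ => hFint q q'
      have he : (fun θ => ∑ q', F q q' θ) = ∑ q', F q q' := by
        ext θ; rw [Finset.sum_apply]
      rw [he]
      exact h
  simp_rw [hsum, hFval, ← Complex.ofReal_sum, Complex.ofReal_re, ← Finset.mul_sum,
    Finset.sum_sub_distrib, Finset.sum_ite_eq, Finset.mem_univ, if_true, ← Finset.mul_sum] at htot
  have hvar : Var[fun ω => ∑ i ∈ Finset.range L, γ i ⬝ᵥ u (t - i) ω; μ] =
      ∑ q, ∑ q', w q * w q' * cov[fun ω => u (t - (q.1 : ℕ)) ω q.2,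
        fun ω => u (t - (q'.1 : ℕ)) ω q'.2; μ] := by
    have h1 : (fun ω => ∑ i ∈ Finset.range L, γ i ⬝ᵥ u (t - i) ω)
        = ∑ q : Fin L × Fin m, w q • fun ω => u (t - (q.1 : ℕ)) ω q.2 := by
      ext ω
      rw [Finset.sum_apply, Fintype.sum_prod_type, Finset.sum_range]
      rfl
    rw [h1, variance_sum fun q => (hu.memLp _ _).const_smul _]
    refine Finset.sum_congr rfl fun q _ => Finset.sum_congr rfl fun q' _ => ?_
    rw [covariance_smul_left, covariance_smul_right]
    ring
  have hnorm : ∑ i ∈ Finset.range L, l2 (γ i) ^ 2 = ∑ q, w q ^ 2 := by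
    rw [Fintype.sum_prod_type, Finset.sum_range]
    exact Finset.sum_congr rfl fun i _ => l2_sq _
  rw [hvar, hnorm]
  have := nonneg_of_mul_nonneg_right htot (by positivity)
  linarith

/-! ### Second moments of sums and of limits -/

section SecondMoments

variable {Ω : Type*} [MeasurableSpace Ω] {μ : Measure Ω}

lemma memLp_two_mul {f g : Ω → ℝ} (hf : MemLp f 4 μ) (hg : MemLp g 4 μ) :
    MemLp (fun ω => f ω * g ω) 2 μ := by
  have : ENNReal.HolderTriple 4 4 2 := ⟨by
    have h4 : (4 : ENNReal) = 2 * 2 := by norm_num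
    rw [h4, ENNReal.mul_inv (by simp) (by simp), ← mul_two, mul_assoc,
      ENNReal.inv_mul_cancel (by simp) (by simp), mul_one]⟩
  exact hg.mul hf

lemma integral_sq_mul_sq_le {f g : Ω → ℝ} {κ : ℝ} (hf : MemLp f 4 μ) (hg : MemLp g 4 μ)
    (hfκ : ∫ ω, f ω ^ 4 ∂μ ≤ κ) (hgκ : ∫ ω, g ω ^ 4 ∂μ ≤ κ) :
    ∫ ω, (f ω * g ω) ^ 2 ∂μ ≤ κ := by
  have h4 : ∀ {f : Ω → ℝ}, MemLp f 4 μ → Integrable (fun ω => f ω ^ 4) μ := by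
    intro f hf
    refine (memLp_two_mul hf hf).integrable_sq.congr (ae_of_all _ fun ω => ?_)
    ring
  have h1 : ∫ ω, (f ω * g ω) ^ 2 ∂μ ≤ ∫ ω, (f ω ^ 4 / 2 + g ω ^ 4 / 2) ∂μ := by
    refine integral_mono (memLp_two_mul hf hg).integrable_sq
      (((h4 hf).div_const 2).add ((h4 hg).div_const 2)) fun ω => ?_
    change (f ω * g ω) ^ 2 ≤ f ω ^ 4 / 2 + g ω ^ 4 / 2
    nlinarith [sq_nonneg (f ω ^ 2 - g ω ^ 2)]
  rw [integral_add ((h4 hf).div_const 2) ((h4 hg).div_const 2), integral_div, integral_div] at h1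
  linarith

/-- The second moment of a weighted sum is at most `(∑ |aᵢ|)²` times that of the summands. -/
lemma integral_sum_mul_sq_le {ι : Type*} (s : Finset ι) (a : ι → ℝ) {X : ι → Ω → ℝ} {K : ℝ}
    (hX : ∀ i ∈ s, MemLp (X i) 2 μ) (hK : ∀ i ∈ s, ∫ ω, X i ω ^ 2 ∂μ ≤ K) :
    ∫ ω, (∑ i ∈ s, a i * X i ω) ^ 2 ∂μ ≤ (∑ i ∈ s, |a i|) ^ 2 * K := by
  have hint : ∀ i ∈ s, Integrable (fun ω => |a i| * X i ω ^ 2) μ :=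
    fun i hi => (hX i hi).integrable_sq.const_mul _
  have h1 : ∫ ω, (∑ i ∈ s, a i * X i ω) ^ 2 ∂μ
      ≤ ∫ ω, (∑ i ∈ s, |a i|) * ∑ i ∈ s, |a i| * X i ω ^ 2 ∂μ := by
    refine integral_mono_of_nonneg (ae_of_all _ fun ω => sq_nonneg _)
      ((integrable_finsetSum _ hint).const_mul _) (ae_of_all _ fun ω => ?_)
    refine Finset.sum_sq_le_sum_mul_sum_of_sq_le_mul _ (fun i _ => abs_nonneg _)
      (fun i _ => by positivity) fun i _ => le_of_eq ?_
    rw [mul_pow, ← sq_abs (a i)]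
    ring
  rw [integral_const_mul, integral_finsetSum _ hint] at h1
  refine h1.trans ?_
  rw [sq, mul_assoc]
  refine mul_le_mul_of_nonneg_left ?_ (Finset.sum_nonneg fun i _ => abs_nonneg _)
  rw [Finset.sum_mul]
  refine Finset.sum_le_sum fun i hi => ?_
  rw [integral_const_mul]
  exact mul_le_mul_of_nonneg_left (hK i hi) (abs_nonneg _)

lemma integral_sum_sq_of_orthogonal {ι : Type*} (s : Finset ι) {d : ι → Ω → ℝ}
    (hd : ∀ i ∈ s, MemLp (d i) 2 μ)
    (horth : ∀ i ∈ s, ∀ j ∈ s, i ≠ j → ∫ ω, d i ω * d j ω ∂μ = 0) :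
    ∫ ω, (∑ i ∈ s, d i ω) ^ 2 ∂μ = ∑ i ∈ s, ∫ ω, d i ω ^ 2 ∂μ := by
  classical
  have hint : ∀ i ∈ s, ∀ j ∈ s, Integrable (fun ω => d i ω * d j ω) μ :=
    fun i hi j hj => (hd i hi).integrable_mul (hd j hj)
  simp_rw [sq, Finset.sum_mul_sum]
  rw [integral_finsetSum _ fun i hi => integrable_finsetSum _ fun j hj => hint i hi j hj]
  refine Finset.sum_congr rfl fun i hi => ?_
  rw [integral_finsetSum _ fun j hj => hint i hi j hj]
  exact Finset.sum_eq_single_of_mem i hi fun j hj hji => horth i hi j hj hji.symm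

/-- Fatou's lemma for second moments. -/
lemma memLp_two_and_integral_sq_le_of_tendsto {Y : Ω → ℝ} {Z : ℕ → Ω → ℝ} {k : ℕ → ℝ} {K : ℝ}
    (hZ : ∀ L, MemLp (Z L) 2 μ)
    (hlim : ∀ᵐ ω ∂μ, Tendsto (fun L => Z L ω) atTop (𝓝 (Y ω)))
    (hk : ∀ L, ∫ ω, Z L ω ^ 2 ∂μ ≤ k L) (hK : Tendsto k atTop (𝓝 K)) :
    MemLp Y 2 μ ∧ ∫ ω, Y ω ^ 2 ∂μ ≤ K := by
  have hY : AEStronglyMeasurable Y μ :=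
    aestronglyMeasurable_of_tendsto_ae atTop (fun L => (hZ L).1) hlim
  have hK0 : 0 ≤ K := ge_of_tendsto' hK fun L =>
    (integral_nonneg fun ω => sq_nonneg (Z L ω)).trans (hk L)
  have h1 : ∫⁻ ω, ENNReal.ofReal (Y ω ^ 2) ∂μ ≤ ENNReal.ofReal K := by
    calc ∫⁻ ω, ENNReal.ofReal (Y ω ^ 2) ∂μ
        = ∫⁻ ω, liminf (fun L => ENNReal.ofReal (Z L ω ^ 2)) atTop ∂μ := by
          refine lintegral_congr_ae ?_
          filter_upwards [hlim] with ω hω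
          exact (ENNReal.tendsto_ofReal (hω.pow 2)).liminf_eq.symm
      _ ≤ liminf (fun L => ∫⁻ ω, ENNReal.ofReal (Z L ω ^ 2) ∂μ) atTop :=
          lintegral_liminf_le' fun L => ((hZ L).1.aemeasurable.pow_const 2).ennreal_ofReal
      _ ≤ liminf (fun L => ENNReal.ofReal (k L)) atTop := by
          refine liminf_le_liminf (Eventually.of_forall fun L => ?_)
          rw [← ofReal_integral_eq_lintegral_ofReal (hZ L).integrable_sq
            (ae_of_all _ fun ω => sq_nonneg _)]
          exact ENNReal.ofReal_le_ofReal (hk L)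
      _ = ENNReal.ofReal K := (ENNReal.tendsto_ofReal hK).liminf_eq
  have hint : Integrable (fun ω => Y ω ^ 2) μ := by
    refine ⟨hY.pow 2, ?_⟩
    rw [hasFiniteIntegral_iff_ofReal (ae_of_all _ fun ω => sq_nonneg _)]
    exact h1.trans_lt ENNReal.ofReal_lt_top
  refine ⟨(memLp_two_iff_integrable_sq hY).mpr hint, ?_⟩
  rw [← ofReal_integral_eq_lintegral_ofReal hint (ae_of_all _ fun ω => sq_nonneg _)] at h1
  exact (ENNReal.ofReal_le_ofReal_iff hK0).mp h1

/-- Mean-square convergence of two sequences implies convergence of the mean of their product. -/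
lemma tendsto_integral_mul_of_tendsto {f g : Ω → ℝ} {F G : ℕ → Ω → ℝ}
    (hf : MemLp f 2 μ) (hg : MemLp g 2 μ) (hF : ∀ L, MemLp (F L) 2 μ) (hG : ∀ L, MemLp (G L) 2 μ)
    (hfF : Tendsto (fun L => ∫ ω, (f ω - F L ω) ^ 2 ∂μ) atTop (𝓝 0))
    (hgG : Tendsto (fun L => ∫ ω, (g ω - G L ω) ^ 2 ∂μ) atTop (𝓝 0)) :
    Tendsto (fun L => ∫ ω, F L ω * G L ω ∂μ) atTop (𝓝 (∫ ω, f ω * g ω ∂μ)) := by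
  have key : ∀ {f : Ω → ℝ} {F : ℕ → Ω → ℝ} (hf : MemLp f 2 μ) (hF : ∀ L, MemLp (F L) 2 μ),
      Tendsto (fun L => ∫ ω, (f ω - F L ω) ^ 2 ∂μ) atTop (𝓝 0) →
      Tendsto (fun L => (hF L).toLp (F L)) atTop (𝓝 (hf.toLp f)) := by
    intro f F hf hF h
    rw [tendsto_iff_norm_sub_tendsto_zero]
    have h2 : Tendsto (fun L => √(∫ ω, (f ω - F L ω) ^ 2 ∂μ)) atTop (𝓝 0) := by
      simpa using h.sqrt
    refine h2.congr fun L => ?_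
    rw [← MemLp.toLp_sub, eq_comm, ← Real.sqrt_sq (norm_nonneg _), ← real_inner_self_eq_norm_sq,
      L2.inner_def]
    congr 1
    refine integral_congr_ae ?_
    filter_upwards [((hF L).sub hf).coeFn_toLp] with ω hω
    rw [hω]
    simp only [Pi.sub_apply, real_inner_self_eq_norm_sq, Real.norm_eq_abs, sq_abs]
    ring
  have h := (key hg hG hgG).inner (𝕜 := ℝ) (key hf hF hfF)
  have hin : ∀ {f g : Ω → ℝ} (hf : MemLp f 2 μ) (hg : MemLp g 2 μ),
      inner ℝ (hg.toLp g) (hf.toLp f) = ∫ ω, f ω * g ω ∂μ := by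
    intro f g hf hg
    rw [L2.inner_def]
    refine integral_congr_ae ?_
    filter_upwards [hf.coeFn_toLp, hg.coeFn_toLp] with ω h1 h2
    rw [h1, h2]
    simp
  simpa only [hin] using h

lemma tendsto_ae_zero_of_summable_integral_sq {X : ℕ → Ω → ℝ} (hX : ∀ L, MemLp (X L) 2 μ)
    (hs : Summable fun L => ∫ ω, X L ω ^ 2 ∂μ) :
    ∀ᵐ ω ∂μ, Tendsto (fun L => X L ω) atTop (𝓝 0) := by
  have hmeas : ∀ L, AEMeasurable (fun ω => ENNReal.ofReal (X L ω ^ 2)) μ :=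
    fun L => ((hX L).1.aemeasurable.pow_const 2).ennreal_ofReal
  have h1 : ∫⁻ ω, ∑' L, ENNReal.ofReal (X L ω ^ 2) ∂μ ≠ ⊤ := by
    rw [lintegral_tsum hmeas]
    simp_rw [← ofReal_integral_eq_lintegral_ofReal (hX _).integrable_sq
      (ae_of_all _ fun ω => sq_nonneg _)]
    exact hs.tsum_ofReal_ne_top
  filter_upwards [ae_lt_top' (AEMeasurable.tsum hmeas) h1] with ω hω
  have h2 := ENNReal.tendsto_atTop_zero_of_tsum_ne_top hω.ne
  have h3 : Tendsto (fun L => X L ω ^ 2) atTop (𝓝 0) := by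
    have := (ENNReal.tendsto_toReal ENNReal.zero_ne_top).comp h2
    simpa [Function.comp_def, ENNReal.toReal_ofReal (sq_nonneg _)] using this
  have h4 := h3.sqrt
  simp only [Real.sqrt_sq_eq_abs, Real.sqrt_zero] at h4
  exact (tendsto_zero_iff_abs_tendsto_zero _).mpr h4

/-- Markov's inequality in the form used for stochastic orders of magnitude; a vanishing bound `b` is
allowed. -/
lemma exists_measure_le_of_integral_le [IsProbabilityMeasure μ] {Q : Ω → ℝ} (hQ : Integrable Q μ)
    (h0 : ∀ ω, 0 ≤ Q ω) {b η : ℝ} (hb : ∫ ω, Q ω ∂μ ≤ b) (hη : 0 < η) :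
    ∃ B : Set Ω, μ B ≤ ENNReal.ofReal η ∧ ∀ ω, ω ∉ B → Q ω ≤ b / η := by
  refine ⟨{ω | b / η < Q ω}, ?_, fun ω hω => not_lt.mp hω⟩
  have hb0 : 0 ≤ b := (integral_nonneg h0).trans hb
  rcases hb0.eq_or_lt with h | h
  · have h1 : ∫ ω, Q ω ∂μ = 0 := le_antisymm (hb.trans h.symm.le) (integral_nonneg h0)
    have h2 := (integral_eq_zero_iff_of_nonneg h0 hQ).mp h1
    have h3 : μ {ω | b / η < Q ω} = 0 := by
      rw [← h, zero_div]
      refine measure_mono_null (fun ω hω => ?_) (ae_iff.mp h2)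
      exact (ne_of_gt (show 0 < Q ω from hω) : Q ω ≠ 0)
    rw [h3]; exact zero_le
  · have h1 := mul_meas_ge_le_integral_of_nonneg (ae_of_all μ h0) hQ (b / η)
    have h2 : μ.real {ω | b / η ≤ Q ω} ≤ η := by
      have h3 : b / η * μ.real {ω | b / η ≤ Q ω} ≤ b := h1.trans hb
      rw [div_mul_eq_mul_div, div_le_iff₀ hη] at h3
      exact le_of_mul_le_mul_left h3 h
    calc μ {ω | b / η < Q ω} ≤ μ {ω | b / η ≤ Q ω} := measure_mono fun ω hω => (show b / η < Q ω from hω).le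
      _ = ENNReal.ofReal (μ.real {ω | b / η ≤ Q ω}) := by
          rw [measureReal_def, ENNReal.ofReal_toReal (measure_ne_top _ _)]
      _ ≤ ENNReal.ofReal η := ENNReal.ofReal_le_ofReal h2

lemma variance_le_integral_sub_sq [IsProbabilityMeasure μ] {X : Ω → ℝ} (hX : MemLp X 2 μ) (c : ℝ) :
    Var[X; μ] ≤ ∫ ω, (X ω - c) ^ 2 ∂μ := by
  rw [← variance_sub_const hX.1 c]
  exact variance_le_expectation_sq (hX.sub (memLp_const c)).1

end SecondMoments

/-! ### Inputs and innovations in open loop -/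

/-- The standing assumptions on the input and the noise, gathered. -/
structure IsOpenLoop {Ω : Type*} [MeasurableSpace Ω] {m p : ℕ} (μ : Measure Ω)
    (u : ℤ → Ω → Fin m → ℝ) (e : ℤ → Ω → Fin p → ℝ) (Φ : ℝ → Matrix (Fin m) (Fin m) ℂ)
    (V : Matrix (Fin p) (Fin p) ℝ) (δ : ℕ → ℝ) : Prop where
  meas : ∀ t, Measurable (u t)
  spec : HasSpectralDensity μ u Φ
  erg : SecondOrderErgodic μ u δ
  innov : IsInnovation μ u e V

/-- The joint process of two signals; `(u, e)` drives the system and `(u, y)` is what is recorded. -/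
def joint {Ω : Type*} {m p : ℕ} (u : ℤ → Ω → Fin m → ℝ) (e : ℤ → Ω → Fin p → ℝ) (t : ℤ) (ω : Ω) :
    Fin m ⊕ Fin p → ℝ :=
  Sum.elim (u t ω) (e t ω)

section History

variable {Ω : Type*} {m p : ℕ} {u : ℤ → Ω → Fin m → ℝ} {e : ℤ → Ω → Fin p → ℝ}

lemma stronglyMeasurable_input (t s : ℤ) (a : Fin m) :
    StronglyMeasurable[history u e t] fun ω => u s ω a := by
  have h : Measurable[history u e t] (u s) := by
    rw [measurable_iff_comap_le]
    exact (le_iSup (fun s => MeasurableSpace.comap (u s) inferInstance) s).trans le_sup_left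
  exact ((measurable_pi_apply a).comp h).stronglyMeasurable

lemma stronglyMeasurable_noise {t s : ℤ} (hst : s < t) (b : Fin p) :
    StronglyMeasurable[history u e t] fun ω => e s ω b := by
  have h : Measurable[history u e t] (e s) := by
    rw [measurable_iff_comap_le]
    exact (le_iSup (fun s : {s : ℤ // s < t} => MeasurableSpace.comap (e s) inferInstance)
      ⟨s, hst⟩).trans le_sup_right
  exact ((measurable_pi_apply b).comp h).stronglyMeasurable

end History

namespace IsOpenLoop

variable {Ω : Type*} [MeasurableSpace Ω] {m p : ℕ} {μ : Measure Ω}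
  {u : ℤ → Ω → Fin m → ℝ} {e : ℤ → Ω → Fin p → ℝ} {Φ : ℝ → Matrix (Fin m) (Fin m) ℂ}
  {V : Matrix (Fin p) (Fin p) ℝ} {δ : ℕ → ℝ}

lemma history_le (h : IsOpenLoop μ u e Φ V δ) (t : ℤ) : history u e t ≤ ‹MeasurableSpace Ω› :=
  sup_le (iSup_le fun s => (h.meas s).comap_le) (iSup_le fun s => (h.innov.measurable s).comap_le)

lemma memLp_joint (h : IsOpenLoop μ u e Φ V δ) (t : ℤ) (c : Fin m ⊕ Fin p) :
    MemLp (fun ω => joint u e t ω c) 4 μ := by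
  rcases c with a | b
  · exact h.erg.memLp t a
  · exact h.innov.memLp t b

variable [IsProbabilityMeasure μ]

/-- The noise is uncorrelated with every function of the inputs and the past noise. -/
lemma integral_mul_noise (h : IsOpenLoop μ u e Φ V δ) {t : ℤ} {X : Ω → ℝ}
    (hX : StronglyMeasurable[history u e t] X) (b : Fin p)
    (hint : Integrable (fun ω => X ω * e t ω b) μ) : ∫ ω, X ω * e t ω b ∂μ = 0 := by
  have he : Integrable (fun ω => e t ω b) μ := (h.innov.memLp t b).integrable (by norm_num)
  rw [← integral_condExp (h.history_le t)]
  have h1 := condExp_mul_of_stronglyMeasurable_left (g := fun ω => e t ω b) hX hint he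
  refine integral_eq_zero_of_ae ?_
  filter_upwards [h1, h.innov.condMean t b] with ω h1 h2
  have h3 : μ[fun ω => X ω * e t ω b | history u e t] ω = X ω * 0 := by
    rw [← h2]; exact h1
  rw [h3]; simp

lemma integral_mul_noise_mul_noise (h : IsOpenLoop μ u e Φ V δ) {t : ℤ} {X : Ω → ℝ}
    (hX : StronglyMeasurable[history u e t] X) (b c : Fin p)
    (hint : Integrable (fun ω => X ω * (e t ω b * e t ω c)) μ) :
    ∫ ω, X ω * (e t ω b * e t ω c) ∂μ = V b c * ∫ ω, X ω ∂μ := by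
  have he : Integrable (fun ω => e t ω b * e t ω c) μ :=
    (memLp_two_mul (h.innov.memLp t b) (h.innov.memLp t c)).integrable (by norm_num)
  rw [← integral_condExp (h.history_le t), ← integral_const_mul]
  have h1 := condExp_mul_of_stronglyMeasurable_left (g := fun ω => e t ω b * e t ω c) hX hint he
  refine integral_congr_ae ?_
  filter_upwards [h1, h.innov.condVar t b c] with ω h1 h2
  have h3 : μ[fun ω => X ω * (e t ω b * e t ω c) | history u e t] ω = X ω * V b c := by
    rw [← h2]; exact h1
  rw [h3, mul_comm]

/-- Sums of noise weighted by functions of the inputs and the past are martingale transforms. -/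
lemma integral_sum_mul_noise_sq (h : IsOpenLoop μ u e Φ V δ) (t : ℤ) (b : Fin p) (N : ℕ)
    {f : ℕ → Ω → ℝ} (hf : ∀ j : ℕ, StronglyMeasurable[history u e (t + j)] (f j))
    (hf4 : ∀ j, MemLp (f j) 4 μ) :
    ∫ ω, (∑ j ∈ Finset.range N, f j ω * e (t + j) ω b) ^ 2 ∂μ =
      V b b * ∑ j ∈ Finset.range N, ∫ ω, f j ω ^ 2 ∂μ := by
  have hd : ∀ j : ℕ, MemLp (fun ω => f j ω * e (t + j) ω b) 2 μ :=
    fun j => memLp_two_mul (hf4 j) (h.innov.memLp _ b)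
  have horth : ∀ i j : ℕ, i < j →
      ∫ ω, (f i ω * e (t + i) ω b) * (f j ω * e (t + j) ω b) ∂μ = 0 := by
    intro i j hij
    have hX : StronglyMeasurable[history u e (t + j)] fun ω => f i ω * e (t + i) ω b * f j ω := by
      refine ((hf i).mono ?_ |>.mul (stronglyMeasurable_noise (by omega) b)).mul (hf j)
      refine sup_le_sup_left (iSup_le fun s => ?_) _
      exact le_iSup (fun s : {s : ℤ // s < t + j} => MeasurableSpace.comap (e s) inferInstance)
        ⟨s, by have := s.2; omega⟩
    have h1 : (fun ω => (f i ω * e (t + i) ω b) * (f j ω * e (t + j) ω b))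
        = fun ω => f i ω * e (t + i) ω b * f j ω * e (t + j) ω b := by ext ω; ring
    have hint : Integrable (fun ω => f i ω * e (t + i) ω b * f j ω * e (t + j) ω b) μ := by
      rw [← h1]; exact (hd i).integrable_mul (hd j)
    rw [h1]
    exact h.integral_mul_noise hX b hint
  rw [integral_sum_sq_of_orthogonal _ fun j _ => hd j, Finset.mul_sum]
  · refine Finset.sum_congr rfl fun j _ => ?_
    have h1 : (fun ω => (f j ω * e (t + j) ω b) ^ 2)
        = fun ω => f j ω ^ 2 * (e (t + j) ω b * e (t + j) ω b) := by ext ω; ring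
    have hint := (hd j).integrable_sq
    rw [h1] at hint ⊢
    exact h.integral_mul_noise_mul_noise ((hf j).pow 2) b b hint
  · intro i _ j _ hij
    rcases hij.lt_or_gt with hlt | hlt
    · exact horth i j hlt
    · rw [← horth j i hlt]
      exact integral_congr_ae (ae_of_all _ fun ω => mul_comm _ _)

/-- The fourth moments of the input and of the noise are bounded uniformly in time; for the input
this follows from stationarity and from the ergodicity bound for a single sample. -/
lemma exists_moment_le (h : IsOpenLoop μ u e Φ V δ) :
    ∃ κ : ℝ, 0 ≤ κ ∧ ∀ t c, ∫ ω, joint u e t ω c ^ 4 ∂μ ≤ κ ∧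
      ∫ ω, joint u e t ω c ^ 2 ∂μ ≤ κ := by
  obtain ⟨κe, hκe⟩ := h.innov.fourth_moment
  have hsq : ∀ t a, ∫ ω, u t ω a ^ 2 ∂μ = ∫ ω, u 0 ω a ^ 2 ∂μ := by
    intro t a
    have hv : ∀ t : ℤ, ∫ ω, u t ω a ^ 2 ∂μ
        = cov[fun ω => u t ω a, fun ω => u t ω a; μ] + (∫ ω, u 0 ω a ∂μ) ^ 2 := by
      intro t
      rw [covariance_eq_sub (h.spec.memLp t a) (h.spec.memLp t a), h.spec.mean t a]
      simp only [Pi.mul_apply, sq]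
      ring
    have hc : cov[fun ω => u t ω a, fun ω => u t ω a; μ]
        = cov[fun ω => u 0 ω a, fun ω => u 0 ω a; μ] := by
      have h1 := h.spec.autocov t 0 a a
      have h2 := h.spec.autocov 0 0 a a
      simp only [add_zero] at h1 h2
      exact_mod_cast h1.trans h2.symm
    rw [hv t, hv 0, hc]
  have hu4 : ∀ t a, ∫ ω, u t ω a ^ 4 ∂μ ≤ δ 1 + (∫ ω, u 0 ω a ^ 2 ∂μ) ^ 2 := by
    intro t a
    have h1 := h.erg.variance_le t 0 1 a a le_rfl
    simp only [Finset.sum_range_one, Nat.cast_zero, add_zero, Nat.cast_one, div_one] at h1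
    rw [variance_eq_sub (memLp_two_mul (h.erg.memLp t a) (h.erg.memLp t a))] at h1
    have h2 : ∫ ω, ((fun ω => u t ω a * u t ω a) ^ 2) ω ∂μ = ∫ ω, u t ω a ^ 4 ∂μ :=
      integral_congr_ae (ae_of_all _ fun ω => by simp only [Pi.pow_apply]; ring)
    have h3 : ∫ ω, u t ω a * u t ω a ∂μ = ∫ ω, u 0 ω a ^ 2 ∂μ := by
      rw [← hsq t a]
      exact integral_congr_ae (ae_of_all _ fun ω => (sq _).symm)
    rw [h2, h3] at h1
    linarith
  set κ₄ := |δ 1| + ∑ a, (∫ ω, u 0 ω a ^ 2 ∂μ) ^ 2 + |κe| with hκ₄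
  have hS0 : 0 ≤ ∑ a, (∫ ω, u 0 ω a ^ 2 ∂μ) ^ 2 := Finset.sum_nonneg fun a _ => sq_nonneg _
  have hκ0 : 0 ≤ κ₄ := by positivity
  have h4 : ∀ t c, ∫ ω, joint u e t ω c ^ 4 ∂μ ≤ κ₄ := by
    intro t c
    rcases c with a | b
    · have h1 := hu4 t a
      have h2 := Finset.single_le_sum (f := fun a => (∫ ω, u 0 ω a ^ 2 ∂μ) ^ 2)
        (fun a _ => sq_nonneg _) (Finset.mem_univ a)
      have h3 := le_abs_self (δ 1)
      have h4 := abs_nonneg κe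
      simp only [joint, Sum.elim_inl]
      linarith
    · have h1 := hκe t b
      have h3 := abs_nonneg (δ 1)
      have h4 := le_abs_self κe
      simp only [joint, Sum.elim_inr]
      linarith
  refine ⟨κ₄ + 1, by linarith, fun t c => ⟨(h4 t c).trans (by linarith), ?_⟩⟩
  have hm := h.memLp_joint t c
  have hi : Integrable (fun ω => joint u e t ω c ^ 4) μ :=
    (memLp_two_mul hm hm).integrable_sq.congr (ae_of_all _ fun ω => by ring)
  calc ∫ ω, joint u e t ω c ^ 2 ∂μ ≤ ∫ ω, (joint u e t ω c ^ 4 + 1) ∂μ := by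
        refine integral_mono (hm.mono_exponent (by norm_num)).integrable_sq
          (hi.add (integrable_const 1)) fun ω => ?_
        change joint u e t ω c ^ 2 ≤ joint u e t ω c ^ 4 + 1
        nlinarith [sq_nonneg (joint u e t ω c ^ 2 - 1), sq_nonneg (joint u e t ω c)]
    _ ≤ κ₄ + 1 := by
        rw [integral_add hi (integrable_const 1)]
        simpa using h4 t c

/-- All sample second moments of the process `(u, e)` have variance `O(δ_N + 1 / N)`: for two inputs
by assumption, for the others because they are averages of martingale differences. -/
lemma exists_variance_joint_le (h : IsOpenLoop μ u e Φ V δ) :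
    ∃ K : ℝ, 0 ≤ K ∧ ∀ (s t : ℤ) (N : ℕ) (c d : Fin m ⊕ Fin p), 1 ≤ N →
      Var[fun ω => (∑ j ∈ Finset.range N, joint u e (s + j) ω c * joint u e (t + j) ω d) / N; μ]
        ≤ K * (|δ N| + 1 / N) := by
  obtain ⟨κ, hκ0, hκ⟩ := h.exists_moment_le
  set v := ∑ b, |V b b| with hv
  have hv0 : 0 ≤ v := Finset.sum_nonneg fun b _ => abs_nonneg _
  have hvb : ∀ b, |V b b| ≤ v := fun b =>
    Finset.single_le_sum (f := fun b => |V b b|) (fun b _ => abs_nonneg _) (Finset.mem_univ b)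
  refine ⟨1 + v * κ + κ, by positivity, fun s t N c d hN => ?_⟩
  have hNpos : (0 : ℝ) < N := by exact_mod_cast hN
  have hprod : ∀ (s t : ℤ) c d, MemLp (fun ω => joint u e s ω c * joint u e t ω d) 2 μ :=
    fun s t c d => memLp_two_mul (h.memLp_joint s c) (h.memLp_joint t d)
  have hmem : ∀ (s t : ℤ) c d, MemLp (fun ω =>
      (∑ j ∈ Finset.range N, joint u e (s + j) ω c * joint u e (t + j) ω d) / N) 2 μ := by
    intro s t c d
    simp_rw [div_eq_inv_mul]
    exact (memLp_finsetSum _ fun j _ => hprod _ _ _ _).const_mul _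
  have hδ := abs_nonneg (δ N)
  have hN1 : 0 ≤ 1 / (N : ℝ) := by positivity
  -- averages of products of the noise with functions of the past
  have key : ∀ (s t : ℤ) (c : Fin m ⊕ Fin p) (b : Fin p),
      (∀ j : ℕ, StronglyMeasurable[history u e (t + j)] fun ω => joint u e (s + j) ω c) →
      Var[fun ω => (∑ j ∈ Finset.range N,
        joint u e (s + j) ω c * joint u e (t + j) ω (Sum.inr b)) / N; μ] ≤ v * κ * (1 / N) := by
    intro s t c b hsm
    refine (variance_le_expectation_sq (hmem _ _ _ _).1).trans ?_
    have h1 := h.integral_sum_mul_noise_sq t b N hsm fun j => h.memLp_joint _ _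
    have h2 : ∫ ω, ((fun ω => (∑ j ∈ Finset.range N,
        joint u e (s + j) ω c * joint u e (t + j) ω (Sum.inr b)) / N) ^ 2) ω ∂μ
        = (V b b * ∑ j ∈ Finset.range N, ∫ ω, joint u e (s + j) ω c ^ 2 ∂μ) / (N : ℝ) ^ 2 := by
      rw [← h1, ← integral_div]
      refine integral_congr_ae (ae_of_all _ fun ω => ?_)
      simp only [Pi.pow_apply, div_pow, joint, Sum.elim_inr]
    rw [h2, div_le_iff₀ (by positivity)]
    have h3 : ∑ j ∈ Finset.range N, ∫ ω, joint u e (s + j) ω c ^ 2 ∂μ ≤ N * κ := by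
      calc ∑ j ∈ Finset.range N, ∫ ω, joint u e (s + j) ω c ^ 2 ∂μ
          ≤ ∑ j ∈ Finset.range N, κ := Finset.sum_le_sum fun j _ => (hκ (s + j) c).2
        _ = N * κ := by simp
    have h4 : 0 ≤ ∑ j ∈ Finset.range N, ∫ ω, joint u e (s + j) ω c ^ 2 ∂μ :=
      Finset.sum_nonneg fun j _ => integral_nonneg fun ω => sq_nonneg _
    calc V b b * ∑ j ∈ Finset.range N, ∫ ω, joint u e (s + j) ω c ^ 2 ∂μ
        ≤ v * (N * κ) := mul_le_mul ((le_abs_self _).trans (hvb b)) h3 h4 hv0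
      _ = v * κ * (1 / N) * N ^ 2 := by field_simp
  have hκδ : 0 ≤ κ * |δ N| := by positivity
  have hκN : 0 ≤ κ * (1 / (N : ℝ)) := by positivity
  have hvδ : 0 ≤ v * κ * |δ N| := by positivity
  have hvN : 0 ≤ v * κ * (1 / (N : ℝ)) := by positivity
  have hswap : (fun ω => (∑ j ∈ Finset.range N, joint u e (s + j) ω c * joint u e (t + j) ω d) / N)
      = fun ω => (∑ j ∈ Finset.range N, joint u e (t + j) ω d * joint u e (s + j) ω c) / (N : ℝ) := by
    ext ω
    simp_rw [mul_comm]
  rcases c with a | b <;> rcases d with a' | b'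
  · have h1 := h.erg.variance_le s (t - s) N a a' hN
    have h2 : ∀ j : ℕ, s + j + (t - s) = t + j := fun j => by ring
    simp only [h2] at h1
    refine h1.trans ?_
    have := le_abs_self (δ N)
    nlinarith
  · refine (key s t (Sum.inl a) b' fun j => stronglyMeasurable_input _ _ a).trans ?_
    nlinarith
  · rw [hswap]
    refine (key t s (Sum.inl a') b fun j => stronglyMeasurable_input _ _ a').trans ?_
    nlinarith
  · rcases lt_trichotomy s t with hst | hst | hst
    · refine (key s t (Sum.inr b) b' fun j => stronglyMeasurable_noise (by omega) b).trans ?_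
      nlinarith
    · subst hst
      -- the products of simultaneous noises, centred by `V`, are martingale differences
      have hvar := variance_le_integral_sub_sq (hmem s s (Sum.inr b) (Sum.inr b')) (V b b')
      refine hvar.trans ?_
      set dd : ℕ → Ω → ℝ := fun j ω => e (s + j) ω b * e (s + j) ω b' - V b b' with hdd
      have hee : ∀ j : ℕ, MemLp (fun ω => e (s + j) ω b * e (s + j) ω b') 2 μ :=
        fun j => memLp_two_mul (h.innov.memLp _ _) (h.innov.memLp _ _)
      have hdd2 : ∀ j, MemLp (dd j) 2 μ := fun j => (hee j).sub (memLp_const _)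
      have hEe : ∀ j : ℕ, ∫ ω, e (s + j) ω b * e (s + j) ω b' ∂μ = V b b' := by
        intro j
        have h1 := h.integral_mul_noise_mul_noise (t := s + j) (X := fun _ => 1)
          stronglyMeasurable_const b b' (by simpa using (hee j).integrable (by norm_num))
        simpa using h1
      have horth : ∀ i j : ℕ, i < j → ∫ ω, dd i ω * dd j ω ∂μ = 0 := by
        intro i j hij
        have hX : StronglyMeasurable[history u e (s + j)] (dd i) :=
          ((stronglyMeasurable_noise (by omega) b).mul
            (stronglyMeasurable_noise (by omega) b')).sub stronglyMeasurable_const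
        have hint : Integrable (fun ω => dd i ω * (e (s + j) ω b * e (s + j) ω b')) μ :=
          (hdd2 i).integrable_mul (hee j)
        have hint' : Integrable (dd i) μ := (hdd2 i).integrable (by norm_num)
        have h1 := h.integral_mul_noise_mul_noise hX b b' hint
        have h2 : (fun ω => dd i ω * dd j ω)
            = fun ω => dd i ω * (e (s + j) ω b * e (s + j) ω b') - V b b' * dd i ω := by
          ext ω; simp only [hdd]; ring
        rw [h2, integral_sub hint (hint'.const_mul _), h1, integral_const_mul, sub_self]
      have hsum := integral_sum_sq_of_orthogonal (Finset.range N) (fun j _ => hdd2 j)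
        fun i _ j _ hij => by
          rcases hij.lt_or_gt with hlt | hlt
          · exact horth i j hlt
          · rw [← horth j i hlt]
            exact integral_congr_ae (ae_of_all _ fun ω => mul_comm _ _)
      have hterm : ∀ j, ∫ ω, dd j ω ^ 2 ∂μ ≤ κ := by
        intro j
        have h1 := integral_sq_mul_sq_le (h.memLp_joint (s + j) (Sum.inr b))
          (h.memLp_joint (s + j) (Sum.inr b')) (hκ _ _).1 (hκ _ _).1
        refine le_trans ?_ h1
        have h2 := variance_le_expectation_sq (hee j).1
        rw [variance_eq_integral (hee j).1.aemeasurable, hEe j] at h2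
        exact h2
      have h5 : ∫ ω, ((∑ j ∈ Finset.range N, joint u e (s + j) ω (Sum.inr b) *
          joint u e (s + j) ω (Sum.inr b')) / N - V b b') ^ 2 ∂μ
          = (∫ ω, (∑ j ∈ Finset.range N, dd j ω) ^ 2 ∂μ) / (N : ℝ) ^ 2 := by
        rw [← integral_div]
        refine integral_congr_ae (ae_of_all _ fun ω => ?_)
        simp only [hdd, joint, Sum.elim_inr, Finset.sum_sub_distrib, Finset.sum_const,
          Finset.card_range, nsmul_eq_mul]
        field_simp
      rw [h5, hsum, div_le_iff₀ (by positivity)]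
      have h6 : ∑ j ∈ Finset.range N, ∫ ω, dd j ω ^ 2 ∂μ ≤ N * κ :=
        (Finset.sum_le_sum fun j _ => hterm j).trans (by simp)
      have h7 : (N : ℝ) * κ = κ * (1 / N) * N ^ 2 := by field_simp
      rw [h7] at h6
      refine h6.trans (mul_le_mul_of_nonneg_right ?_ (by positivity))
      nlinarith
    · rw [hswap]
      refine (key t s (Sum.inr b') b fun j => stronglyMeasurable_noise (by omega) b').trans ?_
      nlinarith

end IsOpenLoop

/-! ### Truncated expansions of the recorded signals -/

section NoiseExpansion

variable {Ω : Type*} {n m p : ℕ} {S : InnovModel n m p} {u : ℤ → Ω → Fin m → ℝ}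
  {e : ℤ → Ω → Fin p → ℝ}

/-- The weighted sum of inputs and outputs with weights `g`, expanded in inputs and noise and cut off
after `L` steps into the past. -/
def noiseExpansion (S : InnovModel n m p) (u : ℤ → Ω → Fin m → ℝ) (e : ℤ → Ω → Fin p → ℝ)
    (g : ℕ → Fin m ⊕ Fin p → ℝ) (t : ℤ) (L : ℕ) (ω : Ω) : ℝ :=
  ∑ i ∈ Finset.range L, S.noiseWeight g i ⬝ᵥ joint u e (t - i) ω

lemma stronglyMeasurable_noiseExpansion {g : ℕ → Fin m ⊕ Fin p → ℝ} {s t : ℤ}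
    (hg : ∀ (i : ℕ) b, S.noiseWeight g i (Sum.inr b) = 0 ∨ s - i < t) (L : ℕ) :
    StronglyMeasurable[history u e t] (noiseExpansion S u e g s L) := by
  refine Finset.stronglyMeasurable_fun_sum
    (f := fun i ω => S.noiseWeight g i ⬝ᵥ joint u e (s - i) ω) _ fun i _ => ?_
  refine Finset.stronglyMeasurable_fun_sum
    (f := fun c ω => S.noiseWeight g i c * joint u e (s - i) ω c) _ fun c _ => ?_
  rcases c with a | b
  · exact stronglyMeasurable_const.mul (stronglyMeasurable_input _ _ a)
  · rcases hg i b with h | h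
    · simp only [h, zero_mul]
      exact stronglyMeasurable_const
    · exact stronglyMeasurable_const.mul (stronglyMeasurable_noise h b)

end NoiseExpansion

section SteadyState

variable {Ω : Type*} [MeasurableSpace Ω] {μ : Measure Ω}
  {n m p : ℕ} {S : InnovModel n m p} {x : ℤ → Ω → Fin n → ℝ}
  {u : ℤ → Ω → Fin m → ℝ} {y e : ℤ → Ω → Fin p → ℝ}
  {Φ : ℝ → Matrix (Fin m) (Fin m) ℂ} {V : Matrix (Fin p) (Fin p) ℝ} {δ : ℕ → ℝ}

lemma IsSteadyState.ae_isTrajectory (hsys : IsSteadyState S μ x u y e) :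
    ∀ᵐ ω ∂μ, S.IsTrajectory (fun t => x t ω) (fun t => u t ω) (fun t => y t ω) (fun t => e t ω) := by
  filter_upwards [ae_all_iff.mpr hsys.state, ae_all_iff.mpr hsys.output] with ω h1 h2
  exact ⟨h1, h2⟩

lemma IsOpenLoop.memLp_noiseExpansion (h : IsOpenLoop μ u e Φ V δ) (g : ℕ → Fin m ⊕ Fin p → ℝ) (t : ℤ)
    (L : ℕ) : MemLp (noiseExpansion S u e g t L) 4 μ := by
  refine memLp_finsetSum (f := fun i ω => S.noiseWeight g i ⬝ᵥ joint u e (t - i) ω) _ fun i _ => ?_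
  exact memLp_finsetSum (f := fun c ω => S.noiseWeight g i c * joint u e (t - i) ω c) _
    fun c _ => (h.memLp_joint _ c).const_mul _

variable [IsProbabilityMeasure μ]

/-- The truncations of a finite weighted sum of inputs and outputs converge to it, in mean square and
almost surely: the remainder is the state in the remote past, damped by the powers of `A`. -/
lemma IsOpenLoop.tendsto_noiseExpansion (h : IsOpenLoop μ u e Φ V δ)
    (hsys : IsSteadyState S μ x u y e) (hA : SchurStable S.A) {g : ℕ → Fin m ⊕ Fin p → ℝ} {L₀ : ℕ}
    (hg : ∀ i, L₀ ≤ i → g i = 0) (t : ℤ) :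
    MemLp (fun ω => ∑ i ∈ Finset.range L₀, g i ⬝ᵥ joint u y (t - i) ω) 2 μ ∧
    Tendsto (fun L => ∫ ω, (∑ i ∈ Finset.range L₀, g i ⬝ᵥ joint u y (t - i) ω -
      noiseExpansion S u e g t (L₀ + L) ω) ^ 2 ∂μ) atTop (𝓝 0) ∧
    ∀ᵐ ω ∂μ, Tendsto (fun L => noiseExpansion S u e g t (L₀ + L) ω) atTop
      (𝓝 (∑ i ∈ Finset.range L₀, g i ⬝ᵥ joint u y (t - i) ω)) := by
  obtain ⟨κ, hκ⟩ := hsys.bounded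
  set r : ℕ → Ω → ℝ := fun L ω => S.costate g (L₀ + L) ⬝ᵥ x (t - (L₀ + L : ℕ) + 1) ω with hr
  have hrmem : ∀ L, MemLp (r L) 2 μ := fun L =>
    memLp_finsetSum (f := fun a ω => S.costate g (L₀ + L) a * x (t - (L₀ + L : ℕ) + 1) ω a) _
      fun a _ => (hsys.memLp _ a).const_mul _
  have heq : ∀ᵐ ω ∂μ, ∀ L, ∑ i ∈ Finset.range L₀, g i ⬝ᵥ joint u y (t - i) ω
      = r L ω + noiseExpansion S u e g t (L₀ + L) ω := by
    filter_upwards [hsys.ae_isTrajectory] with ω hω L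
    have h1 := InnovModel.sum_weight_eq hω g t (L₀ + L)
    have h2 : ∑ i ∈ Finset.range (L₀ + L), g i ⬝ᵥ Sum.elim (u (t - i) ω) (y (t - i) ω)
        = ∑ i ∈ Finset.range L₀, g i ⬝ᵥ joint u y (t - i) ω := by
      rw [Finset.sum_range_add]
      have h3 : ∀ k, g (L₀ + k) = 0 := fun k => hg _ (Nat.le_add_right _ _)
      simp [h3, joint]
    rw [← h2, h1]
    rfl
  have hdiff : ∀ L, (fun ω => ∑ i ∈ Finset.range L₀, g i ⬝ᵥ joint u y (t - i) ω -
      noiseExpansion S u e g t (L₀ + L) ω) =ᵐ[μ] r L := by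
    intro L
    filter_upwards [heq] with ω hω
    rw [hω L]; ring
  have hs := (summable_nat_add_iff L₀).mpr (S.summable_costate hA hg)
  set s : ℕ → ℝ := fun L => ∑ a, |S.costate g (L + L₀) a| with hsdef
  have hs0 : ∀ L, 0 ≤ s L := fun L => Finset.sum_nonneg fun _ _ => abs_nonneg _
  have hsq : Summable fun L => s L ^ 2 * κ := by
    refine Summable.mul_right _ ?_
    refine Summable.of_nonneg_of_le (fun L => sq_nonneg _) (fun L => ?_) (hs.mul_left (∑' L, s L))
    rw [sq]
    exact mul_le_mul_of_nonneg_right (hs.le_tsum L fun j _ => hs0 j) (hs0 L)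
  have hrle : ∀ L, ∫ ω, r L ω ^ 2 ∂μ ≤ s L ^ 2 * κ := by
    intro L
    have h1 := integral_sum_mul_sq_le Finset.univ (S.costate g (L₀ + L)) (K := κ)
      (fun a _ => hsys.memLp (t - (L₀ + L : ℕ) + 1) a) fun a _ => hκ _ a
    rw [add_comm L₀ L] at h1
    simp only [hr, add_comm L₀ L]
    exact h1
  have hsum : Summable fun L => ∫ ω, r L ω ^ 2 ∂μ :=
    Summable.of_nonneg_of_le (fun L => integral_nonneg fun ω => sq_nonneg _) hrle hsq
  refine ⟨?_, ?_, ?_⟩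
  · have h1 := (hrmem 0).add ((h.memLp_noiseExpansion (S := S) g t (L₀ + 0)).mono_exponent
      (by norm_num : (2 : ENNReal) ≤ 4))
    refine h1.ae_eq ?_
    filter_upwards [heq] with ω hω
    exact (hω 0).symm
  · refine hsum.tendsto_atTop_zero.congr fun L => ?_
    refine integral_congr_ae ?_
    filter_upwards [hdiff L] with ω hω
    rw [hω]
  · filter_upwards [heq, tendsto_ae_zero_of_summable_integral_sq hrmem hsum] with ω h1 h2
    have h3 : (fun L => noiseExpansion S u e g t (L₀ + L) ω)
        = fun L => ∑ i ∈ Finset.range L₀, g i ⬝ᵥ joint u y (t - i) ω - r L ω := by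
      ext L; rw [h1 L]; ring
    rw [h3]
    simpa using h2.const_sub (∑ i ∈ Finset.range L₀, g i ⬝ᵥ joint u y (t - i) ω)

/-! ### Uniform positivity of the second-moment matrix of the recorded data -/

lemma exists_mul_l2_sq_le_of_posDef {p : ℕ} {V : Matrix (Fin p) (Fin p) ℝ} (hV : V.PosDef) :
    ∃ v : ℝ, 0 < v ∧ ∀ η, v * l2 η ^ 2 ≤ η ⬝ᵥ V *ᵥ η := by
  set q : EuclideanSpace ℝ (Fin p) → ℝ := fun η => WithLp.ofLp η ⬝ᵥ V *ᵥ WithLp.ofLp η with hq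
  have hcont : Continuous q := by
    simp only [hq, dotProduct, Matrix.mulVec]
    fun_prop
  rcases (Metric.sphere (0 : EuclideanSpace ℝ (Fin p)) 1).eq_empty_or_nonempty with hemp | hne
  · refine ⟨1, one_pos, fun η => ?_⟩
    have h0 : η = 0 := by
      by_contra hη
      have hη' : (WithLp.toLp 2 η : EuclideanSpace ℝ (Fin p)) ≠ 0 := by simpa using hη
      have : ‖(WithLp.toLp 2 η : EuclideanSpace ℝ (Fin p))‖⁻¹ • WithLp.toLp 2 η
          ∈ Metric.sphere (0 : EuclideanSpace ℝ (Fin p)) 1 := by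
        simp [norm_smul, norm_ne_zero_iff.mpr hη']
      rw [hemp] at this
      exact this
    subst h0
    simp [l2]
  · obtain ⟨η₀, hη₀, hmin⟩ := (isCompact_sphere _ _).exists_isMinOn hne hcont.continuousOn
    have hη₀ne : WithLp.ofLp η₀ ≠ 0 := by
      intro h
      have : η₀ = 0 := by ext i; exact congrFun h i
      rw [this] at hη₀
      simp at hη₀
    refine ⟨q η₀, by simpa using hV.dotProduct_mulVec_pos hη₀ne, fun η => ?_⟩
    rcases eq_or_ne η 0 with rfl | hη
    · simp [l2]
    · have hη' : (WithLp.toLp 2 η : EuclideanSpace ℝ (Fin p)) ≠ 0 := by simpa using hη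
      have hpos : 0 < l2 η := norm_pos_iff.mpr hη'
      have hmem : (l2 η)⁻¹ • WithLp.toLp 2 η ∈ Metric.sphere (0 : EuclideanSpace ℝ (Fin p)) 1 := by
        simp [norm_smul, l2, norm_ne_zero_iff.mpr hη']
      have h1 : q η₀ ≤ q ((l2 η)⁻¹ • WithLp.toLp 2 η) := hmin hmem
      have h2 : q ((l2 η)⁻¹ • WithLp.toLp 2 η) = (l2 η)⁻¹ ^ 2 * (η ⬝ᵥ V *ᵥ η) := by
        simp only [hq, WithLp.ofLp_smul, Matrix.mulVec_smul, smul_dotProduct, dotProduct_smul,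
          smul_eq_mul]
        ring
      rw [h2] at h1
      have h3 := mul_le_mul_of_nonneg_right h1 (sq_nonneg (l2 η))
      refine h3.trans (le_of_eq ?_)
      field_simp

/-- Finite sums of inputs and noise have second moments bounded below: the two parts are orthogonal,
the input part is controlled by the spectral density and the noise is white. -/
lemma IsOpenLoop.exists_le_integral_sum_joint_sq (h : IsOpenLoop μ u e Φ V δ)
    (hΦ : BoundedAwayFromZero Φ) (hV : V.PosDef) :
    ∃ c : ℝ, 0 < c ∧ ∀ (w : ℕ → Fin m ⊕ Fin p → ℝ) (t : ℤ) (L : ℕ),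
      c * ∑ i ∈ Finset.range L, l2 (w i) ^ 2 ≤
        ∫ ω, (∑ i ∈ Finset.range L, w i ⬝ᵥ joint u e (t - i) ω) ^ 2 ∂μ := by
  obtain ⟨c, hc, hvar⟩ := h.spec.exists_le_variance hΦ
  obtain ⟨v, hv, hVle⟩ := exists_mul_l2_sq_le_of_posDef hV
  refine ⟨min c v, lt_min hc hv, fun w t L => ?_⟩
  set ga : ℕ → Fin m → ℝ := fun i a => w i (Sum.inl a) with hga
  set et : ℕ → Fin p → ℝ := fun i b => w i (Sum.inr b) with het
  set X : Ω → ℝ := fun ω => ∑ i ∈ Finset.range L, ga i ⬝ᵥ u (t - i) ω with hX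
  set d : ℕ → Ω → ℝ := fun i ω => et i ⬝ᵥ e (t - i) ω with hd
  have hdmem : ∀ i, MemLp (d i) 2 μ := fun i =>
    memLp_finsetSum (f := fun b ω => et i b * e (t - i) ω b) _ fun b _ =>
      ((h.innov.memLp _ b).mono_exponent (by norm_num : (2 : ENNReal) ≤ 4)).const_mul _
  have hXmem : MemLp X 2 μ :=
    memLp_finsetSum (f := fun i ω => ga i ⬝ᵥ u (t - i) ω) _ fun i _ =>
      memLp_finsetSum (f := fun a ω => ga i a * u (t - i) ω a) _ fun a _ =>
        (h.spec.memLp _ a).const_mul _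
  have horthAux : ∀ (Y : Ω → ℝ) (i : ℕ), StronglyMeasurable[history u e (t - i)] Y →
      MemLp Y 2 μ → ∫ ω, Y ω * d i ω ∂μ = 0 := by
    intro Y i hY hYm
    have hi : ∀ b, Integrable (fun ω => Y ω * e (t - i) ω b) μ := fun b =>
      hYm.integrable_mul ((h.innov.memLp _ b).mono_exponent (by norm_num : (2 : ENNReal) ≤ 4))
    have h1 : (fun ω => Y ω * d i ω) = fun ω => ∑ b, et i b * (Y ω * e (t - i) ω b) := by
      ext ω
      simp only [hd, dotProduct, Finset.mul_sum]
      exact Finset.sum_congr rfl fun b _ => by ring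
    rw [h1, integral_finsetSum _ fun b _ => (hi b).const_mul _]
    refine Finset.sum_eq_zero fun b _ => ?_
    rw [integral_const_mul, h.integral_mul_noise hY b (hi b), mul_zero]
  have hXsm : ∀ s, StronglyMeasurable[history u e s] X := fun s =>
    Finset.stronglyMeasurable_fun_sum (f := fun i ω => ga i ⬝ᵥ u (t - i) ω) _ fun i _ =>
      Finset.stronglyMeasurable_fun_sum (f := fun a ω => ga i a * u (t - i) ω a) _ fun a _ =>
        stronglyMeasurable_const.mul (stronglyMeasurable_input _ _ a)
  have hdsm : ∀ i j : ℕ, i < j → StronglyMeasurable[history u e (t - i)] (d j) := fun i j hij =>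
    Finset.stronglyMeasurable_fun_sum (f := fun b ω => et j b * e (t - j) ω b) _ fun b _ =>
      stronglyMeasurable_const.mul (stronglyMeasurable_noise (by omega) b)
  have hdd : ∀ i j : ℕ, i ≠ j → ∫ ω, d i ω * d j ω ∂μ = 0 := by
    intro i j hij
    rcases hij.lt_or_gt with hlt | hlt
    · rw [← horthAux (d j) i (hdsm i j hlt) (hdmem j)]
      exact integral_congr_ae (ae_of_all _ fun ω => mul_comm _ _)
    · exact horthAux (d i) j (hdsm j i hlt) (hdmem i)
  have hdsq : ∀ i, v * l2 (et i) ^ 2 ≤ ∫ ω, d i ω ^ 2 ∂μ := by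
    intro i
    have hi : ∀ a b, Integrable (fun ω => e (t - i) ω a * e (t - i) ω b) μ := fun a b =>
      (memLp_two_mul (h.innov.memLp _ a) (h.innov.memLp _ b)).integrable (by norm_num)
    have hval : ∀ a b, ∫ ω, e (t - i) ω a * e (t - i) ω b ∂μ = V a b := by
      intro a b
      have h1 := h.integral_mul_noise_mul_noise (t := t - i) (X := fun _ => 1)
        stronglyMeasurable_const a b (by simpa using hi a b)
      simpa using h1
    have h1 : (fun ω => d i ω ^ 2)
        = fun ω => ∑ a, ∑ b, et i a * et i b * (e (t - i) ω a * e (t - i) ω b) := by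
      ext ω
      simp only [hd, dotProduct, sq, Finset.sum_mul_sum]
      exact Finset.sum_congr rfl fun a _ => Finset.sum_congr rfl fun b _ => by ring
    have h2 : ∫ ω, d i ω ^ 2 ∂μ = et i ⬝ᵥ V *ᵥ et i := by
      rw [h1, integral_finsetSum _ fun a _ => integrable_finsetSum _ fun b _ =>
        (hi a b).const_mul _]
      simp only [dotProduct, Matrix.mulVec, Finset.mul_sum]
      refine Finset.sum_congr rfl fun a _ => ?_
      rw [integral_finsetSum _ fun b _ => (hi a b).const_mul _]
      refine Finset.sum_congr rfl fun b _ => ?_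
      rw [integral_const_mul, hval]
      ring
    rw [h2]
    exact hVle _
  have hW : MemLp (fun ω => ∑ i ∈ Finset.range L, d i ω) 2 μ :=
    memLp_finsetSum _ fun i _ => hdmem i
  have hcross : ∫ ω, X ω * ∑ i ∈ Finset.range L, d i ω ∂μ = 0 := by
    have hXd : ∀ i, Integrable (fun ω => X ω * d i ω) μ := fun i => hXmem.integrable_mul (hdmem i)
    simp_rw [Finset.mul_sum]
    rw [integral_finsetSum _ fun i _ => hXd i]
    exact Finset.sum_eq_zero fun i _ => horthAux X i (hXsm _) hXmem
  have hsplit : (fun ω => (∑ i ∈ Finset.range L, w i ⬝ᵥ joint u e (t - i) ω) ^ 2)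
      = fun ω => X ω ^ 2 + 2 * (X ω * ∑ i ∈ Finset.range L, d i ω)
        + (∑ i ∈ Finset.range L, d i ω) ^ 2 := by
    ext ω
    have : ∑ i ∈ Finset.range L, w i ⬝ᵥ joint u e (t - i) ω
        = X ω + ∑ i ∈ Finset.range L, d i ω := by
      simp only [hX, hd, ← Finset.sum_add_distrib, joint, InnovModel.dotProduct_sumElim]
      rfl
    rw [this]; ring
  have hXW : Integrable (fun ω => X ω * ∑ i ∈ Finset.range L, d i ω) μ := hXmem.integrable_mul hW
  have hX2 : Integrable (fun ω => X ω ^ 2 + 2 * (X ω * ∑ i ∈ Finset.range L, d i ω)) μ :=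
    hXmem.integrable_sq.add (hXW.const_mul 2)
  rw [hsplit, integral_add hX2 hW.integrable_sq,
    integral_add hXmem.integrable_sq (hXW.const_mul 2), integral_const_mul, hcross,
    integral_sum_sq_of_orthogonal _ (fun i _ => hdmem i) fun i _ j _ hij => hdd i j hij]
  have hXle : c * ∑ i ∈ Finset.range L, l2 (ga i) ^ 2 ≤ ∫ ω, X ω ^ 2 ∂μ :=
    (hvar ga t L).trans (variance_le_expectation_sq hXmem.1)
  have hWle : v * ∑ i ∈ Finset.range L, l2 (et i) ^ 2
      ≤ ∑ i ∈ Finset.range L, ∫ ω, d i ω ^ 2 ∂μ := by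
    rw [Finset.mul_sum]
    exact Finset.sum_le_sum fun i _ => hdsq i
  have hl2 : ∑ i ∈ Finset.range L, l2 (w i) ^ 2
      = ∑ i ∈ Finset.range L, l2 (ga i) ^ 2 + ∑ i ∈ Finset.range L, l2 (et i) ^ 2 := by
    rw [← Finset.sum_add_distrib]
    refine Finset.sum_congr rfl fun i _ => ?_
    simp [l2_sq, Fintype.sum_sum_type, hga, het]
  have hG : 0 ≤ ∑ i ∈ Finset.range L, l2 (ga i) ^ 2 := Finset.sum_nonneg fun i _ => sq_nonneg _
  have hE : 0 ≤ ∑ i ∈ Finset.range L, l2 (et i) ^ 2 := Finset.sum_nonneg fun i _ => sq_nonneg _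
  rw [hl2, mul_add]
  have h1 := mul_le_mul_of_nonneg_right (min_le_left c v) hG
  have h2 := mul_le_mul_of_nonneg_right (min_le_right c v) hE
  linarith

/-- The second-moment matrix of a window of recorded inputs and outputs is bounded below, uniformly
in the length of the window. -/
lemma IsOpenLoop.exists_le_integral_sum_io_sq (h : IsOpenLoop μ u e Φ V δ)
    (hsys : IsSteadyState S μ x u y e) (hA : SchurStable S.A)
    (hAKC : SchurStable (S.A - S.K * S.C)) (hΦ : BoundedAwayFromZero Φ) (hV : V.PosDef) :
    ∃ c : ℝ, 0 < c ∧ ∀ (g : ℕ → Fin m ⊕ Fin p → ℝ) (t : ℤ) (L₀ : ℕ), (∀ i, L₀ ≤ i → g i = 0) →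
      c * ∑ i ∈ Finset.range L₀, l2 (g i) ^ 2 ≤
        ∫ ω, (∑ i ∈ Finset.range L₀, g i ⬝ᵥ joint u y (t - i) ω) ^ 2 ∂μ := by
  obtain ⟨c, hc, hlow⟩ := h.exists_le_integral_sum_joint_sq hΦ hV
  obtain ⟨C, hC, hup⟩ := S.exists_sum_weight_sq_le hAKC
  refine ⟨c / C, div_pos hc hC, fun g t L₀ hg => ?_⟩
  obtain ⟨hmem, hms, -⟩ := h.tendsto_noiseExpansion hsys hA hg t
  have htr : ∀ L, MemLp (noiseExpansion S u e g t (L₀ + L)) 2 μ := fun L =>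
    (h.memLp_noiseExpansion g t _).mono_exponent (by norm_num)
  have hlim := tendsto_integral_mul_of_tendsto hmem hmem htr htr hms hms
  simp only [← sq] at hlim
  refine ge_of_tendsto' hlim fun L => ?_
  have h1 := hlow (S.noiseWeight g) t (L₀ + L)
  have h2 := hup g (L₀ + L)
  have h3 : ∑ i ∈ Finset.range L₀, l2 (g i) ^ 2 ≤ ∑ i ∈ Finset.range (L₀ + L), l2 (g i) ^ 2 :=
    Finset.sum_le_sum_of_subset_of_nonneg
      (Finset.range_mono (Nat.le_add_right _ _)) fun i _ _ => sq_nonneg _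
  calc c / C * ∑ i ∈ Finset.range L₀, l2 (g i) ^ 2
      ≤ c / C * (C * ∑ i ∈ Finset.range (L₀ + L), l2 (S.noiseWeight g i) ^ 2) :=
        mul_le_mul_of_nonneg_left (h3.trans h2) (by positivity)
    _ = c * ∑ i ∈ Finset.range (L₀ + L), l2 (S.noiseWeight g i) ^ 2 := by field_simp
    _ ≤ _ := h1

/-! ### Fluctuations of the sample moments of the recorded data -/

/-- The weights that pick the component `c` at the end of the window. -/
def unitWeight (c : Fin m ⊕ Fin p) (i : ℕ) : Fin m ⊕ Fin p → ℝ :=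
  if i = 0 then Pi.single c 1 else 0

/-- `tendsto_noiseExpansion` for a single recorded signal. -/
lemma IsOpenLoop.tendsto_noiseExpansion_unitWeight (h : IsOpenLoop μ u e Φ V δ)
    (hsys : IsSteadyState S μ x u y e) (hA : SchurStable S.A) (c : Fin m ⊕ Fin p) (t : ℤ) :
    MemLp (fun ω => joint u y t ω c) 2 μ ∧
    Tendsto (fun L => ∫ ω, (joint u y t ω c -
      noiseExpansion S u e (unitWeight c) t (1 + L) ω) ^ 2 ∂μ) atTop (𝓝 0) ∧
    ∀ᵐ ω ∂μ, Tendsto (fun L => noiseExpansion S u e (unitWeight c) t (1 + L) ω) atTop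
      (𝓝 (joint u y t ω c)) := by
  have h1 := h.tendsto_noiseExpansion hsys hA (g := unitWeight c) (L₀ := 1)
    (fun i hi => if_neg (by omega)) t
  simpa [unitWeight] using h1

/-- The sample second moments of the recorded data have variance `O(δ_N + 1 / N)`, uniformly in the
lag. -/
lemma IsOpenLoop.exists_variance_io_le (h : IsOpenLoop μ u e Φ V δ)
    (hsys : IsSteadyState S μ x u y e) (hA : SchurStable S.A) :
    ∃ K : ℝ, 0 ≤ K ∧ ∀ (s t : ℤ) (N : ℕ) (c d : Fin m ⊕ Fin p), 1 ≤ N →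
      let X : Ω → ℝ := fun ω =>
        (∑ j ∈ Finset.range N, joint u y (s + j) ω c * joint u y (t + j) ω d) / N
      MemLp (fun ω => X ω - ∫ ω', X ω' ∂μ) 2 μ ∧
        ∫ ω, (X ω - ∫ ω', X ω' ∂μ) ^ 2 ∂μ ≤ K * (|δ N| + 1 / N) := by
  obtain ⟨K, hK0, hK⟩ := h.exists_variance_joint_le
  have hsupp : ∀ c : Fin m ⊕ Fin p, ∀ i, 1 ≤ i → unitWeight c i = 0 :=
    fun c i hi => if_neg (by omega)
  set B : ℝ := ∑ c : Fin m ⊕ Fin p, ∑' i, ∑ a, |S.noiseWeight (unitWeight c) i a| with hB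
  have hBc0 : ∀ c : Fin m ⊕ Fin p, 0 ≤ ∑' i, ∑ a, |S.noiseWeight (unitWeight c) i a| := fun c =>
    tsum_nonneg fun i => Finset.sum_nonneg fun a _ => abs_nonneg _
  have hBc : ∀ (c : Fin m ⊕ Fin p) (L : ℕ),
      ∑ i ∈ Finset.range L, ∑ a, |S.noiseWeight (unitWeight c) i a| ≤ B := fun c L =>
    ((S.summable_noiseWeight hA (hsupp c)).sum_le_tsum _
      fun i _ => Finset.sum_nonneg fun a _ => abs_nonneg _).trans
      (Finset.single_le_sum (fun c _ => hBc0 c) (Finset.mem_univ c))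
  refine ⟨(B * B) ^ 2 * K, by positivity, fun s t N c d hN => ?_⟩
  intro X
  set f : ℕ → ℕ → Ω → ℝ := fun L j => noiseExpansion S u e (unitWeight c) (s + j) (1 + L)
  set f' : ℕ → ℕ → Ω → ℝ := fun L j => noiseExpansion S u e (unitWeight d) (t + j) (1 + L)
  set Z : ℕ → Ω → ℝ := fun L ω => (∑ j ∈ Finset.range N, f L j ω * f' L j ω) / N with hZ
  have hf4 : ∀ L j, MemLp (f L j) 4 μ := fun L j => h.memLp_noiseExpansion _ _ _
  have hf4' : ∀ L j, MemLp (f' L j) 4 μ := fun L j => h.memLp_noiseExpansion _ _ _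
  have hle : (2 : ENNReal) ≤ 4 := by norm_num
  have hff : ∀ L j, MemLp (fun ω => f L j ω * f' L j ω) 2 μ :=
    fun L j => memLp_two_mul (hf4 L j) (hf4' L j)
  have hZmem : ∀ L, MemLp (Z L) 2 μ := by
    intro L
    simp only [hZ, div_eq_inv_mul]
    exact (memLp_finsetSum _ fun j _ => hff L j).const_mul _
  have happc := fun j : ℕ => h.tendsto_noiseExpansion_unitWeight hsys hA c (s + j)
  have happd := fun j : ℕ => h.tendsto_noiseExpansion_unitWeight hsys hA d (t + j)
  -- the means converge because the signals converge in mean square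
  have hEZ : Tendsto (fun L => ∫ ω, Z L ω ∂μ) atTop (𝓝 (∫ ω, X ω ∂μ)) := by
    have h1 : ∀ L, ∫ ω, Z L ω ∂μ = (∑ j ∈ Finset.range N, ∫ ω, f L j ω * f' L j ω ∂μ) / N := by
      intro L
      rw [← integral_finsetSum _ fun j _ => (hff L j).integrable (by norm_num), ← integral_div]
    have h2 : ∫ ω, X ω ∂μ = (∑ j ∈ Finset.range N,
        ∫ ω, joint u y (s + j) ω c * joint u y (t + j) ω d ∂μ) / N := by
      have hi : ∀ j : ℕ, Integrable
          (fun ω => joint u y (s + j) ω c * joint u y (t + j) ω d) μ :=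
        fun j => (happc j).1.integrable_mul (happd j).1
      rw [← integral_finsetSum _ fun j _ => hi j, ← integral_div]
    simp_rw [h1, h2]
    refine Tendsto.div_const (tendsto_finsetSum _ fun j _ => ?_) _
    exact tendsto_integral_mul_of_tendsto (happc j).1 (happd j).1
      (fun L => (hf4 L j).mono_exponent hle) (fun L => (hf4' L j).mono_exponent hle)
      (happc j).2.1 (happd j).2.1
  refine memLp_two_and_integral_sq_le_of_tendsto (Z := fun L ω => Z L ω - ∫ ω', Z L ω' ∂μ)
    (k := fun _ => (B * B) ^ 2 * K * (|δ N| + 1 / N))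
    (fun L => (hZmem L).sub (memLp_const _)) ?_ (fun L => ?_) tendsto_const_nhds
  · filter_upwards [ae_all_iff.mpr fun j => (happc j).2.2, ae_all_iff.mpr fun j => (happd j).2.2]
      with ω h1 h2
    exact ((tendsto_finsetSum _ fun j _ => (h1 j).mul (h2 j)).div_const _).sub hEZ
  · -- the truncated moments are combinations of the moments of the inputs and the noise
    set I := (Finset.range (1 + L) ×ˢ (Finset.univ : Finset (Fin m ⊕ Fin p))) ×ˢ
      (Finset.range (1 + L) ×ˢ (Finset.univ : Finset (Fin m ⊕ Fin p))) with hI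
    set a : (ℕ × (Fin m ⊕ Fin p)) × (ℕ × (Fin m ⊕ Fin p)) → ℝ := fun q =>
      S.noiseWeight (unitWeight c) q.1.1 q.1.2 * S.noiseWeight (unitWeight d) q.2.1 q.2.2 with ha
    set Q : (ℕ × (Fin m ⊕ Fin p)) × (ℕ × (Fin m ⊕ Fin p)) → Ω → ℝ := fun q ω =>
      (∑ j ∈ Finset.range N, joint u e (s - q.1.1 + j) ω q.1.2 *
        joint u e (t - q.2.1 + j) ω q.2.2) / N with hQ
    have hQmem : ∀ q, MemLp (Q q) 2 μ := by
      intro q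
      simp only [hQ, div_eq_inv_mul]
      exact (memLp_finsetSum _ fun j _ =>
        memLp_two_mul (h.memLp_joint _ _) (h.memLp_joint _ _)).const_mul _
    have hZQ : ∀ ω, Z L ω = ∑ q ∈ I, a q * Q q ω := by
      intro ω
      have hexp : ∀ j : ℕ, f L j ω * f' L j ω = ∑ q ∈ I, a q *
          (joint u e (s - q.1.1 + j) ω q.1.2 * joint u e (t - q.2.1 + j) ω q.2.2) := by
        intro j
        have e1 : ∀ (r : ℤ) (i : ℕ), r + j - i = r - i + j := fun r i => by ring
        simp only [f, f', noiseExpansion, dotProduct, e1]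
        rw [← Finset.sum_product', ← Finset.sum_product', Finset.sum_mul_sum, hI,
          Finset.sum_product (Finset.range (1 + L) ×ˢ Finset.univ)]
        refine Finset.sum_congr rfl fun q _ => Finset.sum_congr rfl fun q' _ => ?_
        simp only [ha]
        ring
      simp only [hZ, hexp, hQ]
      rw [Finset.sum_comm, Finset.sum_div]
      refine Finset.sum_congr rfl fun q _ => ?_
      rw [← Finset.mul_sum, mul_div_assoc]
    have hEZQ : ∫ ω, Z L ω ∂μ = ∑ q ∈ I, a q * ∫ ω, Q q ω ∂μ := by
      simp_rw [hZQ]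
      rw [integral_finsetSum _ fun q _ => ((hQmem q).integrable (by norm_num)).const_mul _]
      exact Finset.sum_congr rfl fun q _ => integral_const_mul _ _
    have hcent : ∀ ω, Z L ω - ∫ ω', Z L ω' ∂μ = ∑ q ∈ I, a q * (Q q ω - ∫ ω', Q q ω' ∂μ) := by
      intro ω
      rw [hEZQ, hZQ, ← Finset.sum_sub_distrib]
      exact Finset.sum_congr rfl fun q _ => by ring
    simp only [hcent]
    have hbound := integral_sum_mul_sq_le I a (X := fun q ω => Q q ω - ∫ ω', Q q ω' ∂μ)
      (K := K * (|δ N| + 1 / N)) (fun q _ => (hQmem q).sub (memLp_const _)) fun q _ => by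
        have h1 := hK (s - q.1.1) (t - q.2.1) N q.1.2 q.2.2 hN
        rwa [variance_eq_integral (hQmem q).1.aemeasurable] at h1
    refine hbound.trans ?_
    have hsumabs : ∑ q ∈ I, |a q| ≤ B * B := by
      have e1 : ∑ q ∈ I, |a q|
          = (∑ i ∈ Finset.range (1 + L), ∑ b, |S.noiseWeight (unitWeight c) i b|) *
            ∑ i ∈ Finset.range (1 + L), ∑ b, |S.noiseWeight (unitWeight d) i b| := by
        rw [← Finset.sum_product', ← Finset.sum_product', Finset.sum_mul_sum, hI,
          Finset.sum_product (Finset.range (1 + L) ×ˢ Finset.univ)]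
        simp only [ha, abs_mul]
      rw [e1]
      have hB0 : 0 ≤ B := Finset.sum_nonneg fun c _ => hBc0 c
      exact mul_le_mul (hBc c _) (hBc d _)
        (Finset.sum_nonneg fun i _ => Finset.sum_nonneg fun b _ => abs_nonneg _) hB0
    rw [mul_assoc]
    refine mul_le_mul_of_nonneg_right (pow_le_pow_left₀
      (Finset.sum_nonneg fun q _ => abs_nonneg _) hsumabs 2) (by positivity)

/-- Sums of future noise weighted by past data and arbitrary inputs behave like white noise. -/
lemma IsOpenLoop.memLp_and_integral_noise_sq_le (h : IsOpenLoop μ u e Φ V δ)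
    (hsys : IsSteadyState S μ x u y e) (hA : SchurStable S.A) {κ : Type*} [Fintype κ] (v : κ → ℝ)
    (s : κ → ℤ) (c : κ → Fin m ⊕ Fin p) (t : ℤ) (hst : ∀ q b, c q = Sum.inr b → s q < t)
    (b : Fin p) (N : ℕ) :
    MemLp (fun ω => ∑ j ∈ Finset.range N,
      (∑ q, v q * joint u y (s q + j) ω (c q)) * e (t + j) ω b) 2 μ ∧
    ∫ ω, (∑ j ∈ Finset.range N,
      (∑ q, v q * joint u y (s q + j) ω (c q)) * e (t + j) ω b) ^ 2 ∂μ ≤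
      V b b * ∑ j ∈ Finset.range N, ∫ ω, (∑ q, v q * joint u y (s q + j) ω (c q)) ^ 2 ∂μ := by
  set f : ℕ → ℕ → Ω → ℝ := fun L j ω =>
    ∑ q, v q * noiseExpansion S u e (unitWeight (c q)) (s q + j) (1 + L) ω with hf
  have hle : (2 : ENNReal) ≤ 4 := by norm_num
  have hf4 : ∀ L j, MemLp (f L j) 4 μ := fun L j =>
    memLp_finsetSum (f := fun q ω => v q *
      noiseExpansion S u e (unitWeight (c q)) (s q + j) (1 + L) ω) _
      fun q _ => (h.memLp_noiseExpansion _ _ _).const_mul _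
  have hsm : ∀ L (j : ℕ), StronglyMeasurable[history u e (t + j)] (f L j) := by
    intro L j
    refine Finset.stronglyMeasurable_fun_sum (f := fun q ω => v q *
      noiseExpansion S u e (unitWeight (c q)) (s q + j) (1 + L) ω) _ fun q _ => ?_
    refine stronglyMeasurable_const.mul (stronglyMeasurable_noiseExpansion (fun i b => ?_) _)
    rcases hc : c q with a | b'
    · left
      -- an input does not involve the noise at all
      have hin : ∀ i b, (unitWeight (Sum.inl a) i : Fin m ⊕ Fin p → ℝ) (Sum.inr b) = 0 := by
        intro i b
        unfold unitWeight
        split_ifs <;> simp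
      rw [S.noiseWeight_eq_self hin, hin]
    · right
      have := hst q b' hc
      omega
  have happ := fun (q : κ) (j : ℕ) => h.tendsto_noiseExpansion_unitWeight hsys hA (c q) (s q + j)
  have hlimmem : ∀ j : ℕ, MemLp (fun ω => ∑ q, v q * joint u y (s q + j) ω (c q)) 2 μ := fun j =>
    memLp_finsetSum (f := fun q ω => v q * joint u y (s q + j) ω (c q)) _
      fun q _ => (happ q j).1.const_mul _
  have hms : ∀ j : ℕ, Tendsto (fun L => ∫ ω, (∑ q, v q * joint u y (s q + j) ω (c q) -
      f L j ω) ^ 2 ∂μ) atTop (𝓝 0) := by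
    intro j
    -- a finite combination of mean-square null sequences
    have hb : Tendsto (fun L => (∑ q, |v q|) ^ 2 * ∑ q, ∫ ω, (joint u y (s q + j) ω (c q) -
        noiseExpansion S u e (unitWeight (c q)) (s q + j) (1 + L) ω) ^ 2 ∂μ) atTop (𝓝 0) := by
      have := (tendsto_finsetSum Finset.univ fun q _ => (happ q j).2.1).const_mul
        ((∑ q, |v q|) ^ 2)
      simpa using this
    refine squeeze_zero (fun L => integral_nonneg fun ω => sq_nonneg _) (fun L => ?_) hb
    have h1 := integral_sum_mul_sq_le Finset.univ v (X := fun q ω => joint u y (s q + j) ω (c q) -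
        noiseExpansion S u e (unitWeight (c q)) (s q + j) (1 + L) ω)
      (fun q _ => (happ q j).1.sub ((h.memLp_noiseExpansion _ _ _).mono_exponent hle)) (fun q _ =>
        Finset.single_le_sum (f := fun q => ∫ ω, (joint u y (s q + j) ω (c q) -
          noiseExpansion S u e (unitWeight (c q)) (s q + j) (1 + L) ω) ^ 2 ∂μ)
          (fun q _ => integral_nonneg fun ω => sq_nonneg _) (Finset.mem_univ q))
    refine le_trans (le_of_eq ?_) h1
    refine integral_congr_ae (ae_of_all _ fun ω => ?_)
    simp only [hf, mul_sub, Finset.sum_sub_distrib]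
  have hk : Tendsto (fun L => V b b * ∑ j ∈ Finset.range N, ∫ ω, f L j ω ^ 2 ∂μ) atTop
      (𝓝 (V b b * ∑ j ∈ Finset.range N,
        ∫ ω, (∑ q, v q * joint u y (s q + j) ω (c q)) ^ 2 ∂μ)) := by
    refine (tendsto_finsetSum _ fun j _ => ?_).const_mul _
    have h2 : ∀ L, MemLp (f L j) 2 μ := fun L => (hf4 L j).mono_exponent hle
    have := tendsto_integral_mul_of_tendsto (hlimmem j) (hlimmem j) h2 h2 (hms j) (hms j)
    simpa only [← sq] using this
  refine memLp_two_and_integral_sq_le_of_tendsto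
    (Z := fun L ω => ∑ j ∈ Finset.range N, f L j ω * e (t + j) ω b)
    (fun L => memLp_finsetSum _ fun j _ => memLp_two_mul (hf4 L j) (h.innov.memLp _ b)) ?_
    (fun L => (h.integral_sum_mul_noise_sq t b N (hsm L) (hf4 L)).le) hk
  filter_upwards [ae_all_iff.mpr fun q => ae_all_iff.mpr fun j => (happ q j).2.2] with ω hω
  exact tendsto_finsetSum _ fun j _ =>
    (tendsto_finsetSum _ fun q _ => (hω q j).const_mul _).mul_const _

end SteadyState

/-! ### Moments of the recorded data matrices -/

section RegressorEntries

variable {Ω : Type*} {m p : ℕ} {u : ℤ → Ω → Fin m → ℝ} {y e : ℤ → Ω → Fin p → ℝ}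

/-- The starting time of the signal in a row of the regressor. -/
def rowTime {m p ρ T : ℕ} : (Fin ρ × (Fin m ⊕ Fin p)) ⊕ (Fin T × Fin m) → ℤ :=
  Sum.elim (fun q => (q.1 : ℕ)) fun q => ρ + (q.1 : ℕ)

/-- The signal in a row of the regressor. -/
def rowSignal {m p ρ T : ℕ} : (Fin ρ × (Fin m ⊕ Fin p)) ⊕ (Fin T × Fin m) → Fin m ⊕ Fin p :=
  Sum.elim (fun q => q.2) fun q => Sum.inl q.2

/-- The entry of column `j` of the unscaled regressor in row `q`. -/
def regressorSample {ρ T : ℕ} (u : ℤ → Ω → Fin m → ℝ) (y : ℤ → Ω → Fin p → ℝ) (j : ℕ) (ω : Ω)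
    (q : (Fin ρ × (Fin m ⊕ Fin p)) ⊕ (Fin T × Fin m)) : ℝ :=
  joint u y (rowTime q + j) ω (rowSignal q)

/-- The regressor `[Z_P; U_F]` of the outcome `ω`. -/
def dataMatrix (u : ℤ → Ω → Fin m → ℝ) (y : ℤ → Ω → Fin p → ℝ) (ρ T N : ℕ) (ω : Ω) :
    Matrix ((Fin ρ × (Fin m ⊕ Fin p)) ⊕ (Fin T × Fin m)) (Fin N) ℝ :=
  regressor (fun s => u s ω) (fun s => y s ω) ρ T N

lemma dataMatrix_apply (ρ T N : ℕ) (ω : Ω) (q) (j : Fin N) :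
    dataMatrix u y ρ T N ω q j = regressorSample u y j ω q / √(N : ℝ) := by
  rcases q with q | q
  · simp [dataMatrix, regressor, hankel, regressorSample, rowTime, rowSignal, joint]
  · simp [dataMatrix, regressor, hankel, regressorSample, rowTime, rowSignal, joint]

lemma dataMatrix_mul_transpose_apply (ρ T N : ℕ) (ω : Ω) (q q') :
    (dataMatrix u y ρ T N ω * (dataMatrix u y ρ T N ω)ᵀ) q q' =
      (∑ j ∈ Finset.range N, regressorSample u y j ω q * regressorSample u y j ω q') / N := by
  rw [Matrix.mul_apply, Finset.sum_range, Finset.sum_div]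
  refine Finset.sum_congr rfl fun j _ => ?_
  rw [Matrix.transpose_apply, dataMatrix_apply, dataMatrix_apply, div_mul_div_comm,
    Real.mul_self_sqrt (Nat.cast_nonneg N)]

lemma hankel_mulVec_dataMatrix_transpose (ρ T N : ℕ) (ω : Ω) (v) (r : Fin T × Fin p) :
    (hankel (fun s => e s ω) ρ T N *ᵥ ((dataMatrix u y ρ T N ω)ᵀ *ᵥ v)) r =
      (∑ j ∈ Finset.range N, (∑ q, v q * regressorSample u y j ω q) *
        e (ρ + (r.1 : ℕ) + j) ω r.2) / N := by
  rw [Finset.sum_range, Finset.sum_div]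
  simp only [hankel, Matrix.of_apply, Matrix.mulVec, dotProduct, Matrix.transpose_apply,
    dataMatrix_apply]
  refine Finset.sum_congr rfl fun j _ => ?_
  have h1 : ∑ q, regressorSample u y j ω q / √(N : ℝ) * v q
      = (∑ q, v q * regressorSample u y j ω q) / √(N : ℝ) := by
    rw [Finset.sum_div]
    exact Finset.sum_congr rfl fun q _ => by ring
  rw [h1, div_mul_div_comm, Real.mul_self_sqrt (Nat.cast_nonneg N), mul_comm]

lemma hankel_mul_dataMatrix_transpose_apply (ρ T N : ℕ) (ω : Ω) (r : Fin T × Fin p) (q) :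
    (hankel (fun s => e s ω) ρ T N * (dataMatrix u y ρ T N ω)ᵀ) r q =
      (∑ j ∈ Finset.range N, regressorSample u y j ω q * e (ρ + (r.1 : ℕ) + j) ω r.2) / N := by
  classical
  have h := hankel_mulVec_dataMatrix_transpose (u := u) (y := y) (e := e) ρ T N ω
    (Pi.single q 1) r
  rw [Matrix.mulVec_mulVec, Matrix.mulVec_single_one] at h
  simpa [Pi.single_apply] using h

/-- The past rows of the regressor precede the future noise; its future rows are inputs. -/
lemma rowTime_lt {ρ T : ℕ} (i : Fin T) (q : (Fin ρ × (Fin m ⊕ Fin p)) ⊕ (Fin T × Fin m)) (b : Fin p)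
    (hq : rowSignal q = Sum.inr b) : rowTime q < (ρ : ℤ) + (i : ℕ) := by
  rcases q with q | q
  · have := q.1.2
    simp only [rowTime, Sum.elim_inl]
    omega
  · simp [rowSignal] at hq

end RegressorEntries

section DataMatrices

variable {Ω : Type*} [MeasurableSpace Ω] {μ : Measure Ω}
  {n m p : ℕ} {S : InnovModel n m p} {x : ℤ → Ω → Fin n → ℝ}
  {u : ℤ → Ω → Fin m → ℝ} {y e : ℤ → Ω → Fin p → ℝ}
  {Φ : ℝ → Matrix (Fin m) (Fin m) ℂ} {V : Matrix (Fin p) (Fin p) ℝ} {δ : ℕ → ℝ}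

/-- The second-moment matrix of the columns of the regressor, averaged over the columns. -/
def dataCov (μ : Measure Ω) (u : ℤ → Ω → Fin m → ℝ) (y : ℤ → Ω → Fin p → ℝ) (ρ T N : ℕ) :
    Matrix ((Fin ρ × (Fin m ⊕ Fin p)) ⊕ (Fin T × Fin m))
      ((Fin ρ × (Fin m ⊕ Fin p)) ⊕ (Fin T × Fin m)) ℝ :=
  Matrix.of fun q q' => ∫ ω, (dataMatrix u y ρ T N ω * (dataMatrix u y ρ T N ω)ᵀ) q q' ∂μ

lemma IsSteadyState.exists_integral_initialStates_le (hsys : IsSteadyState S μ x u y e) :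
    ∃ K : ℝ, 0 ≤ K ∧ ∀ N : ℕ,
      let Q : Ω → ℝ := fun ω => ∑ i, ∑ j, InnovModel.initialStates (fun t => x t ω) N i j ^ 2
      Integrable Q μ ∧ ∫ ω, Q ω ∂μ ≤ K := by
  obtain ⟨κ, hκ⟩ := hsys.bounded
  refine ⟨n * |κ|, by positivity, fun N => ?_⟩
  intro Q
  have hent : ∀ (i : Fin n) (j : Fin N),
      Integrable (fun ω => InnovModel.initialStates (fun t => x t ω) N i j ^ 2) μ ∧
      ∫ ω, InnovModel.initialStates (fun t => x t ω) N i j ^ 2 ∂μ ≤ |κ| / N := by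
    intro i j
    simp only [InnovModel.initialStates, Matrix.of_apply, div_pow, Real.sq_sqrt (Nat.cast_nonneg N)]
    refine ⟨(hsys.memLp _ i).integrable_sq.div_const _, ?_⟩
    rw [integral_div]
    exact div_le_div_of_nonneg_right ((hκ _ i).trans (le_abs_self _)) (Nat.cast_nonneg N)
  refine ⟨integrable_finsetSum _ fun i _ => integrable_finsetSum _ fun j _ => (hent i j).1, ?_⟩
  simp only [Q]
  rw [integral_finsetSum _ fun i _ => integrable_finsetSum _ fun j _ => (hent i j).1]
  have h1 : ∀ i : Fin n, ∫ ω, ∑ j, InnovModel.initialStates (fun t => x t ω) N i j ^ 2 ∂μ ≤ |κ| := by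
    intro i
    rw [integral_finsetSum _ fun j _ => (hent i j).1]
    have h2 := Finset.sum_le_card_nsmul Finset.univ _ _ fun j _ => (hent i j).2
    simp only [Finset.card_univ, Fintype.card_fin, nsmul_eq_mul] at h2
    refine h2.trans ?_
    rcases Nat.eq_zero_or_pos N with rfl | hN
    · simp
    · have : (0 : ℝ) < N := by exact_mod_cast hN
      exact le_of_eq (by field_simp)
  have h3 := Finset.sum_le_card_nsmul Finset.univ _ _ fun i _ => h1 i
  simpa only [Finset.card_univ, Fintype.card_fin, nsmul_eq_mul] using h3

variable [IsProbabilityMeasure μ]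

lemma IsOpenLoop.meanOutput_eq (h : IsOpenLoop μ u e Φ V δ) (t : ℤ) (T : ℕ) (x₀ : Fin n → ℝ)
    (uf : Fin T × Fin m → ℝ) : S.meanOutput μ e t T x₀ uf = S.futureLin T (x₀, uf, 0) := by
  have hi : ∀ t b, Integrable (fun ω => e t ω b) μ := fun t b =>
    (h.innov.memLp t b).integrable (by norm_num)
  have h0 : ∀ t b, ∫ ω, e t ω b ∂μ = 0 := by
    intro t b
    have := h.integral_mul_noise (t := t) (X := fun _ => 1) stronglyMeasurable_const b
      (by simpa using hi t b)
    simpa using this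
  have hmv : ∀ {k l : ℕ} (M : Matrix (Fin k) (Fin l) ℝ) {f : Ω → Fin l → ℝ} {v : Fin l → ℝ},
      (∀ b, Integrable (fun ω => f ω b) μ ∧ ∫ ω, f ω b ∂μ = v b) →
      ∀ a, Integrable (fun ω => (M *ᵥ f ω) a) μ ∧ ∫ ω, (M *ᵥ f ω) a ∂μ = (M *ᵥ v) a := by
    intro k l M f v hf a
    simp only [Matrix.mulVec, dotProduct]
    refine ⟨integrable_finsetSum _ fun b _ => (hf b).1.const_mul _, ?_⟩
    rw [integral_finsetSum _ fun b _ => (hf b).1.const_mul _]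
    exact Finset.sum_congr rfl fun b _ => by rw [integral_const_mul, (hf b).2]
  set w : ℕ → Fin m → ℝ := fun k a => if h : k < T then uf (⟨k, h⟩, a) else 0
  have hstate : ∀ k a, Integrable (fun ω => S.futureState x₀ w (fun k => e (t + k) ω) k a) μ ∧
      ∫ ω, S.futureState x₀ w (fun k => e (t + k) ω) k a ∂μ = S.futureState x₀ w 0 k a := by
    intro k
    induction k with
    | zero => intro a; simp [InnovModel.futureState]
    | succ k ih =>
      intro a
      have hA := hmv S.A ih a
      have hK := hmv S.K (f := fun ω => e (t + k) ω) (v := 0) (fun b => ⟨hi _ b, h0 _ b⟩) a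
      have hB : Integrable (fun _ : Ω => (S.B *ᵥ w k) a) μ := integrable_const _
      simp only [InnovModel.futureState, InnovModel.next, Pi.add_apply]
      refine ⟨(hA.1.add hB).add hK.1, ?_⟩
      rw [integral_add (f := fun ω => (S.A *ᵥ S.futureState x₀ w (fun k => e (t + k) ω) k) a
        + (S.B *ᵥ w k) a) (hA.1.add hB) hK.1, integral_add hA.1 hB, hA.2, hK.2]
      simp
  ext q
  have hC := hmv S.C (hstate q.1) q.2
  have hD : Integrable (fun _ : Ω => (S.D *ᵥ w q.1) q.2) μ := integrable_const _
  have hz : InnovModel.extendZero (0 : Fin T × Fin p → ℝ) = 0 := by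
    ext i a; simp [InnovModel.extendZero]
  rw [InnovModel.futureLin_apply, hz]
  simp only [InnovModel.meanOutput, InnovModel.futureOutput, InnovModel.out, Pi.add_apply]
  change ∫ ω, ((S.C *ᵥ S.futureState x₀ w (fun k => e (t + k) ω) q.1) q.2 + (S.D *ᵥ w q.1) q.2)
    + e (t + (q.1 : ℕ)) ω q.2 ∂μ = _
  rw [integral_add (f := fun ω => (S.C *ᵥ S.futureState x₀ w (fun k => e (t + k) ω) q.1) q.2
    + (S.D *ᵥ w q.1) q.2) (hC.1.add hD) (hi _ _), integral_add hC.1 hD, hC.2, h0]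
  simp only [integral_const, probReal_univ, one_smul, Pi.zero_apply]
  rfl

lemma IsOpenLoop.memLp_io (h : IsOpenLoop μ u e Φ V δ) (hsys : IsSteadyState S μ x u y e)
    (hA : SchurStable S.A) (t : ℤ) (c : Fin m ⊕ Fin p) : MemLp (fun ω => joint u y t ω c) 2 μ :=
  (h.tendsto_noiseExpansion_unitWeight hsys hA c t).1

lemma IsOpenLoop.exists_integral_io_sq_le (h : IsOpenLoop μ u e Φ V δ)
    (hsys : IsSteadyState S μ x u y e) :
    ∃ κ : ℝ, 0 ≤ κ ∧ ∀ t c, ∫ ω, joint u y t ω c ^ 2 ∂μ ≤ κ := by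
  obtain ⟨κ, hκ0, hκ⟩ := h.exists_moment_le
  obtain ⟨κx, hκx⟩ := hsys.bounded
  set X : ℤ → Fin n ⊕ (Fin m ⊕ Fin p) → Ω → ℝ := fun t q ω =>
    Sum.elim (x t ω) (joint u e t ω) q with hX
  set a : Fin p → Fin n ⊕ (Fin m ⊕ Fin p) → ℝ := fun b =>
    Sum.elim (S.C b) (Sum.elim (S.D b) (Pi.single b 1)) with ha
  have hXm : ∀ t q, MemLp (X t q) 2 μ := by
    rintro t (i | c)
    · exact hsys.memLp t i
    · exact (h.memLp_joint t c).mono_exponent (by norm_num)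
  have hXκ : ∀ t q, ∫ ω, X t q ω ^ 2 ∂μ ≤ |κx| + κ := by
    rintro t (i | c)
    · have := hκx t i
      have := le_abs_self κx
      simp only [hX, Sum.elim_inl]
      linarith
    · have := (hκ t c).2
      have := abs_nonneg κx
      simp only [hX, Sum.elim_inr]
      linarith
  have hpos : 0 ≤ ∑ b, (∑ q, |a b q|) ^ 2 * (|κx| + κ) :=
    Finset.sum_nonneg fun b _ => by positivity
  refine ⟨κ + ∑ b, (∑ q, |a b q|) ^ 2 * (|κx| + κ), by positivity, ?_⟩
  rintro t (i | b)
  · exact (hκ t (Sum.inl i)).2.trans (le_add_of_nonneg_right hpos)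
  · have h1 := integral_sum_mul_sq_le Finset.univ (a b) (fun q _ => hXm t q) fun q _ => hXκ t q
    have h2 : ∫ ω, joint u y t ω (Sum.inr b) ^ 2 ∂μ = ∫ ω, (∑ q, a b q * X t q ω) ^ 2 ∂μ := by
      refine integral_congr_ae ?_
      filter_upwards [hsys.output t] with ω hω
      simp only [joint, Sum.elim_inr, hω, InnovModel.out, hX, ha, Fintype.sum_sum_type,
        Sum.elim_inl, Pi.add_apply, Matrix.mulVec, dotProduct]
      simp [Pi.single_apply, add_assoc]
    rw [h2]
    refine h1.trans ?_
    have h3 := Finset.single_le_sum (f := fun b => (∑ q, |a b q|) ^ 2 * (|κx| + κ))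
      (fun b _ => by positivity) (Finset.mem_univ b)
    linarith

/-- The quadratic form of the second-moment matrix is the mean energy of the weighted rows. -/
lemma IsOpenLoop.dotProduct_dataCov (h : IsOpenLoop μ u e Φ V δ)
    (hsys : IsSteadyState S μ x u y e) (hA : SchurStable S.A) (ρ T N : ℕ) (v) :
    v ⬝ᵥ dataCov μ u y ρ T N *ᵥ v =
      (∑ j ∈ Finset.range N, ∫ ω, (∑ q, v q * regressorSample u y j ω q) ^ 2 ∂μ) / N := by
  have hm : ∀ (j : ℕ) q, MemLp (fun ω => regressorSample (ρ := ρ) (T := T) u y j ω q) 2 μ :=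
    fun j q => h.memLp_io hsys hA _ _
  have hi : ∀ (j : ℕ) q q', Integrable (fun ω => regressorSample (ρ := ρ) (T := T) u y j ω q *
      regressorSample u y j ω q') μ := fun j q q' => (hm j q).integrable_mul (hm j q')
  have hcov : ∀ q q', dataCov μ u y ρ T N q q' = (∑ j ∈ Finset.range N,
      ∫ ω, regressorSample u y j ω q * regressorSample u y j ω q' ∂μ) / N := by
    intro q q'
    simp only [dataCov, Matrix.of_apply, dataMatrix_mul_transpose_apply]
    rw [integral_div, integral_finsetSum _ fun j _ => hi j q q']
  have hsq : ∀ j : ℕ, ∫ ω, (∑ q, v q * regressorSample u y j ω q) ^ 2 ∂μ =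
      ∑ q, ∑ q', v q * v q' *
        ∫ ω, regressorSample u y j ω q * regressorSample u y j ω q' ∂μ := by
    intro j
    have h1 : ∀ ω, (∑ q, v q * regressorSample u y j ω q) ^ 2 = ∑ q, ∑ q', v q * v q' *
        (regressorSample u y j ω q * regressorSample u y j ω q') := by
      intro ω
      rw [sq, Finset.sum_mul_sum]
      exact Finset.sum_congr rfl fun q _ => Finset.sum_congr rfl fun q' _ => by ring
    simp_rw [h1]
    rw [integral_finsetSum _ fun q _ => integrable_finsetSum _ fun q' _ => (hi j q q').const_mul _]
    refine Finset.sum_congr rfl fun q _ => ?_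
    rw [integral_finsetSum _ fun q' _ => (hi j q q').const_mul _]
    exact Finset.sum_congr rfl fun q' _ => integral_const_mul _ _
  simp_rw [hsq]
  rw [Finset.sum_comm, Finset.sum_div]
  simp only [dotProduct, Matrix.mulVec, hcov, Finset.mul_sum]
  refine Finset.sum_congr rfl fun q _ => ?_
  rw [Finset.sum_comm, Finset.sum_div]
  refine Finset.sum_congr rfl fun q' _ => ?_
  rw [← Finset.mul_sum]
  ring

/-- The second-moment matrix of the regressor is coercive, uniformly in its size. -/
lemma IsOpenLoop.exists_dataCov_coercive (h : IsOpenLoop μ u e Φ V δ)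
    (hsys : IsSteadyState S μ x u y e) (hA : SchurStable S.A)
    (hAKC : SchurStable (S.A - S.K * S.C)) (hΦ : BoundedAwayFromZero Φ) (hV : V.PosDef) :
    ∃ c : ℝ, 0 < c ∧ ∀ (ρ T N : ℕ), 1 ≤ N → ∀ v,
      c * l2 v ^ 2 ≤ v ⬝ᵥ dataCov μ u y ρ T N *ᵥ v := by
  obtain ⟨c, hc, hlow⟩ := h.exists_le_integral_sum_io_sq hsys hA hAKC hΦ hV
  refine ⟨c, hc, fun ρ T N hN v => ?_⟩
  -- the weights of the window, forward and backward in time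
  set fw : ℕ → Fin m ⊕ Fin p → ℝ := fun k =>
    if hk : k < ρ then fun c => v (Sum.inl (⟨k, hk⟩, c))
    else if hk : k - ρ < T then Sum.elim (fun a => v (Sum.inr (⟨k - ρ, hk⟩, a))) 0 else 0 with hfw
  set g : ℕ → Fin m ⊕ Fin p → ℝ := fun i => if i < ρ + T then fw (ρ + T - 1 - i) else 0 with hg
  have hfw1 : ∀ k : Fin ρ, fw k = fun c => v (Sum.inl (k, c)) := fun k => by
    simp [hfw]
  have hfw2 : ∀ k : Fin T, fw (ρ + k) = Sum.elim (fun a => v (Sum.inr (k, a))) 0 := fun k => by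
    simp [hfw]
  have hgfw : ∀ {f : (Fin m ⊕ Fin p → ℝ) → ℤ → ℝ} (j : ℕ),
      ∑ i ∈ Finset.range (ρ + T), f (g i) ((j : ℤ) + (ρ + T : ℕ) - 1 - i)
        = ∑ k ∈ Finset.range (ρ + T), f (fw k) (k + j) := by
    intro f j
    rw [← Finset.sum_range_reflect]
    refine Finset.sum_congr rfl fun i hi => ?_
    have hi' := Finset.mem_range.mp hi
    simp only [hg]
    rw [if_pos (by omega), show ρ + T - 1 - (ρ + T - 1 - i) = i by omega,
      show ((j : ℤ) + (ρ + T : ℕ) - 1 - (ρ + T - 1 - i : ℕ)) = i + j by omega]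
  have hnorm : ∑ i ∈ Finset.range (ρ + T), l2 (g i) ^ 2 = l2 v ^ 2 := by
    rw [hgfw (f := fun w _ => l2 w ^ 2) 0, Finset.sum_range_add, Finset.sum_range,
      Finset.sum_range]
    simp only [hfw1, hfw2, l2_sq, Fintype.sum_sum_type, Fintype.sum_prod_type]
    simp
  have hsig : ∀ (j : ℕ) ω, ∑ i ∈ Finset.range (ρ + T),
      g i ⬝ᵥ joint u y ((j : ℤ) + (ρ + T : ℕ) - 1 - i) ω = ∑ q, v q * regressorSample u y j ω q := by
    intro j ω
    rw [hgfw (f := fun w t => w ⬝ᵥ joint u y t ω) j, Finset.sum_range_add, Finset.sum_range,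
      Finset.sum_range]
    simp only [hfw1, hfw2, regressorSample, Fintype.sum_sum_type, Fintype.sum_prod_type,
      dotProduct, rowTime, rowSignal, Sum.elim_inl, Sum.elim_inr]
    simp
  rw [h.dotProduct_dataCov hsys hA]
  have hNpos : (0 : ℝ) < N := by exact_mod_cast hN
  rw [le_div_iff₀ hNpos]
  have hj : ∀ j ∈ Finset.range N, c * l2 v ^ 2 ≤
      ∫ ω, (∑ q, v q * regressorSample u y j ω q) ^ 2 ∂μ := by
    intro j _
    have h1 := hlow g ((j : ℤ) + (ρ + T : ℕ) - 1) (ρ + T) fun i hi => if_neg (by omega)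
    rw [hnorm] at h1
    simpa only [hsig] using h1
  have h2 := Finset.card_nsmul_le_sum _ _ _ hj
  rw [Finset.card_range, nsmul_eq_mul] at h2
  linarith

/-- The sample second-moment matrix is close to its mean in Frobenius norm. -/
lemma IsOpenLoop.exists_integral_dataCov_sub_le (h : IsOpenLoop μ u e Φ V δ)
    (hsys : IsSteadyState S μ x u y e) (hA : SchurStable S.A) :
    ∃ K : ℝ, 0 ≤ K ∧ ∀ ρ T N : ℕ, 1 ≤ N →
      let Q : Ω → ℝ := fun ω => ∑ q, ∑ q', (dataCov μ u y ρ T N -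
        dataMatrix u y ρ T N ω * (dataMatrix u y ρ T N ω)ᵀ) q q' ^ 2
      Integrable Q μ ∧ ∫ ω, Q ω ∂μ ≤
        K * ((Fintype.card ((Fin ρ × (Fin m ⊕ Fin p)) ⊕ (Fin T × Fin m)) : ℝ) ^ 2 *
          (|δ N| + 1 / N)) := by
  obtain ⟨K, hK0, hK⟩ := h.exists_variance_io_le hsys hA
  refine ⟨K, hK0, fun ρ T N hN => ?_⟩
  intro Q
  have hent : ∀ q q', Integrable (fun ω => (dataCov μ u y ρ T N -
      dataMatrix u y ρ T N ω * (dataMatrix u y ρ T N ω)ᵀ) q q' ^ 2) μ ∧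
      ∫ ω, (dataCov μ u y ρ T N -
        dataMatrix u y ρ T N ω * (dataMatrix u y ρ T N ω)ᵀ) q q' ^ 2 ∂μ ≤
        K * (|δ N| + 1 / N) := by
    intro q q'
    have h1 := hK (rowTime q) (rowTime q') N (rowSignal q) (rowSignal q') hN
    have h2 : (fun ω => (dataCov μ u y ρ T N -
        dataMatrix u y ρ T N ω * (dataMatrix u y ρ T N ω)ᵀ) q q' ^ 2) = fun ω =>
        ((∑ j ∈ Finset.range N, joint u y (rowTime q + j) ω (rowSignal q) *
          joint u y (rowTime q' + j) ω (rowSignal q')) / (N : ℝ) -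
        ∫ ω', (∑ j ∈ Finset.range N, joint u y (rowTime q + j) ω' (rowSignal q) *
          joint u y (rowTime q' + j) ω' (rowSignal q')) / (N : ℝ) ∂μ) ^ 2 := by
      ext ω
      rw [Matrix.sub_apply, dataCov, Matrix.of_apply]
      simp only [dataMatrix_mul_transpose_apply, regressorSample]
      ring
    rw [h2]
    exact ⟨h1.1.integrable_sq, h1.2⟩
  refine ⟨integrable_finsetSum _ fun q _ => integrable_finsetSum _ fun q' _ => (hent q q').1, ?_⟩
  simp only [Q]
  rw [integral_finsetSum _ fun q _ => integrable_finsetSum _ fun q' _ => (hent q q').1]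
  have h3 : ∀ q, ∫ ω, ∑ q', (dataCov μ u y ρ T N -
      dataMatrix u y ρ T N ω * (dataMatrix u y ρ T N ω)ᵀ) q q' ^ 2 ∂μ ≤
      Fintype.card ((Fin ρ × (Fin m ⊕ Fin p)) ⊕ (Fin T × Fin m)) * (K * (|δ N| + 1 / N)) := by
    intro q
    rw [integral_finsetSum _ fun q' _ => (hent q q').1]
    have := Finset.sum_le_card_nsmul Finset.univ _ _ fun q' _ => (hent q q').2
    simpa only [Finset.card_univ, nsmul_eq_mul] using this
  have h4 := Finset.sum_le_card_nsmul Finset.univ _ _ fun q _ => h3 q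
  simp only [Finset.card_univ, nsmul_eq_mul] at h4
  refine h4.trans (le_of_eq ?_)
  ring

/-- Future noise is nearly orthogonal to a fixed combination of the rows of the regressor, at a rate
that does not depend on the number of rows. -/
lemma IsOpenLoop.integral_noise_mulVec_le (h : IsOpenLoop μ u e Φ V δ)
    (hsys : IsSteadyState S μ x u y e) (hA : SchurStable S.A) (ρ T N : ℕ) (hN : 1 ≤ N) (v) :
    let Q : Ω → ℝ := fun ω =>
      l2 (hankel (fun s => e s ω) ρ T N *ᵥ ((dataMatrix u y ρ T N ω)ᵀ *ᵥ v)) ^ 2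
    Integrable Q μ ∧ ∫ ω, Q ω ∂μ ≤
      (∑ r : Fin T × Fin p, |V r.2 r.2|) * (v ⬝ᵥ dataCov μ u y ρ T N *ᵥ v) / N := by
  intro Q
  have hNpos : (0 : ℝ) < N := by exact_mod_cast hN
  set E : ℝ := ∑ j ∈ Finset.range N, ∫ ω, (∑ q, v q * regressorSample u y j ω q) ^ 2 ∂μ with hE
  have hE0 : 0 ≤ E := Finset.sum_nonneg fun j _ => integral_nonneg fun ω => sq_nonneg _
  have hent : ∀ r : Fin T × Fin p, Integrable (fun ω =>
      (hankel (fun s => e s ω) ρ T N *ᵥ ((dataMatrix u y ρ T N ω)ᵀ *ᵥ v)) r ^ 2) μ ∧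
      ∫ ω, (hankel (fun s => e s ω) ρ T N *ᵥ ((dataMatrix u y ρ T N ω)ᵀ *ᵥ v)) r ^ 2 ∂μ ≤
        |V r.2 r.2| * (E / N ^ 2) := by
    intro r
    obtain ⟨h1, h2⟩ := h.memLp_and_integral_noise_sq_le hsys hA v rowTime rowSignal
      (ρ + (r.1 : ℕ)) (fun q b hq => rowTime_lt r.1 q b hq) r.2 N
    simp only [hankel_mulVec_dataMatrix_transpose, div_pow]
    refine ⟨h1.integrable_sq.div_const _, ?_⟩
    rw [integral_div, ← mul_div_assoc]
    refine div_le_div_of_nonneg_right (h2.trans ?_) (by positivity)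
    exact mul_le_mul_of_nonneg_right (le_abs_self _) hE0
  simp only [Q, l2_sq]
  refine ⟨integrable_finsetSum _ fun r _ => (hent r).1, ?_⟩
  rw [integral_finsetSum _ fun r _ => (hent r).1, h.dotProduct_dataCov hsys hA]
  refine (Finset.sum_le_sum fun r _ => (hent r).2).trans (le_of_eq ?_)
  rw [← Finset.sum_mul, ← hE]
  field_simp

/-- The whole correlation matrix of the future noise and the regressor is small, at a rate
proportional to the number of rows. -/
lemma IsOpenLoop.exists_integral_noise_mul_le (h : IsOpenLoop μ u e Φ V δ)
    (hsys : IsSteadyState S μ x u y e) (hA : SchurStable S.A) (T : ℕ) :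
    ∃ K : ℝ, 0 ≤ K ∧ ∀ ρ N : ℕ, 1 ≤ N →
      let Q : Ω → ℝ := fun ω => ∑ r, ∑ q,
        (hankel (fun s => e s ω) ρ T N * (dataMatrix u y ρ T N ω)ᵀ) r q ^ 2
      Integrable Q μ ∧ ∫ ω, Q ω ∂μ ≤
        K * (Fintype.card ((Fin ρ × (Fin m ⊕ Fin p)) ⊕ (Fin T × Fin m)) / N) := by
  obtain ⟨κ, hκ0, hκ⟩ := h.exists_integral_io_sq_le hsys
  set v := ∑ r : Fin T × Fin p, |V r.2 r.2| with hv
  have hv0 : 0 ≤ v := Finset.sum_nonneg fun r _ => abs_nonneg _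
  refine ⟨v * κ, by positivity, fun ρ N hN => ?_⟩
  intro Q
  have hNpos : (0 : ℝ) < N := by exact_mod_cast hN
  have hent : ∀ (r : Fin T × Fin p) q, Integrable (fun ω =>
      (hankel (fun s => e s ω) ρ T N * (dataMatrix u y ρ T N ω)ᵀ) r q ^ 2) μ ∧
      ∫ ω, (hankel (fun s => e s ω) ρ T N * (dataMatrix u y ρ T N ω)ᵀ) r q ^ 2 ∂μ ≤
        |V r.2 r.2| * (κ / N) := by
    intro r q
    obtain ⟨h1, h2⟩ := h.memLp_and_integral_noise_sq_le hsys hA (κ := Unit) (fun _ => 1)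
      (fun _ => rowTime q) (fun _ => rowSignal q) (ρ + (r.1 : ℕ))
      (fun _ b hq => rowTime_lt r.1 q b hq) r.2 N
    simp only [Finset.univ_unique, Finset.sum_singleton, one_mul] at h1 h2
    simp only [hankel_mul_dataMatrix_transpose_apply, div_pow]
    refine ⟨h1.integrable_sq.div_const _, ?_⟩
    rw [integral_div, div_le_iff₀ (by positivity)]
    refine h2.trans ?_
    have h3 : ∑ j ∈ Finset.range N, ∫ ω, joint u y (rowTime q + j) ω (rowSignal q) ^ 2 ∂μ
        ≤ N * κ := by
      calc ∑ j ∈ Finset.range N, ∫ ω, joint u y (rowTime q + j) ω (rowSignal q) ^ 2 ∂μ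
          ≤ ∑ j ∈ Finset.range N, κ := Finset.sum_le_sum fun j _ => hκ _ _
        _ = N * κ := by simp
    have h4 : 0 ≤ ∑ j ∈ Finset.range N, ∫ ω, joint u y (rowTime q + j) ω (rowSignal q) ^ 2 ∂μ :=
      Finset.sum_nonneg fun j _ => integral_nonneg fun ω => sq_nonneg _
    calc V r.2 r.2 * ∑ j ∈ Finset.range N, ∫ ω, joint u y (rowTime q + j) ω (rowSignal q) ^ 2 ∂μ
        ≤ |V r.2 r.2| * (N * κ) := mul_le_mul (le_abs_self _) h3 h4 (abs_nonneg _)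
      _ = |V r.2 r.2| * (κ / N) * N ^ 2 := by field_simp
  refine ⟨integrable_finsetSum _ fun r _ => integrable_finsetSum _ fun q _ => (hent r q).1, ?_⟩
  simp only [Q]
  rw [integral_finsetSum _ fun r _ => integrable_finsetSum _ fun q _ => (hent r q).1]
  calc ∑ r : Fin T × Fin p, ∫ ω, ∑ q,
        (hankel (fun s => e s ω) ρ T N * (dataMatrix u y ρ T N ω)ᵀ) r q ^ 2 ∂μ
      ≤ ∑ r : Fin T × Fin p, |V r.2 r.2| *
        (Fintype.card ((Fin ρ × (Fin m ⊕ Fin p)) ⊕ (Fin T × Fin m)) * (κ / N)) := by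
        refine Finset.sum_le_sum fun r _ => ?_
        rw [integral_finsetSum _ fun q _ => (hent r q).1]
        have := Finset.sum_le_card_nsmul Finset.univ _ _ fun q _ => (hent r q).2
        simp only [Finset.card_univ, nsmul_eq_mul] at this
        refine this.trans (le_of_eq (by ring))
    _ = v * κ * (Fintype.card ((Fin ρ × (Fin m ⊕ Fin p)) ⊕ (Fin T × Fin m)) / N) := by
        rw [← Finset.sum_mul, ← hv]
        ring

end DataMatrices

/-! ### The prediction error -/

/-- The prediction error of a combination `α` of recorded trajectories that reproduces the data of the
online experiment, bounded by the damped mismatch of the initial states and the noise picked up. -/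
lemma InnovModel.exists_prediction_error_le {n m p : ℕ} (S : InnovModel n m p) (T : ℕ) :
    ∃ C : ℝ, 0 ≤ C ∧ ∀ {x : ℤ → Fin n → ℝ} {u : ℤ → Fin m → ℝ} {y e : ℤ → Fin p → ℝ},
      S.IsTrajectory x u y e → ∀ (ρ N : ℕ) (α : Fin N → ℝ) (ξ : Fin n → ℝ)
      (zinit : Fin ρ × (Fin m ⊕ Fin p) → ℝ) (uf : Fin T × Fin m → ℝ),
      regressor u y ρ T N *ᵥ α = Sum.elim zinit uf →
      l2 (S.futureLin T (S.stateAfter ξ ρ zinit, uf, 0) - hankel y ρ T N *ᵥ α) ≤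
        C * (‖(S.A - S.K * S.C) ^ ρ‖ * l2 (ξ - initialStates x N *ᵥ α) +
          l2 (hankel e ρ T N *ᵥ α)) := by
  obtain ⟨C₁, hC₁, h₁⟩ := exists_l2_le_of_linear
    (LinearMap.inl ℝ (Fin n → ℝ) ((Fin T × Fin m → ℝ) × (Fin T × Fin p → ℝ))) (S.futureLin T)
  obtain ⟨C₂, hC₂, h₂⟩ := exists_l2_le_of_linear
    (LinearMap.inr ℝ (Fin n → ℝ) ((Fin T × Fin m → ℝ) × (Fin T × Fin p → ℝ)) ∘ₗ
      LinearMap.inr ℝ (Fin T × Fin m → ℝ) (Fin T × Fin p → ℝ)) (S.futureLin T)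
  refine ⟨C₁ + C₂, by positivity, fun {x u y e} htraj ρ N α ξ zinit uf hα => ?_⟩
  rw [htraj.mean_sub_hankel_mulVec ρ T N α ξ zinit uf hα]
  set a := (S.A - S.K * S.C) ^ ρ *ᵥ (ξ - initialStates x N *ᵥ α)
  set b := hankel e ρ T N *ᵥ α
  have hsplit : S.futureLin T (a, 0, -b) = S.futureLin T (a, 0) + S.futureLin T (0, 0, -b) := by
    rw [← map_add]
    congr 1
    simp
  have ha : l2 (S.futureLin T (a, 0)) ≤ C₁ * l2 a := h₁ a
  have hb : l2 (S.futureLin T (0, 0, -b)) ≤ C₂ * l2 b := by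
    rw [← l2_neg b]; exact h₂ (-b)
  have ha' : l2 a ≤ ‖(S.A - S.K * S.C) ^ ρ‖ * l2 (ξ - initialStates x N *ᵥ α) := l2_mulVec_le _ _
  have hb0 := l2_nonneg b
  have ha0 := (l2_nonneg a).trans ha'
  rw [hsplit]
  calc l2 (S.futureLin T (a, 0) + S.futureLin T (0, 0, -b))
      ≤ C₁ * l2 a + C₂ * l2 b := (l2_add_le _ _).trans (add_le_add ha hb)
    _ ≤ C₁ * (‖(S.A - S.K * S.C) ^ ρ‖ * l2 (ξ - initialStates x N *ᵥ α)) + C₂ * l2 b :=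
        add_le_add_left (mul_le_mul_of_nonneg_left ha' hC₁) _
    _ ≤ _ := by nlinarith [mul_nonneg hC₁ hb0, mul_nonneg hC₂ ha0]

/-- Growth of the number `d` of rows of the regressor against the sampling errors
`σ = |δ_N| + 1 / N`: `d³ σ` stays bounded and `d² σ` vanishes. -/
lemma exists_rows_bound {δ : ℕ → ℝ} {ρ : ℕ → ℕ} {a b : ℕ} (hδ : Tendsto δ atTop (𝓝 0))
    (hρ : (fun N : ℕ => (ρ N : ℝ) ^ 3) =O[atTop] (fun N : ℕ => (N : ℝ)))
    (hρδ : (fun N : ℕ => (ρ N : ℝ) ^ 3 * δ N) =O[atTop] (fun _ : ℕ => (1 : ℝ))) :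
    ∃ D : ℝ, 0 ≤ D ∧
      (∀ᶠ N : ℕ in atTop, ((ρ N * a + b : ℕ) : ℝ) ^ 3 * (|δ N| + 1 / N) ≤ D) ∧
      ∀ τ : ℝ, 0 < τ →
        ∀ᶠ N : ℕ in atTop, ((ρ N * a + b : ℕ) : ℝ) ^ 2 * (|δ N| + 1 / N) ≤ τ := by
  obtain ⟨c₁, hc₁, h₁⟩ := hρ.exists_nonneg
  obtain ⟨c₂, hc₂, h₂⟩ := hρδ.exists_nonneg
  have hσ : Tendsto (fun N : ℕ => |δ N| + 1 / (N : ℝ)) atTop (𝓝 0) := by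
    have h3 := hδ.abs.add tendsto_one_div_atTop_nhds_zero_nat
    simpa using h3
  set D : ℝ := ((a : ℝ) + b) ^ 3 * 4 * (c₁ + c₂ + 1) with hD
  have hD0 : 0 ≤ D := by positivity
  have hbd : ∀ᶠ N : ℕ in atTop, ((ρ N * a + b : ℕ) : ℝ) ^ 3 * (|δ N| + 1 / N) ≤ D := by
    filter_upwards [h₁.bound, h₂.bound, hσ.eventually (gt_mem_nhds one_pos), eventually_gt_atTop 0]
      with N h3 h4 h5 hN
    have hNpos : (0 : ℝ) < N := by exact_mod_cast hN
    have hρ0 : (0 : ℝ) ≤ ρ N := Nat.cast_nonneg _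
    rw [Real.norm_eq_abs, Real.norm_eq_abs, abs_of_nonneg (by positivity),
      abs_of_nonneg hNpos.le] at h3
    rw [Real.norm_eq_abs, norm_one, mul_one, abs_mul, abs_of_nonneg (by positivity)] at h4
    have h6 : (ρ N : ℝ) ^ 3 * (1 / N) ≤ c₁ := by
      rw [mul_one_div, div_le_iff₀ hNpos]; exact h3
    have hσ0 : 0 ≤ |δ N| + 1 / (N : ℝ) := by positivity
    have h7 : ((ρ N * a + b : ℕ) : ℝ) ≤ ((a : ℝ) + b) * (ρ N + 1) := by
      push_cast
      have ha : (0 : ℝ) ≤ a := Nat.cast_nonneg _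
      have hb : (0 : ℝ) ≤ b := Nat.cast_nonneg _
      nlinarith [mul_nonneg hb hρ0]
    have h8 : ((ρ N : ℝ) + 1) ^ 3 ≤ 4 * ((ρ N : ℝ) ^ 3 + 1) := by
      nlinarith [mul_nonneg (sq_nonneg ((ρ N : ℝ) - 1)) (by positivity : (0 : ℝ) ≤ ρ N + 1)]
    calc ((ρ N * a + b : ℕ) : ℝ) ^ 3 * (|δ N| + 1 / N)
        ≤ (((a : ℝ) + b) * (ρ N + 1)) ^ 3 * (|δ N| + 1 / N) :=
          mul_le_mul_of_nonneg_right (pow_le_pow_left₀ (Nat.cast_nonneg _) h7 3) hσ0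
      _ = ((a : ℝ) + b) ^ 3 * (((ρ N : ℝ) + 1) ^ 3 * (|δ N| + 1 / N)) := by ring
      _ ≤ ((a : ℝ) + b) ^ 3 * (4 * ((ρ N : ℝ) ^ 3 + 1) * (|δ N| + 1 / N)) := by gcongr
      _ = ((a : ℝ) + b) ^ 3 * 4 * ((ρ N : ℝ) ^ 3 * (1 / N) + (ρ N : ℝ) ^ 3 * |δ N| +
            (|δ N| + 1 / N)) := by ring
      _ ≤ D := by rw [hD]; gcongr
  refine ⟨D, hD0, hbd, fun τ hτ => ?_⟩
  -- `(d² σ)³ = (d³ σ)² σ`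
  have hlim : Tendsto (fun N : ℕ => D ^ 2 * (|δ N| + 1 / (N : ℝ))) atTop (𝓝 0) := by
    simpa using hσ.const_mul (D ^ 2)
  filter_upwards [hbd, hlim.eventually (gt_mem_nhds (pow_pos hτ 3))] with N h3 h4
  set d : ℝ := ((ρ N * a + b : ℕ) : ℝ)
  have hd : 0 ≤ d := Nat.cast_nonneg _
  have hσ0 : 0 ≤ |δ N| + 1 / (N : ℝ) := by positivity
  refine le_of_pow_le_pow_left₀ (n := 3) (by norm_num) hτ.le ?_
  calc (d ^ 2 * (|δ N| + 1 / (N : ℝ))) ^ 3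
      = (d ^ 3 * (|δ N| + 1 / (N : ℝ))) ^ 2 * (|δ N| + 1 / (N : ℝ)) := by ring
    _ ≤ D ^ 2 * (|δ N| + 1 / (N : ℝ)) := by gcongr
    _ ≤ τ ^ 3 := h4.le

/-- Off four exceptional events of small probability the prediction error has the claimed size. The
number of rows of the regressor is `d`, and `Q₁, …, Q₄` are the squared norms that the events
bound: of the fluctuation of the Gram matrix, of the correlation of noise and regressor, of the
correlation of the noise with the optimal combination of the rows, and of the initial states. -/
lemma prediction_error_le_of_bounds {C c η k₁ k₂ k₃ k₄ D d σ N a R Q₁ Q₂ Q₃ Q₄ ξ w v α f g E : ℝ}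
    (hC : 0 ≤ C) (hc : 0 < c) (hη : 0 < η) (hk₁ : 0 ≤ k₁) (hk₂ : 0 ≤ k₂) (hk₃ : 0 ≤ k₃)
    (hd : 0 ≤ d) (hN : 0 < N) (ha : 0 ≤ a) (hD : d ^ 3 * σ ≤ D)
    (hξ : 0 ≤ ξ) (hw : 0 ≤ w) (hα0 : 0 ≤ α)
    (hQ₁ : Q₁ ≤ k₁ * (d ^ 2 * σ) / η) (hQ₂ : Q₂ ≤ k₂ * (d / N) / η)
    (hQ₃ : Q₃ ≤ k₃ * w ^ 2 / N / η) (hQ₄ : Q₄ ≤ k₄ / η)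
    (hv : v ≤ w / c) (hα : α ^ 2 ≤ 2 / c * w ^ 2) (hf : f ^ 2 ≤ Q₃) (hg : g ≤ 2 / c * (√Q₁ * v))
    (hR : R ≤ ξ + √Q₄ * α) (hE : E ≤ C * (a * R + (f + √Q₂ * g))) :
    E ≤ C * (1 + √(k₄ / η) * √(2 / c) + √(k₃ / η) + 2 / c ^ 2 * √(k₁ * k₂ * D / η ^ 2)) *
      (1 / √N + a) * (ξ + w) := by
  have hsN : 0 < √N := Real.sqrt_pos.mpr hN
  have h1 : α ≤ √(2 / c) * w := by
    refine abs_le_of_sq_le_sq' ?_ (by positivity) |>.2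
    rw [mul_pow, Real.sq_sqrt (by positivity)]
    exact hα
  have h2 : R ≤ ξ + √(k₄ / η) * √(2 / c) * w := by
    refine hR.trans (add_le_add_right ?_ _)
    rw [mul_assoc]
    exact mul_le_mul (Real.sqrt_le_sqrt hQ₄) h1 hα0 (Real.sqrt_nonneg _)
  have h3 : f ≤ √(k₃ / η) * (1 / √N) * w := by
    refine abs_le_of_sq_le_sq' ?_ (by positivity) |>.2
    rw [mul_pow, mul_pow, Real.sq_sqrt (by positivity), div_pow, Real.sq_sqrt hN.le, one_pow]
    refine (hf.trans hQ₃).trans (le_of_eq ?_)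
    field_simp
  have h4 : √Q₂ * √Q₁ ≤ √(k₁ * k₂ * D / η ^ 2) * (1 / √N) := by
    calc √Q₂ * √Q₁ ≤ √(k₂ * (d / N) / η) * √(k₁ * (d ^ 2 * σ) / η) :=
          mul_le_mul (Real.sqrt_le_sqrt hQ₂) (Real.sqrt_le_sqrt hQ₁) (Real.sqrt_nonneg _)
            (Real.sqrt_nonneg _)
      _ = √(k₁ * k₂ * (d ^ 3 * σ) / η ^ 2 / N) := by
          rw [← Real.sqrt_mul (by positivity)]
          congr 1
          field_simp
      _ ≤ √(k₁ * k₂ * D / η ^ 2 / N) := by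
          refine Real.sqrt_le_sqrt ?_
          gcongr
      _ = _ := by rw [Real.sqrt_div' _ hN.le, mul_one_div]
  have h5 : √Q₂ * g ≤ 2 / c ^ 2 * √(k₁ * k₂ * D / η ^ 2) * (1 / √N) * w := by
    calc √Q₂ * g ≤ √Q₂ * (2 / c * (√Q₁ * (w / c))) := by
          refine mul_le_mul_of_nonneg_left (hg.trans ?_) (Real.sqrt_nonneg _)
          gcongr
      _ = 2 / c ^ 2 * (√Q₂ * √Q₁) * w := by field_simp
      _ ≤ 2 / c ^ 2 * (√(k₁ * k₂ * D / η ^ 2) * (1 / √N)) * w := by gcongr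
      _ = _ := by ring
  set A := √(k₄ / η) * √(2 / c) with hA
  set B := √(k₃ / η) with hB
  set F := 2 / c ^ 2 * √(k₁ * k₂ * D / η ^ 2) with hF
  have hA0 : 0 ≤ A := by positivity
  have hB0 : 0 ≤ B := by positivity
  have hF0 : 0 ≤ F := by positivity
  have hr : 0 ≤ 1 / √N := by positivity
  set r := 1 / √N
  calc E ≤ C * (a * (ξ + A * w) + (B * r * w + F * r * w)) := by
        refine hE.trans (mul_le_mul_of_nonneg_left ?_ hC)
        exact add_le_add (mul_le_mul_of_nonneg_left h2 ha) (add_le_add h3 h5)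
    _ ≤ C * ((1 + A + B + F) * (r + a) * (ξ + w)) := by
        refine mul_le_mul_of_nonneg_left ?_ hC
        have e1 : (1 + A + B + F) * (r + a) * (ξ + w)
            - (a * (ξ + A * w) + (B * r * w + F * r * w))
            = a * w + (A + B + F) * a * ξ + (B + F) * a * w + (1 + A + B + F) * r * ξ
              + (1 + A) * r * w := by ring
        have e2 : 0 ≤ a * w + (A + B + F) * a * ξ + (B + F) * a * w + (1 + A + B + F) * r * ξ
              + (1 + A) * r * w := by positivity
        linarith
    _ = _ := by ring

section PredictionError

variable {Ω : Type*} [MeasurableSpace Ω] {μ : Measure Ω} [IsProbabilityMeasure μ]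
  {n m p : ℕ} {S : InnovModel n m p} {x : ℤ → Ω → Fin n → ℝ}
  {u : ℤ → Ω → Fin m → ℝ} {y e : ℤ → Ω → Fin p → ℝ}
  {Φ : ℝ → Matrix (Fin m) (Fin m) ℂ} {V : Matrix (Fin p) (Fin p) ℝ} {δ : ℕ → ℝ}

/-- The prediction error for arbitrary past horizons. -/
lemma IsOpenLoop.predictionErrorBigOP (h : IsOpenLoop μ u e Φ V δ)
    (hsys : IsSteadyState S μ x u y e) (hA : SchurStable S.A)
    (hAKC : SchurStable (S.A - S.K * S.C)) (hΦ : BoundedAwayFromZero Φ) (hV : V.PosDef)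
    (T : ℕ) (ρ : ℕ → ℕ)
    (hρ : (fun N : ℕ => (ρ N : ℝ) ^ 3) =O[atTop] (fun N : ℕ => (N : ℝ)))
    (hρδ : (fun N : ℕ => (ρ N : ℝ) ^ 3 * δ N) =O[atTop] (fun _ : ℕ => (1 : ℝ))) :
    PredictionErrorBigOP S μ u y e T ρ
      (fun N => 1 / √(N : ℝ) + ‖(S.A - S.K * S.C) ^ ρ N‖) := by
  intro ε hε
  obtain ⟨C, hC, herr⟩ := S.exists_prediction_error_le T
  obtain ⟨c, hc, hcoer⟩ := h.exists_dataCov_coercive hsys hA hAKC hΦ hV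
  obtain ⟨k₁, hk₁, hQ₁⟩ := h.exists_integral_dataCov_sub_le hsys hA
  obtain ⟨k₂, hk₂, hQ₂⟩ := h.exists_integral_noise_mul_le hsys hA T
  obtain ⟨k₄, hk₄, hQ₄⟩ := hsys.exists_integral_initialStates_le
  obtain ⟨D, hD0, hD, hsmall⟩ := exists_rows_bound (a := m + p) (b := T * m) h.erg.tendsto hρ hρδ
  set v₀ := ∑ r : Fin T × Fin p, |V r.2 r.2| with hv₀
  have hv₀0 : 0 ≤ v₀ := Finset.sum_nonneg fun r _ => abs_nonneg _
  set η := ε / 4 with hη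
  have hηpos : 0 < η := by positivity
  set k₃ := v₀ / c with hk₃
  have hτ : 0 < (c / 2) ^ 2 * η / (k₁ + 1) := by positivity
  refine ⟨C * (1 + √(k₄ / η) * √(2 / c) + √(k₃ / η) + 2 / c ^ 2 * √(k₁ * k₂ * D / η ^ 2)), ?_⟩
  obtain ⟨N₀, hN₀⟩ := eventually_atTop.mp ((hD.and (hsmall _ hτ)).and (eventually_ge_atTop 1))
  refine ⟨N₀, fun N hN t ξ zinit uf => ?_⟩
  obtain ⟨⟨hDN, hsmallN⟩, hN1⟩ := hN₀ N hN
  have hNpos : (0 : ℝ) < N := by exact_mod_cast hN1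
  have hcard : Fintype.card ((Fin (ρ N) × (Fin m ⊕ Fin p)) ⊕ (Fin T × Fin m))
      = ρ N * (m + p) + T * m := by simp
  set σ : ℝ := |δ N| + 1 / N with hσ
  set d : ℝ := ((ρ N * (m + p) + T * m : ℕ) : ℝ) with hd
  have hσ0 : 0 ≤ σ := by positivity
  set w : (Fin (ρ N) × (Fin m ⊕ Fin p)) ⊕ (Fin T × Fin m) → ℝ := Sum.elim zinit uf with hw
  obtain ⟨v, hv⟩ := exists_mulVec_eq_of_coercive hc (hcoer (ρ N) T N hN1) w
  have hvw : l2 v ≤ l2 w / c := by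
    have := l2_le_of_coercive (hcoer (ρ N) T N hN1) v
    rw [hv] at this
    rw [le_div_iff₀ hc]; linarith
  -- the four exceptional events
  obtain ⟨hi₁, hb₁⟩ := hQ₁ (ρ N) T N hN1
  obtain ⟨hi₂, hb₂⟩ := hQ₂ (ρ N) N hN1
  obtain ⟨hi₃, hb₃⟩ := h.integral_noise_mulVec_le hsys hA (ρ N) T N hN1 v
  obtain ⟨hi₄, hb₄⟩ := hQ₄ N
  rw [hcard] at hb₁ hb₂
  have hb₃' : ∫ ω, l2 (hankel (fun s => e s ω) (ρ N) T N *ᵥ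
      ((dataMatrix u y (ρ N) T N ω)ᵀ *ᵥ v)) ^ 2 ∂μ ≤ k₃ * l2 w ^ 2 / N := by
    refine hb₃.trans (div_le_div_of_nonneg_right ?_ hNpos.le)
    rw [hv, hk₃, div_mul_eq_mul_div, mul_div_assoc]
    refine mul_le_mul_of_nonneg_left ((dotProduct_le_l2 v w).trans ?_) hv₀0
    have := mul_le_mul_of_nonneg_right hvw (l2_nonneg w)
    refine this.trans (le_of_eq ?_)
    ring
  obtain ⟨B₁, hm₁, hB₁⟩ := exists_measure_le_of_integral_le hi₁ (fun ω =>
    Finset.sum_nonneg fun q _ => Finset.sum_nonneg fun q' _ => sq_nonneg _) hb₁ hηpos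
  obtain ⟨B₂, hm₂, hB₂⟩ := exists_measure_le_of_integral_le hi₂ (fun ω =>
    Finset.sum_nonneg fun q _ => Finset.sum_nonneg fun q' _ => sq_nonneg _) hb₂ hηpos
  obtain ⟨B₃, hm₃, hB₃⟩ := exists_measure_le_of_integral_le hi₃ (fun ω => sq_nonneg _) hb₃' hηpos
  obtain ⟨B₄, hm₄, hB₄⟩ := exists_measure_le_of_integral_le hi₄ (fun ω =>
    Finset.sum_nonneg fun q _ => Finset.sum_nonneg fun q' _ => sq_nonneg _) hb₄ hηpos
  set B₀ : Set Ω := {ω | ¬ S.IsTrajectory (fun t => x t ω) (fun t => u t ω) (fun t => y t ω)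
    (fun t => e t ω)} with hB₀
  have hm₀ : μ B₀ = 0 := ae_iff.mp hsys.ae_isTrajectory
  have hsub : {ω | ¬ ∃ α : Fin N → ℝ,
      IsMinNormSolution (regressor (fun s => u s ω) (fun s => y s ω) (ρ N) T N)
        (Sum.elim zinit uf) α ∧
      l2 (S.meanOutput μ e t T (S.stateAfter ξ (ρ N) zinit) uf
          - projOutput (fun s => u s ω) (fun s => y s ω) (ρ N) T N *ᵥ α)
        ≤ C * (1 + √(k₄ / η) * √(2 / c) + √(k₃ / η) + 2 / c ^ 2 * √(k₁ * k₂ * D / η ^ 2)) *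
          (1 / √(N : ℝ) + ‖(S.A - S.K * S.C) ^ ρ N‖) * (l2 ξ + l2 zinit + l2 uf)} ⊆
      B₀ ∪ (B₁ ∪ (B₂ ∪ (B₃ ∪ B₄))) := by
    intro ω hω
    by_contra hnot
    simp only [Set.mem_union, not_or] at hnot
    obtain ⟨n0, n1, n2, n3, n4⟩ := hnot
    apply hω
    have htraj : S.IsTrajectory (fun t => x t ω) (fun t => u t ω) (fun t => y t ω)
      (fun t => e t ω) := not_not.mp n0
    have q1 := hB₁ ω n1
    have q2 := hB₂ ω n2
    have q3 := hB₃ ω n3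
    have q4 := hB₄ ω n4
    set W := dataMatrix u y (ρ N) T N ω with hW
    set Q₁ := ∑ q, ∑ q', (dataCov μ u y (ρ N) T N - W * Wᵀ) q q' ^ 2 with hQ₁def
    have hQ₁c : √Q₁ ≤ c / 2 := by
      rw [Real.sqrt_le_left (by positivity)]
      refine q1.trans ?_
      rw [div_le_iff₀ hηpos]
      have h1 := mul_le_mul_of_nonneg_left hsmallN hk₁
      refine h1.trans ?_
      rw [mul_div_assoc', div_le_iff₀ (by positivity)]
      nlinarith [show 0 < (c / 2) ^ 2 * η by positivity]
    obtain ⟨g, hmin, hαle, hgv⟩ := exists_isMinNormSolution W hc (hcoer (ρ N) T N hN1) hQ₁c hv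
    refine ⟨Wᵀ *ᵥ g, hmin, ?_⟩
    rw [h.meanOutput_eq, projOutput]
    have hproj := rowProj_mulVec_transpose W (hankel (fun s => y s ω) (ρ N) T N) g
    rw [hW, dataMatrix] at hproj
    rw [hW, dataMatrix, hproj]
    have hE := herr htraj (ρ N) N (Wᵀ *ᵥ g) ξ zinit uf hmin.1
    rw [hW, dataMatrix] at hE
    refine le_trans (b := C * (1 + √(k₄ / η) * √(2 / c) + √(k₃ / η) +
      2 / c ^ 2 * √(k₁ * k₂ * D / η ^ 2)) * (1 / √(N : ℝ) + ‖(S.A - S.K * S.C) ^ ρ N‖) *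
      (l2 ξ + l2 w)) ?_ ?_
    · set Eh := hankel (fun s => e s ω) (ρ N) T N with hEh
      set X₀ := InnovModel.initialStates (fun t => x t ω) N with hX₀
      have hR : l2 (ξ - X₀ *ᵥ (Wᵀ *ᵥ g)) ≤ l2 ξ + √(∑ i, ∑ j, X₀ i j ^ 2) * l2 (Wᵀ *ᵥ g) :=
        (l2_sub_le _ _).trans (add_le_add_right (l2_mulVec_le_sqrt _ _) _)
      have hnoise : l2 (Eh *ᵥ (Wᵀ *ᵥ g)) ≤ l2 (Eh *ᵥ (Wᵀ *ᵥ v)) +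
          √(∑ r, ∑ q, (Eh * Wᵀ) r q ^ 2) * l2 (g - v) := by
        have h1 : Eh *ᵥ (Wᵀ *ᵥ g) = Eh *ᵥ (Wᵀ *ᵥ v) + (Eh * Wᵀ) *ᵥ (g - v) := by
          rw [← Matrix.mulVec_mulVec, Matrix.mulVec_sub, Matrix.mulVec_sub]
          abel
        rw [h1]
        exact (l2_add_le _ _).trans (add_le_add_right (l2_mulVec_le_sqrt _ _) _)
      refine prediction_error_le_of_bounds (d := d) (σ := σ) hC hc hηpos hk₁ hk₂
        (div_nonneg hv₀0 hc.le) (Nat.cast_nonneg _) hNpos (norm_nonneg _) hDN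
        (l2_nonneg ξ) (l2_nonneg w) (l2_nonneg _) q1 q2 q3 q4 hvw hαle le_rfl hgv hR
        (hE.trans ?_)
      exact mul_le_mul_of_nonneg_left (add_le_add_right hnoise _) hC
    · have h1 : l2 ξ + l2 w ≤ l2 ξ + l2 zinit + l2 uf := by
        have := l2_sumElim_le zinit uf
        linarith
      exact mul_le_mul_of_nonneg_left h1 (by positivity)
  calc _ ≤ μ (B₀ ∪ (B₁ ∪ (B₂ ∪ (B₃ ∪ B₄)))) := measure_mono hsub
    _ ≤ μ B₀ + (μ B₁ + (μ B₂ + (μ B₃ + μ B₄))) := by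
        refine (measure_union_le _ _).trans (add_le_add_right ?_ _)
        refine (measure_union_le _ _).trans (add_le_add_right ?_ _)
        refine (measure_union_le _ _).trans (add_le_add_right ?_ _)
        exact measure_union_le _ _
    _ ≤ 0 + (ENNReal.ofReal η + (ENNReal.ofReal η + (ENNReal.ofReal η + ENNReal.ofReal η))) :=
        add_le_add hm₀.le (add_le_add hm₁ (add_le_add hm₂ (add_le_add hm₃ hm₄)))
    _ = ENNReal.ofReal ε := by
        rw [zero_add, ← ENNReal.ofReal_add hηpos.le hηpos.le,
          ← ENNReal.ofReal_add hηpos.le (by positivity),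
          ← ENNReal.ofReal_add hηpos.le (by positivity)]
        congr 1
        rw [hη]; ring

end PredictionError

/-- A rate may be replaced by one that eventually dominates it up to a constant. -/
lemma PredictionErrorBigOP.mono {Ω : Type*} [MeasurableSpace Ω] {μ : Measure Ω} {n m p : ℕ}
    {S : InnovModel n m p} {u : ℤ → Ω → Fin m → ℝ} {y e : ℤ → Ω → Fin p → ℝ} {T : ℕ} {ρ : ℕ → ℕ}
    {r r' : ℕ → ℝ} {c : ℝ} (h : PredictionErrorBigOP S μ u y e T ρ r) (hr : ∀ N, 0 ≤ r N)
    (hrr : ∀ᶠ N in atTop, r N ≤ c * r' N) : PredictionErrorBigOP S μ u y e T ρ r' := by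
  intro ε hε
  obtain ⟨M, N₀, hM⟩ := h ε hε
  obtain ⟨N₁, hN₁⟩ := eventually_atTop.mp hrr
  refine ⟨|M| * c, max N₀ N₁, fun N hN t ξ zinit uf => ?_⟩
  refine le_trans (measure_mono fun ω hω => ?_) (hM N (le_trans (le_max_left _ _) hN) t ξ zinit uf)
  rintro ⟨α, hα, hle⟩
  refine hω ⟨α, hα, hle.trans ?_⟩
  refine mul_le_mul_of_nonneg_right ?_
    (add_nonneg (add_nonneg (l2_nonneg _) (l2_nonneg _)) (l2_nonneg _))
  calc M * r N ≤ |M| * r N := mul_le_mul_of_nonneg_right (le_abs_self M) (hr N)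
    _ ≤ |M| * (c * r' N) :=
        mul_le_mul_of_nonneg_left (hN₁ N (le_trans (le_max_right _ _) hN)) (abs_nonneg M)
    _ = |M| * c * r' N := by ring

end

theorem theorem2 {Ω : Type*} [MeasurableSpace Ω] (μ : Measure Ω) [IsProbabilityMeasure μ]
    {n m p : ℕ} (S : InnovModel n m p)
    (x : ℤ → Ω → Fin n → ℝ) (u : ℤ → Ω → Fin m → ℝ) (y e : ℤ → Ω → Fin p → ℝ)
    (Φ : ℝ → Matrix (Fin m) (Fin m) ℂ) (V : Matrix (Fin p) (Fin p) ℝ)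
    (hA : SchurStable S.A) (hAKC : SchurStable (S.A - S.K * S.C))
    (hu_meas : ∀ t, Measurable (u t))
    (hu_spec : HasSpectralDensity μ u Φ) (hu_pos : BoundedAwayFromZero Φ)
    (δ : ℕ → ℝ) (hu_erg : SecondOrderErgodic μ u δ)
    (he : IsInnovation μ u e V) (hV : V.PosDef)
    (hsys : IsSteadyState S μ x u y e)
    (T : ℕ) (ρ : ℕ → ℕ)
    (hρ : (fun N : ℕ => (ρ N : ℝ) ^ 3) =O[atTop] (fun N : ℕ => (N : ℝ)))
    (hρδ : (fun N : ℕ => (ρ N : ℝ) ^ 3 * δ N) =O[atTop] (fun _ : ℕ => (1 : ℝ))) :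
    ((fun N : ℕ => ‖(S.A - S.K * S.C) ^ ρ N‖) =o[atTop] (fun N : ℕ => 1 / √(N : ℝ)) →
      PredictionErrorBigOP S μ u y e T ρ (fun N => 1 / √(N : ℝ))) ∧
    PredictionErrorBigOP S μ u y e T ρ
      (fun N => 1 / √(N : ℝ) + ‖(S.A - S.K * S.C) ^ ρ N‖) := by
  have h : IsOpenLoop μ u e Φ V δ := ⟨hu_meas, hu_spec, hu_erg, he⟩
  have h2 := h.predictionErrorBigOP hsys hA hAKC hu_pos hV T ρ hρ hρδ
  refine ⟨fun hK => h2.mono (c := 2) (fun N => by positivity) ?_, h2⟩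
  filter_upwards [hK.bound one_pos] with N hN
  rw [one_mul, norm_norm, Real.norm_of_nonneg (by positivity)] at hN
  linarith
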